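/- A \emph{2-complex} is a connected CW-complex of dimension at most 2. An \emph{immersion} $f\colon \mathcal C\to\mathcal B$ of 2-complexes is a continuous cellular map, carrying each open $n$-cell bijectively onto an open $n$-cell, such that each point has a neighborhood $U$ which $f$ maps homeomorphically onto $f(U)$. Let $X$ and $P$ be sets. Let $B_{X,P}$ be a 2-complex with one $0$-cell, with $1$-cells (each with an orientation) labeled bijectively by $X$, and with $2$-cells labeled bijectively by $P$, such that the attaching map of the $2$-cell $\rho\in P$, read from a chosen root on the boundary circle, is a closed edge path labeled by a word $bl(\rho)\in (X\cup X^{-1})^*$ (possibly empty, in which case the attaching map is constant). Let $$M_{X,P}=\mathrm{Inv}\langle X\cup P \mid \rho^2=\rho,\ \rho\le bl(\rho)\ (\rho\in P)\rangle ,$$ where $\le$ is the natural partial order of inverse monoids ($a\le b$ iff $a=eb$ for an idempotent $e$). A \emph{closed inverse submonoid} of $M_{X,P}$ is a submonoid that is closed under inverses and upward closed for $\le$. Two closed inverse submonoids $H,K$ are \emph{conjugate} if there is $m\in M_{X,P}$ with $m^{-1}Hm\subseteq K$ and $mKm^{-1}\subseteq H$; the classes of this equivalence relation are called conjugacy classes.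 An immersion $f\colon\mathcal C\to B_{X,P}$ labels the oriented $1$-cells of $\mathcal C$ over $X\cup X^{-1}$ and the $2$-cells over $P$, and lifts the root of each $2$-cell $\rho$ to a root of each $2$-cell of $\mathcal C$ labeled $\rho$. Let $\Gamma_{\mathcal C}$ be the labeled graph whose vertices are the $0$-cells of $\mathcal C$ and whose edges are the $1$-cells together with, for each $2$-cell $C$, a loop $e_C$ at the root of $C$ with the label of $C$. Let $\sim$ be the congruence on the free category on $\Gamma_{\mathcal C}$ (with inverse edges) generated by $p=pp^{-1}p$, $pp^{-1}qq^{-1}=qq^{-1}pp^{-1}$ (for $p,q$ with a common initial vertex), and $p^2=p$, $p=pq$ whenever $p,q$ are coterminal paths such that $p$ is labeled by some $\rho\in P$ and $q$ is labeled by $bl(\rho)$. The \emph{loop monoid} $L(\mathcal C,v)$ is the monoid of $\sim$-classes of closed paths at the $0$-cell $v$. \textbf{Theorem.} (1) Let $f\colon \mathcal C\to B_{X,P}$ be an immersion of a 2-complex. For each $0$-cell $v$, reading labels gives an injective homomorphism $L(\mathcal C,v)\to M_{X,P}$ whose image is a closed inverse submonoid of $M_{X,P}$. Identifying $L(\mathcal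 C,v)$ with its image, the set of all $L(\mathcal C,v)$, $v\in \mathcal C^0$, is exactly one conjugacy class of closed inverse submonoids of $M_{X,P}$. (2) Conversely, let $H$ be a closed inverse submonoid of $M_{X,P}$. Then there are a 2-complex $\mathcal C$ and an immersion $f\colon\mathcal C\to B_{X,P}$ such that $H$ is a loop monoid of $\mathcal C$. One such complex is the coset complex $\mathcal C_H$: its labeled graph $\Gamma_{\mathcal C_H}$ is the graph $\Gamma_H$ whose vertices are the right $\omega$-cosets $(Hm)^\omega=\{n : n\ge hm \text{ for some } h\in H\}$ with $mm^{-1}\in H$, and which has an edge labeled $a\in X\cup P$ from $(Hm)^\omega$ to $(Hn)^\omega$ exactly when $(Hn)^\omega=(Hma)^\omega$; and $H=L(\mathcal C_H,H)$. Moreover, $\mathcal C$ is unique up to isomorphism and $f$ up to equivalence: if $f\colon\mathcal C\to B_{X,P}$ and $f'\colon\mathcal C'\to B_{X,P}$ are immersions of 2-complexes that both have $H$ as a loop monoid, then there is an isomorphism of CW-complexes (a homeomorphism carrying open cells onto open cells) $\varphi\colon \mathcal C\to\mathcal C'$ with $f'\circ\varphi=f$. -/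

import Mathlib

open Set Metric Topology

/-! ### Inverse monoids -/

/-- An inverse monoid: every `a` has exactly one `b` with `a b a = a` and `b a b = b`, and it is
denoted `a⁻¹`. -/
class InverseMonoid (M : Type*) extends Monoid M, Inv M where
  mul_inv_mul_self : ∀ a : M, a * a⁻¹ * a = a
  inv_mul_inv_self : ∀ a : M, a⁻¹ * a * a⁻¹ = a⁻¹
  inv_unique : ∀ a b : M, a * b * a = a → b * a * b = b → b = a⁻¹

namespace InverseMonoid

variable {M : Type*} [InverseMonoid M]

/-- The natural partial order: `a ≤ b` iff `a = e b` for some idempotent `e`. -/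
def NatLE (a b : M) : Prop := ∃ e : M, e * e = e ∧ a = e * b

/-- `N^ω`, the set of all elements above some element of `N`. -/
def upClosure (N : Set M) : Set M := {m | ∃ n ∈ N, NatLE n m}

/-- Closed inverse submonoids. -/
structure IsClosedInverseSubmonoid (H : Set M) : Prop where
  one_mem : (1 : M) ∈ H
  mul_mem : ∀ a ∈ H, ∀ b ∈ H, a * b ∈ H
  inv_mem : ∀ a ∈ H, a⁻¹ ∈ H
  closed : upClosure H = H

/-- Conjugation: `m⁻¹ H m ⊆ K` and `m K m⁻¹ ⊆ H` for some `m`. -/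
def Conj (H K : Set M) : Prop :=
  ∃ m : M, (∀ h ∈ H, m⁻¹ * h * m ∈ K) ∧ (∀ k ∈ K, m * k * m⁻¹ ∈ H)

/-- A set of subsets of `M` is a conjugacy class of closed inverse submonoids. -/
def IsConjugacyClass (𝓗 : Set (Set M)) : Prop :=
  ∃ H : Set M, IsClosedInverseSubmonoid H ∧
    𝓗 = {K | IsClosedInverseSubmonoid K ∧ Conj H K}

/-- The right `ω`-cosets `(H m)^ω`, with `m m⁻¹ ∈ H`. -/
def RightCoset (H : Set M) : Type _ :=
  {Y : Set M // ∃ m : M, m * m⁻¹ ∈ H ∧ Y = upClosure {y | ∃ h ∈ H, y = h * m}}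

/-- The partial right action on cosets: `Z` is the coset `(Y m)^ω`. -/
def RightCoset.Acts {H : Set M} (Y : RightCoset H) (m : M) (Z : RightCoset H) : Prop :=
  Z.1 = upClosure {z | ∃ y ∈ Y.1, z = y * m}

end InverseMonoid

/-! ### The inverse monoid `Inv⟨X ∪ P | ρ² = ρ, ρ ≤ bl ρ⟩` -/

namespace MXP

universe u

variable {X P : Type u}

/-- Words over `X ∪ P` and formal inverses; `(a, true)` is the letter `a` and `(a, false)` is its
inverse. -/
abbrev Word (X P : Type u) : Type u := FreeMonoid ((X ⊕ P) × Bool)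

/-- The involution on words: reverse the word and invert the letters. -/
def Word.inv (w : Word X P) : Word X P :=
  FreeMonoid.ofList ((FreeMonoid.toList w).reverse.map fun a => (a.1, !a.2))

/-- The letter `a` as a word. -/
def letter (a : X ⊕ P) : Word X P := FreeMonoid.of (a, true)

/-- A word over `X` and formal inverses, viewed as a word over `X ∪ P`. -/
def wordOfX (l : List (X × Bool)) : Word X P :=
  FreeMonoid.ofList (l.map fun a => (Sum.inl a.1, a.2))

theorem Word.inv_mul (u v : Word X P) : Word.inv (u * v) = Word.inv v * Word.inv u := by
  simp [Word.inv, FreeMonoid.toList_mul]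

theorem Word.inv_inv (u : Word X P) : Word.inv (Word.inv u) = u := by
  have h : ((fun a : (X ⊕ P) × Bool => (a.1, !a.2)) ∘ fun a : (X ⊕ P) × Bool => (a.1, !a.2))
      = id := by
    funext a
    simp
  simp [Word.inv, List.map_reverse, h]

/-- The relations of the free inverse monoid together with `ρ² = ρ` and `ρ = ρ bl(ρ)` (which, for
an idempotent `ρ`, says `ρ ≤ bl(ρ)`). -/
inductive Rel (bl : P → List (X × Bool)) : Word X P → Word X P → Prop
  | inv (w : Word X P) : Rel bl (w * w.inv * w) w
  | comm (w u : Word X P) : Rel bl (w * w.inv * (u * u.inv)) (u * u.inv * (w * w.inv))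
  | idem (ρ : P) : Rel bl (letter (Sum.inr ρ) * letter (Sum.inr ρ)) (letter (Sum.inr ρ))
  | bound (ρ : P) : Rel bl (letter (Sum.inr ρ)) (letter (Sum.inr ρ) * wordOfX (bl ρ))

end MXP

universe u

open MXP in
/-- `M_{X,P} = Inv⟨X ∪ P | ρ² = ρ, ρ ≤ bl ρ⟩`. -/
def MXP {X P : Type u} (bl : P → List (X × Bool)) : Type u := (conGen (Rel bl)).Quotient

namespace MXP

variable {X P : Type u} (bl : P → List (X × Bool))

instance : Monoid (MXP bl) := inferInstanceAs (Monoid (conGen (Rel bl)).Quotient)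

/-- The element of `M_{X,P}` represented by a word. -/
def ofWord : Word X P →* MXP bl := (conGen (Rel bl)).mk'

theorem ofWord_surjective : Function.Surjective (ofWord bl) := Con.mk'_surjective

theorem ofWord_eq_iff {u v : Word X P} : ofWord bl u = ofWord bl v ↔ conGen (Rel bl) u v :=
  (conGen (Rel bl)).eq

theorem ofWord_rel {u v : Word X P} (h : Rel bl u v) : ofWord bl u = ofWord bl v :=
  (ofWord_eq_iff bl).2 (ConGen.Rel.of _ _ h)

theorem ofWord_inv_rel {u v : Word X P} (h : Rel bl u v) :
    ofWord bl u.inv = ofWord bl v.inv := by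
  have hinv (w : Word X P) : ofWord bl w * ofWord bl w.inv * ofWord bl w = ofWord bl w := by
    simpa using ofWord_rel bl (Rel.inv w)
  have hcomm (w u : Word X P) : ofWord bl w * ofWord bl w.inv * (ofWord bl u * ofWord bl u.inv) =
      ofWord bl u * ofWord bl u.inv * (ofWord bl w * ofWord bl w.inv) := by
    simpa using ofWord_rel bl (Rel.comm w u)
  have hself (ρ : P) : ofWord bl (letter (Sum.inr ρ)).inv = ofWord bl (letter (Sum.inr ρ)) := by
    have h2 := ofWord_rel bl (Rel.idem ρ)
    have h3 := hinv (letter (Sum.inr ρ) * letter (Sum.inr ρ))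
    have h4 := hinv (Word.inv (letter (Sum.inr ρ)))
    have h5 := hcomm (letter (Sum.inr ρ)).inv (letter (Sum.inr ρ))
    simp only [Word.inv_mul, Word.inv_inv, map_mul] at h2 h3 h4 h5
    generalize ofWord bl (letter (Sum.inr ρ)).inv = a at *
    generalize ofWord bl (letter (Sum.inr ρ)) = e at *
    have h6 : e * (a * a) * e = e := by
      calc e * (a * a) * e = (e * e) * (a * a) * (e * e) := by rw [h2]
        _ = e := by rw [h3, h2]
    calc a = a * (e * e) * a := by rw [h2, h4]
      _ = a * e * (e * a) := by simp only [mul_assoc]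
      _ = e * (a * a) * e := by rw [h5]; simp only [mul_assoc]
      _ = e := h6
  cases h with
  | inv _ =>
    have := hinv (Word.inv v)
    simpa [Word.inv_mul, Word.inv_inv, mul_assoc] using this
  | comm w u =>
    have := hcomm u w
    simpa [Word.inv_mul, Word.inv_inv, mul_assoc] using this
  | idem ρ =>
    rw [Word.inv_mul, map_mul, hself, ← map_mul]
    exact ofWord_rel bl (Rel.idem ρ)
  | bound ρ =>
    have h1 := ofWord_rel bl (Rel.idem ρ)
    have h2 := ofWord_rel bl (Rel.bound ρ)
    have h3 := hinv (letter (Sum.inr ρ) * wordOfX (bl ρ))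
    have h4 := hcomm (wordOfX (bl ρ)) (letter (Sum.inr ρ))
    have h5 := hcomm (letter (Sum.inr ρ) * wordOfX (bl ρ)).inv (letter (Sum.inr ρ))
    simp only [Word.inv_mul, Word.inv_inv, map_mul, hself] at h1 h2 h3 h4 h5 ⊢
    generalize ofWord bl (letter (Sum.inr ρ)) = e at *
    generalize ofWord bl (wordOfX (bl ρ)).inv = a at *
    generalize ofWord bl (wordOfX (bl ρ)) = b at *
    have h6 : e * a = e := by
      rw [← h2, ← mul_assoc, mul_assoc, h1] at h3
      rw [h1] at h4
      have h7 : e * (b * a) = e * a := by rw [← mul_assoc, ← h2]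
      have h8 : e * a * e = e * a := by
        rw [← h7, ← h4, mul_assoc (b * a) e e, h1]
      rw [← h8, h3]
    rw [← h2, mul_assoc a e e, h1, mul_assoc a e e, h1, ← mul_assoc (e) a e, h6, h1] at h5
    exact h5.symm

theorem ofWord_inv_congr {u v : Word X P} (h : conGen (Rel bl) u v) :
    ofWord bl u.inv = ofWord bl v.inv := by
  induction h with
  | of _ _ h => exact ofWord_inv_rel bl h
  | refl _ => rfl
  | symm _ ih => exact ih.symm
  | trans _ _ ih1 ih2 => exact ih1.trans ih2
  | mul _ _ ih1 ih2 =>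
    rw [Word.inv_mul, Word.inv_mul, map_mul, map_mul, ih1, ih2]

instance : Inv (MXP bl) :=
  ⟨Quotient.lift (s := (conGen (Rel bl)).toSetoid) (fun w => ofWord bl w.inv)
    fun _ _ h => ofWord_inv_congr bl h⟩

theorem ofWord_inv (w : Word X P) : (ofWord bl w)⁻¹ = ofWord bl w.inv := rfl

instance : InverseMonoid (MXP bl) where
  mul_inv_mul_self a := by
    obtain ⟨w, rfl⟩ := ofWord_surjective bl a
    simpa [ofWord_inv] using ofWord_rel bl (Rel.inv w)
  inv_mul_inv_self a := by
    obtain ⟨w, rfl⟩ := ofWord_surjective bl a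
    simpa [ofWord_inv, Word.inv_inv] using ofWord_rel bl (Rel.inv w.inv)
  inv_unique := by
    have hi (a : MXP bl) : a * a⁻¹ * a = a := by
      obtain ⟨w, rfl⟩ := ofWord_surjective bl a
      simpa [ofWord_inv] using ofWord_rel bl (Rel.inv w)
    have hii (a : MXP bl) : a⁻¹⁻¹ = a := by
      obtain ⟨w, rfl⟩ := ofWord_surjective bl a
      simp [ofWord_inv, Word.inv_inv]
    have hm (a b : MXP bl) : (a * b)⁻¹ = b⁻¹ * a⁻¹ := by
      obtain ⟨w, rfl⟩ := ofWord_surjective bl a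
      obtain ⟨u, rfl⟩ := ofWord_surjective bl b
      rw [← map_mul, ofWord_inv, Word.inv_mul, map_mul, ofWord_inv, ofWord_inv]
    have hc (a b : MXP bl) : a * a⁻¹ * (b * b⁻¹) = b * b⁻¹ * (a * a⁻¹) := by
      obtain ⟨w, rfl⟩ := ofWord_surjective bl a
      obtain ⟨u, rfl⟩ := ofWord_surjective bl b
      simpa [ofWord_inv] using ofWord_rel bl (Rel.comm w u)
    have hid (e : MXP bl) (he : e * e = e) : e = e * e⁻¹ := by
      have h1 : e⁻¹ * e⁻¹ = e⁻¹ := by rw [← hm, he]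
      have h2 : e⁻¹ = e := by
        calc e⁻¹ = e⁻¹ * e * e⁻¹ := by have := hi e⁻¹; rw [hii] at this; exact this.symm
          _ = e⁻¹ * e⁻¹⁻¹ * (e * e⁻¹) := by rw [hii, ← mul_assoc, mul_assoc e⁻¹ e e, he]
          _ = e * e⁻¹ * (e⁻¹ * e⁻¹⁻¹) := hc _ _
          _ = e * (e⁻¹ * e⁻¹) * e := by rw [hii]; simp only [mul_assoc]
          _ = e := by rw [h1, hi]
      rw [h2, he]
    have hidc (e f : MXP bl) (he : e * e = e) (hf : f * f = f) : e * f = f * e := by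
      rw [hid e he, hid f hf, hc]
    intro a b h1 h2
    have h3 : a⁻¹ * a * a⁻¹ = a⁻¹ := by have := hi a⁻¹; rwa [hii] at this
    have e1 : (a * b) * (a * b) = a * b := by rw [← mul_assoc, h1]
    have e2 : (b * a) * (b * a) = b * a := by rw [← mul_assoc, h2]
    have e3 : (a * a⁻¹) * (a * a⁻¹) = a * a⁻¹ := by rw [← mul_assoc, hi]
    have e4 : (a⁻¹ * a) * (a⁻¹ * a) = a⁻¹ * a := by rw [← mul_assoc, h3]
    have hL : b * a = a⁻¹ * a := by
      calc b * a = b * (a * a⁻¹ * a) := by rw [hi]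
        _ = (b * a) * (a⁻¹ * a) := by simp only [mul_assoc]
        _ = (a⁻¹ * a) * (b * a) := hidc _ _ e2 e4
        _ = a⁻¹ * (a * b * a) := by simp only [mul_assoc]
        _ = a⁻¹ * a := by rw [h1]
    have hR : a * b = a * a⁻¹ := by
      calc a * b = (a * a⁻¹ * a) * b := by rw [hi]
        _ = (a * a⁻¹) * (a * b) := by simp only [mul_assoc]
        _ = (a * b) * (a * a⁻¹) := hidc _ _ e3 e1
        _ = (a * b * a) * a⁻¹ := by simp only [mul_assoc]
        _ = a * a⁻¹ := by rw [h1]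
    calc b = b * a * b := h2.symm
      _ = a⁻¹ * (a * b) := by rw [hL, mul_assoc]
      _ = a⁻¹ := by rw [hR, ← mul_assoc, h3]

end MXP

/-! ### `2`-complexes and immersions -/

/-- A `2`-complex: a connected (Hausdorff) CW-complex of dimension at most `2`. -/
structure TwoComplex : Type (u + 1) where
  carrier : Type u
  [top : TopologicalSpace carrier]
  [t2 : T2Space carrier]
  [conn : ConnectedSpace carrier]
  [cw : CWComplex (Set.univ : Set carrier)]
  dim_le : ∀ n : ℕ, 2 < n → IsEmpty (RelCWComplex.cell (Set.univ : Set carrier) n)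

namespace TwoComplex

instance : CoeSort TwoComplex.{u} (Type u) := ⟨TwoComplex.carrier⟩

attribute [instance] TwoComplex.top TwoComplex.t2 TwoComplex.conn TwoComplex.cw

/-- The set `C^{(n)}` of `n`-cells. -/
abbrev Cell (C : TwoComplex.{u}) (n : ℕ) : Type u := RelCWComplex.cell (Set.univ : Set C) n

/-- The characteristic map of an `n`-cell; it is meaningful on the closed unit ball. The ball is
that of the supremum norm, so for `n = 1` it is `[-1, 1]` and for `n = 2` it is a square. -/
abbrev charMap (C : TwoComplex.{u}) {n : ℕ} (e : C.Cell n) : (Fin n → ℝ) → C :=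
  RelCWComplex.map (C := (Set.univ : Set C)) n e

/-- The open `n`-cell. -/
abbrev openCell (C : TwoComplex.{u}) {n : ℕ} (e : C.Cell n) : Set C :=
  RelCWComplex.openCell (C := (Set.univ : Set C)) n e

/-- A `0`-cell as a point. -/
abbrev point (C : TwoComplex.{u}) (v : C.Cell 0) : C := C.charMap v 0

end TwoComplex

/-- Immersions of `2`-complexes: cellular maps (open cells go bijectively onto open cells of the
same dimension) that restrict, on some neighborhood `U` of each point, to a homeomorphism from `U`
onto its image. -/
structure IsImmersion (D C : TwoComplex.{u}) (f : D → C) : Prop where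
  continuous : Continuous f
  cellular : ∀ (n : ℕ) (e : D.Cell n), ∃ e' : C.Cell n, BijOn f (D.openCell e) (C.openCell e')
  locally_embedding : ∀ y : D, ∃ U ∈ 𝓝 y, IsEmbedding (U.domRestrict f)

/-- `φ` carries the open `n`-cells of `D` onto open `n`-cells of `C`. For a homeomorphism `φ`, this
makes `φ` an isomorphism of CW-complexes. -/
def IsCellularIso {D C : TwoComplex.{u}} (φ : D ≃ₜ C) : Prop :=
  ∀ (n : ℕ) (e : D.Cell n), ∃ e' : C.Cell n, φ '' D.openCell e = C.openCell e'

/-- `B` is a complex `B_{X,P}`: a bouquet of circles indexed by `X` with `2`-cells indexed by `P`,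
each with a root and a boundary walk. The circle bounding the cell `ρ` is parametrized by
`[0, 1]` through `circle ρ`, starting at the point that is sent to the root. Along this
parametrization, the attaching map reads the word `bl ρ`. -/
structure BouquetLabeling (X P : Type u) (B : TwoComplex.{u}) where
  vertex : Unique (B.Cell 0)
  edge : X ≃ B.Cell 1
  face : P ≃ B.Cell 2
  /-- The boundary label; `(x, true)` is the letter `x` and `(x, false)` its inverse. -/
  bl : P → List (X × Bool)
  circle : P → ℝ → (Fin 2 → ℝ)
  circle_continuousOn : ∀ ρ, ContinuousOn (circle ρ) (Icc 0 1)
  circle_bijOn : ∀ ρ, BijOn (circle ρ) (Ico 0 1) (sphere 0 1)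
  circle_closed : ∀ ρ, circle ρ 1 = circle ρ 0
  boundary_nil : ∀ ρ, bl ρ = [] → ∀ y ∈ sphere (0 : Fin 2 → ℝ) 1,
    B.charMap (face ρ) y = B.point vertex.default
  /-- The `i`-th of the `k` segments of the circle runs once along the `i`-th edge of the walk,
  from `-1` to `1` for a letter `x` and from `1` to `-1` for an inverse letter. -/
  boundary_cons : ∀ ρ (i : Fin (bl ρ).length), ∀ t ∈ Icc (0 : ℝ) 1,
    B.charMap (face ρ) (circle ρ ((i + t) / (bl ρ).length)) =
      B.charMap (edge ((bl ρ).get i).1)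
        (fun _ => if ((bl ρ).get i).2 then 2 * t - 1 else 1 - 2 * t)

/-- `G` is a characteristic map for the cell `e` of `D` that is compatible with `f : D → C`, that
is, `f ∘ G` is the given characteristic map of `e'`. -/
structure IsLiftedCharMap {D C : TwoComplex.{u}} (f : D → C) {n : ℕ} (e : D.Cell n)
    (e' : C.Cell n) (G : (Fin n → ℝ) → D) : Prop where
  continuousOn : ContinuousOn G (closedBall 0 1)
  mapsTo : MapsTo G (ball 0 1) (D.openCell e)
  lift : ∀ y ∈ closedBall (0 : Fin n → ℝ) 1, f (G y) = C.charMap e' y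

namespace BouquetLabeling

open MXP InverseMonoid

variable {X P : Type u} {B : TwoComplex.{u}} (L : BouquetLabeling X P B)
variable {C : TwoComplex.{u}} (f : C → B)

/-- In the labeling of `C` induced by `f`, the `1`-cell `e` is labeled by `x` and, as a positively
oriented edge, runs from `v` to `w`. -/
def IsEdge (e : C.Cell 1) (x : X) (v w : C.Cell 0) : Prop :=
  ∃ G, IsLiftedCharMap f e (L.edge x) G ∧
    G (fun _ => -1) = C.point v ∧ G (fun _ => 1) = C.point w

/-- In the labeling of `C` induced by `f`, the `2`-cell `c` is labeled by `ρ` and has root `v`. -/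
def IsFace (c : C.Cell 2) (ρ : P) (v : C.Cell 0) : Prop :=
  ∃ G, IsLiftedCharMap f c (L.face ρ) G ∧ G (L.circle ρ 0) = C.point v

/-- The vertices of the labeled graph `Γ_C`. -/
def Gamma (_L : BouquetLabeling X P B) (_f : C → B) : Type u := C.Cell 0

/-- The positively labeled edges of `Γ_C`: the `1`-cells, and a loop `e_c` at the root of each
`2`-cell `c`. -/
inductive GammaEdge : L.Gamma f → L.Gamma f → Type u
  | ofEdge {v w : C.Cell 0} (e : C.Cell 1) (x : X) (h : L.IsEdge f e x v w) : GammaEdge v w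
  | ofFace {v : C.Cell 0} (c : C.Cell 2) (ρ : P) (h : L.IsFace f c ρ v) : GammaEdge v v

/-- The label of an edge of `Γ_C`. -/
def GammaEdge.label {v w : L.Gamma f} : L.GammaEdge f v w → X ⊕ P
  | .ofEdge _ x _ => Sum.inl x
  | .ofFace _ ρ _ => Sum.inr ρ

/-- The arrows of `Γ_C`: an edge traversed forwards or backwards. -/
instance : Quiver (L.Gamma f) := ⟨fun v w => L.GammaEdge f v w ⊕ L.GammaEdge f w v⟩

instance : Quiver.HasReverse (L.Gamma f) := ⟨fun e => e.swap⟩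

/-- Paths in `Γ_C`. -/
abbrev GPath (v w : L.Gamma f) : Type u :=
  Quiver.Path v w

/-- The word labeling a path. -/
def pathWord {v : L.Gamma f} : ∀ {w : L.Gamma f}, L.GPath f v w → Word X P
  | _, .nil => 1
  | _, .cons p (Sum.inl e) => pathWord p * FreeMonoid.of (e.label, true)
  | _, .cons p (Sum.inr e) => pathWord p * FreeMonoid.of (e.label, false)

/-- The congruence `∼` on the free category on `Γ_C`, generated by the relations of the free
inverse category and by `p² = p`, `p = p q` for coterminal `p`, `q` such that `p` is labeled by
some `ρ ∈ P` and `q` by `bl ρ`. -/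
inductive PathEquiv : ∀ {v w : L.Gamma f}, L.GPath f v w → L.GPath f v w → Prop
  | refl {v w : L.Gamma f} (p : L.GPath f v w) : PathEquiv p p
  | symm {v w : L.Gamma f} {p q : L.GPath f v w} : PathEquiv p q → PathEquiv q p
  | trans {v w : L.Gamma f} {p q r : L.GPath f v w} :
      PathEquiv p q → PathEquiv q r → PathEquiv p r
  | comp {u v w : L.Gamma f} {p p' : L.GPath f u v} {q q' : L.GPath f v w} :
      PathEquiv p p' → PathEquiv q q' → PathEquiv (p.comp q) (p'.comp q')
  | inv {v w : L.Gamma f} (p : L.GPath f v w) : PathEquiv ((p.comp p.reverse).comp p) p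
  | comm {u v w : L.Gamma f} (p : L.GPath f u v) (q : L.GPath f u w) :
      PathEquiv ((p.comp p.reverse).comp (q.comp q.reverse))
        ((q.comp q.reverse).comp (p.comp p.reverse))
  | idem {v : L.Gamma f} (p : L.GPath f v v) (ρ : P)
      (hp : L.pathWord f p = letter (Sum.inr ρ)) : PathEquiv (p.comp p) p
  | bound {v : L.Gamma f} (p q : L.GPath f v v) (ρ : P)
      (hp : L.pathWord f p = letter (Sum.inr ρ)) (hq : L.pathWord f q = wordOfX (L.bl ρ)) :
      PathEquiv p (p.comp q)

/-- `∼` on the closed paths at `v`. -/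
def loopSetoid (v : L.Gamma f) : Setoid (L.GPath f v v) where
  r := L.PathEquiv f
  iseqv := ⟨.refl, .symm, .trans⟩

/-- The loop monoid `L(C, v)`: the `∼`-classes of closed paths at `v`. -/
def LoopMonoid (v : L.Gamma f) : Type u := Quotient (L.loopSetoid f v)

instance (v : L.Gamma f) : Monoid (L.LoopMonoid f v) where
  mul := Quotient.map₂ Quiver.Path.comp fun _ _ h _ _ h' => PathEquiv.comp h h'
  one := Quotient.mk _ Quiver.Path.nil
  mul_assoc := by
    rintro ⟨a⟩ ⟨b⟩ ⟨c⟩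
    exact congrArg (Quotient.mk _) (Quiver.Path.comp_assoc a b c)
  one_mul := by
    rintro ⟨a⟩
    exact congrArg (Quotient.mk _) (Quiver.Path.nil_comp a)
  mul_one := by
    rintro ⟨a⟩
    exact congrArg (Quotient.mk _) (Quiver.Path.comp_nil a)

theorem pathWord_comp {u v w : L.Gamma f} (p : L.GPath f u v) (q : L.GPath f v w) :
    L.pathWord f (p.comp q) = L.pathWord f p * L.pathWord f q := by
  induction q with
  | nil => exact (mul_one _).symm
  | cons q e ih =>
    rcases e with e | e
    all_goals
      simp only [Quiver.Path.comp_cons, pathWord]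
      rw [ih, mul_assoc]

theorem pathWord_reverse {v w : L.Gamma f} (p : L.GPath f v w) :
    L.pathWord f p.reverse = (L.pathWord f p).inv := by
  induction p with
  | nil => rfl
  | cons q e ih =>
    rcases e with e | e
    all_goals
      refine (L.pathWord_comp f _ _).trans ?_
      rw [ih]
      simp only [pathWord, Word.inv_mul]
      rfl

theorem ofWord_pathWord {v w : L.Gamma f} {p q : L.GPath f v w} (h : L.PathEquiv f p q) :
    ofWord L.bl (L.pathWord f p) = ofWord L.bl (L.pathWord f q) := by
  induction h with
  | refl => rfl
  | symm _ ih => exact ih.symm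
  | trans _ _ ih1 ih2 => exact ih1.trans ih2
  | comp _ _ ih1 ih2 => rw [pathWord_comp, pathWord_comp, map_mul, map_mul, ih1, ih2]
  | inv p =>
    rw [pathWord_comp, pathWord_comp, pathWord_reverse]
    exact ofWord_rel _ (Rel.inv _)
  | comm p q =>
    simp only [pathWord_comp, pathWord_reverse]
    exact ofWord_rel _ (Rel.comm _ _)
  | idem p ρ hp =>
    rw [pathWord_comp, hp]
    exact ofWord_rel _ (Rel.idem ρ)
  | bound p q ρ hp hq =>
    rw [pathWord_comp, hp, hq]
    exact ofWord_rel _ (Rel.bound ρ)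

/-- The homomorphism `L(C, v) → M_{X,P}` sending the class of a closed path to its label. -/
def loopLabel (v : L.Gamma f) : L.LoopMonoid f v →* MXP L.bl where
  toFun := Quotient.lift (fun p => ofWord L.bl (L.pathWord f p)) fun _ _ h => L.ofWord_pathWord f h
  map_one' := rfl
  map_mul' := by
    rintro ⟨a⟩ ⟨b⟩
    exact (congrArg (ofWord L.bl) (L.pathWord_comp f a b)).trans (map_mul (ofWord L.bl) _ _)

/-- The loop monoid `L(C, v)`, regarded as a subset of `M_{X,P}`. -/
def loopSet (v : L.Gamma f) : Set (MXP L.bl) := Set.range (L.loopLabel f v)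

/-- The positively labeled edges of the `ω`-coset graph `Γ_H`. -/
def CosetEdge {H : Set (MXP L.bl)} (Y Z : RightCoset H) : Type u :=
  {a : X ⊕ P // Y.Acts (ofWord L.bl (letter a)) Z}

/-- An isomorphism from the labeled graph `Γ_C` to the `ω`-coset graph `Γ_H`. It identifies the
labeled complex `C` with the coset complex `C_H`: the `0`-cells are the right `ω`-cosets of `H`,
the `1`-cells are the edges of `Γ_H` labeled over `X`, the `2`-cells are the edges of `Γ_H` labeled
over `P`, and the base point of such an edge is the root of the `2`-cell. -/
structure CosetComplexIso (H : Set (MXP L.bl)) where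
  vertexEquiv : L.Gamma f ≃ RightCoset H
  edgeEquiv : ∀ v w : L.Gamma f,
    L.GammaEdge f v w ≃ L.CosetEdge (vertexEquiv v) (vertexEquiv w)
  label_eq : ∀ (v w : L.Gamma f) (e : L.GammaEdge f v w), (edgeEquiv v w e).1 = e.label

end BouquetLabeling

/-! An immersion makes `Γ_C` deterministic. Two lifts of one characteristic map of `B` that agree at
a single point, possibly on the boundary, agree everywhere. Hence at most one edge with a given
label has a given source, at most one has a given target, and at most one face with a given label
has a given root (`IsLiftedCharMap.cell_eq`). A path is therefore determined by its initial vertex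
and its label (`path_unique`). For such graphs every defining relation of `M_{X,P}` can be followed
along paths: if `u` and `u'` represent the same element, a path labeled `u` is equivalent to a
coterminal path labeled `u'` (`transfers_of_conGen`). The relation `ρ = ρ bl(ρ)` can be followed
because the boundary of a face lifts to a closed path at its root.

So `M_{X,P}` acts by partial injections on the vertices, and `L(C, v)` is the stabilizer of `v`.
Labels separate `∼`-classes, which is injectivity; idempotents act as partial identities, which
makes stabilizers upward closed; and connectedness of `C` makes the action transitive, so the
stabilizers form one conjugacy class.

Conversely, `M_{X,P}` acts by partial injections on the right `ω`-cosets of `H`, transitively and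
with `H` as the stabilizer of the coset `H`. A partial action in which each `bl(ρ)` labels a closed
walk wherever `ρ` is defined yields cells over those of `B`, with attaching maps lifting those of
`B`. These are glued with the weak topology. The projection to `B` is an immersion because star
neighborhoods, obtained by radial thickening, embed as closed sets
(`CellLift.exists_embedding_nhds`).

For uniqueness, equal stabilizers give a label-preserving bijection of vertices, and `exists_lift`
extends vertex data over the cells, using that characteristic maps of `B` lift through immersions
(`IsImmersion.exists_isLiftedCharMap`). Both composites of the two resulting maps are lifts that
agree with the identity at a base point. -/

namespace InverseMonoid

/-! ### Idempotents and the natural partial order in inverse monoids -/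

variable {M : Type*} [InverseMonoid M]

theorem inv_inv' (a : M) : a⁻¹⁻¹ = a :=
  (inv_unique a⁻¹ a (inv_mul_inv_self a) (mul_inv_mul_self a)).symm

theorem inv_eq_self_of_idem {e : M} (he : e * e = e) : e⁻¹ = e :=
  (inv_unique e e (by rw [he, he]) (by rw [he, he])).symm

theorem mul_inv_idem (a : M) : a * a⁻¹ * (a * a⁻¹) = a * a⁻¹ := by
  rw [← mul_assoc, mul_inv_mul_self]

theorem inv_mul_idem (a : M) : a⁻¹ * a * (a⁻¹ * a) = a⁻¹ * a := by
  rw [← mul_assoc, inv_mul_inv_self]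

/-- By uniqueness of inverses `(e f)⁻¹ = f (e f)⁻¹ e`, and this expression squares to itself. An
idempotent is its own inverse, so `e f` equals its inverse and is idempotent too. -/
theorem mul_idem_of_idem {e f : M} (he : e * e = e) (hf : f * f = f) :
    e * f * (e * f) = e * f := by
  have h1 := mul_inv_mul_self (e * f)
  have h2 := inv_mul_inv_self (e * f)
  have h3 : f * (e * f)⁻¹ * e = (e * f)⁻¹ := by
    apply inv_unique
    · calc e * f * (f * (e * f)⁻¹ * e) * (e * f) =
          e * (f * f) * (e * f)⁻¹ * (e * e) * f := by simp only [mul_assoc]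
        _ = e * f * (e * f)⁻¹ * (e * f) := by rw [he, hf]; simp only [mul_assoc]
        _ = e * f := h1
    · calc f * (e * f)⁻¹ * e * (e * f) * (f * (e * f)⁻¹ * e) =
          f * ((e * f)⁻¹ * ((e * e) * (f * f)) * (e * f)⁻¹) * e := by simp only [mul_assoc]
        _ = f * (e * f)⁻¹ * e := by rw [he, hf, h2]
  have h4 : (e * f)⁻¹ * (e * f)⁻¹ = (e * f)⁻¹ := by
    calc (e * f)⁻¹ * (e * f)⁻¹ = f * (e * f)⁻¹ * e * (f * (e * f)⁻¹ * e) := by rw [h3]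
      _ = f * ((e * f)⁻¹ * (e * f) * (e * f)⁻¹) * e := by simp only [mul_assoc]
      _ = (e * f)⁻¹ := by rw [h2, h3]
  have h5 := inv_eq_self_of_idem h4
  rw [inv_inv'] at h5
  rw [← h5] at h4
  exact h4

/-- Since `e f` and `f e` are both idempotent, `f e` is an inverse of `e f`; but `e f` is its own
inverse. -/
theorem idem_comm {e f : M} (he : e * e = e) (hf : f * f = f) : e * f = f * e := by
  have h1 := mul_idem_of_idem he hf
  have h2 := mul_idem_of_idem hf he
  have h3 : f * e = (e * f)⁻¹ := by
    apply inv_unique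
    · calc e * f * (f * e) * (e * f) = e * (f * f) * (e * e) * f := by simp only [mul_assoc]
        _ = e * f * (e * f) := by rw [he, hf]; simp only [mul_assoc]
        _ = e * f := h1
    · calc f * e * (e * f) * (f * e) = f * (e * e) * (f * f) * e := by simp only [mul_assoc]
        _ = f * e * (f * e) := by rw [he, hf]; simp only [mul_assoc]
        _ = f * e := h2
  rw [h3, inv_eq_self_of_idem h1]

theorem mul_inv' (a b : M) : (a * b)⁻¹ = b⁻¹ * a⁻¹ := by
  have hc := idem_comm (mul_inv_idem b) (inv_mul_idem a)
  symm
  apply inv_unique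
  · calc a * b * (b⁻¹ * a⁻¹) * (a * b) = a * (b * b⁻¹ * (a⁻¹ * a)) * b := by
          simp only [mul_assoc]
      _ = (a * a⁻¹ * a) * (b * b⁻¹ * b) := by rw [hc]; simp only [mul_assoc]
      _ = a * b := by rw [mul_inv_mul_self, mul_inv_mul_self]
  · calc b⁻¹ * a⁻¹ * (a * b) * (b⁻¹ * a⁻¹) = b⁻¹ * (a⁻¹ * a * (b * b⁻¹)) * a⁻¹ := by
          simp only [mul_assoc]
      _ = (b⁻¹ * b * b⁻¹) * (a⁻¹ * a * a⁻¹) := by rw [← hc]; simp only [mul_assoc]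
      _ = b⁻¹ * a⁻¹ := by rw [inv_mul_inv_self, inv_mul_inv_self]

theorem conj_idem {e : M} (he : e * e = e) (a : M) :
    a * e * a⁻¹ * (a * e * a⁻¹) = a * e * a⁻¹ := by
  calc a * e * a⁻¹ * (a * e * a⁻¹) = a * (e * (a⁻¹ * a)) * (e * a⁻¹) := by simp only [mul_assoc]
    _ = (a * a⁻¹ * a) * (e * e) * a⁻¹ := by
      rw [idem_comm he (inv_mul_idem a)]; simp only [mul_assoc]
    _ = a * e * a⁻¹ := by rw [mul_inv_mul_self, he]

/-- An idempotent passes to the other side of `a` as the idempotent `a e a⁻¹`. This makes the order,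
defined by idempotents on the left, compatible with multiplication on either side. -/
theorem mul_idem_eq {e : M} (he : e * e = e) (a : M) : a * e = a * e * a⁻¹ * a := by
  calc a * e = (a * a⁻¹ * a) * e := by rw [mul_inv_mul_self]
    _ = a * (a⁻¹ * a * e) := by simp only [mul_assoc]
    _ = a * e * a⁻¹ * a := by rw [idem_comm (inv_mul_idem a) he]; simp only [mul_assoc]

namespace NatLE

theorem refl (a : M) : NatLE a a := ⟨1, one_mul 1, (one_mul a).symm⟩

theorem trans {a b c : M} (h : NatLE a b) (h' : NatLE b c) : NatLE a c := by
  obtain ⟨e, he, rfl⟩ := h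
  obtain ⟨f, hf, rfl⟩ := h'
  exact ⟨e * f, mul_idem_of_idem he hf, (mul_assoc _ _ _).symm⟩

theorem mul_right {a b : M} (h : NatLE a b) (c : M) : NatLE (a * c) (b * c) := by
  obtain ⟨e, he, rfl⟩ := h
  exact ⟨e, he, mul_assoc _ _ _⟩

theorem mul_left {a b : M} (h : NatLE a b) (c : M) : NatLE (c * a) (c * b) := by
  obtain ⟨e, he, rfl⟩ := h
  refine ⟨c * e * c⁻¹, conj_idem he c, ?_⟩
  rw [← mul_assoc, ← mul_assoc, ← mul_idem_eq he c]

theorem mul {a b c d : M} (h : NatLE a b) (h' : NatLE c d) : NatLE (a * c) (b * d) :=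
  (h.mul_right c).trans (h'.mul_left b)

theorem inv {a b : M} (h : NatLE a b) : NatLE a⁻¹ b⁻¹ := by
  obtain ⟨e, he, rfl⟩ := h
  rw [mul_inv', inv_eq_self_of_idem he]
  have h := conj_idem he b⁻¹
  have h' := mul_idem_eq he b⁻¹
  exact ⟨_, h, h'⟩

theorem of_idem_mul {e : M} (he : e * e = e) (a : M) : NatLE (e * a) a := ⟨e, he, rfl⟩

theorem of_mul_idem {e : M} (he : e * e = e) (a : M) : NatLE (a * e) a := by
  simpa using NatLE.mul_left (⟨e, he, (mul_one e).symm⟩ : NatLE e 1) a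

end NatLE

/-! ### Closed inverse submonoids and their right `ω`-cosets -/

theorem subset_upClosure (N : Set M) : N ⊆ upClosure N := fun n hn => ⟨n, hn, .refl n⟩

namespace IsClosedInverseSubmonoid

variable {H : Set M} (hH : IsClosedInverseSubmonoid H)
include hH

theorem mem_of_le {a b : M} (h : NatLE a b) (ha : a ∈ H) : b ∈ H := by
  rw [← hH.closed]
  exact ⟨a, ha, h⟩

/-- The coset `(H m)^ω` consists of the `n` with `n m⁻¹ ∈ H`. -/
theorem mem_coset_iff {m n : M} (hm : m * m⁻¹ ∈ H) :
    n ∈ upClosure {y | ∃ h ∈ H, y = h * m} ↔ n * m⁻¹ ∈ H := by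
  constructor
  · rintro ⟨_, ⟨h, hh, rfl⟩, hle⟩
    refine hH.mem_of_le (hle.mul_right m⁻¹) ?_
    rw [mul_assoc]
    exact hH.mul_mem _ hh _ hm
  · intro h
    refine ⟨n * m⁻¹ * m, ⟨_, h, rfl⟩, ?_⟩
    rw [mul_assoc]
    exact NatLE.of_mul_idem (inv_mul_idem m) n

/-- From `h m ≤ n` follows `h (m m⁻¹) h⁻¹ ≤ n n⁻¹`, and the left side is in `H`. Every element of a
coset can thus serve as its representative. -/
theorem domain_mem {m n : M} (hm : m * m⁻¹ ∈ H)
    (hn : n ∈ upClosure {y | ∃ h ∈ H, y = h * m}) : n * n⁻¹ ∈ H := by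
  obtain ⟨_, ⟨h, hh, rfl⟩, hle⟩ := hn
  refine hH.mem_of_le (hle.mul hle.inv) ?_
  rw [mul_inv']
  have : h * m * (m⁻¹ * h⁻¹) = h * (m * m⁻¹) * h⁻¹ := by simp only [mul_assoc]
  rw [this]
  exact hH.mul_mem _ (hH.mul_mem _ hh _ hm) _ (hH.inv_mem _ hh)

theorem coset_eq {m n : M} (hm : m * m⁻¹ ∈ H) (hn : n * n⁻¹ ∈ H) (h : m * n⁻¹ ∈ H) :
    upClosure {y | ∃ h ∈ H, y = h * m} = upClosure {y | ∃ h ∈ H, y = h * n} := by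
  have key : ∀ {m n : M}, m * m⁻¹ ∈ H → n * n⁻¹ ∈ H → m * n⁻¹ ∈ H →
      upClosure {y | ∃ h ∈ H, y = h * m} ⊆ upClosure {y | ∃ h ∈ H, y = h * n} := by
    intro m n hm hn h a ha
    rw [hH.mem_coset_iff hn]
    rw [hH.mem_coset_iff hm] at ha
    -- The product of the two known elements of `H` lies below `a n⁻¹`.
    have h1 : a * m⁻¹ * (m * n⁻¹) = a * (m⁻¹ * m) * n⁻¹ := by simp only [mul_assoc]
    refine hH.mem_of_le ((NatLE.of_mul_idem (inv_mul_idem m) a).mul_right n⁻¹) ?_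
    rw [← h1]
    exact hH.mul_mem _ ha _ h
  refine (key hm hn h).antisymm (key hn hm ?_)
  have := hH.inv_mem _ h
  rwa [mul_inv', inv_inv'] at this

theorem self_mem_coset {m : M} : m ∈ upClosure {y | ∃ h ∈ H, y = h * m} :=
  subset_upClosure _ ⟨1, hH.one_mem, (one_mul m).symm⟩

end IsClosedInverseSubmonoid

theorem upClosure_mul_upClosure (N : Set M) (m : M) :
    upClosure {z | ∃ y ∈ upClosure N, z = y * m} = upClosure {z | ∃ y ∈ N, z = y * m} := by
  ext a
  constructor
  · rintro ⟨_, ⟨y, ⟨n, hn, h⟩, rfl⟩, h'⟩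
    exact ⟨_, ⟨n, hn, rfl⟩, (h.mul_right m).trans h'⟩
  · rintro ⟨_, ⟨y, hy, rfl⟩, h'⟩
    exact ⟨_, ⟨y, subset_upClosure _ hy, rfl⟩, h'⟩

theorem upClosure_coset_mul (H : Set M) (n m : M) :
    upClosure {z | ∃ y ∈ upClosure {y | ∃ h ∈ H, y = h * n}, z = y * m} =
      upClosure {y | ∃ h ∈ H, y = h * (n * m)} := by
  rw [upClosure_mul_upClosure]
  congr 1
  ext z
  constructor
  · rintro ⟨_, ⟨h, hh, rfl⟩, rfl⟩
    exact ⟨h, hh, mul_assoc _ _ _⟩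
  · rintro ⟨h, hh, rfl⟩
    exact ⟨_, ⟨h, hh, rfl⟩, (mul_assoc _ _ _).symm⟩

namespace RightCoset

variable {H : Set M}

/-- The coset `(H m)^ω`. -/
def mk (m : M) (hm : m * m⁻¹ ∈ H) : RightCoset H := ⟨_, m, hm, rfl⟩

theorem exists_rep (Y : RightCoset H) : ∃ (m : M) (hm : m * m⁻¹ ∈ H), Y = mk m hm := by
  obtain ⟨Y, m, hm, rfl⟩ := Y
  exact ⟨m, hm, rfl⟩

/-- The coset `H` itself. -/
def base (hH : IsClosedInverseSubmonoid H) : RightCoset H :=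
  ⟨H, 1, hH.mul_mem _ hH.one_mem _ (hH.inv_mem _ hH.one_mem), by simpa using hH.closed.symm⟩

theorem base_eq (hH : IsClosedInverseSubmonoid H) :
    base hH = mk 1 (hH.mul_mem _ hH.one_mem _ (hH.inv_mem _ hH.one_mem)) :=
  Subtype.ext (by simpa [base, mk] using hH.closed.symm)

variable (hH : IsClosedInverseSubmonoid H)
include hH

theorem mk_eq_mk_iff {m n : M} (hm : m * m⁻¹ ∈ H) (hn : n * n⁻¹ ∈ H) :
    mk m hm = mk n hn ↔ m * n⁻¹ ∈ H := by
  constructor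
  · intro h
    have h' : upClosure {y | ∃ h ∈ H, y = h * m} = upClosure {y | ∃ h ∈ H, y = h * n} :=
      congrArg Subtype.val h
    rw [← hH.mem_coset_iff hn, ← h']
    exact hH.self_mem_coset
  · exact fun h => Subtype.ext (hH.coset_eq hm hn h)

/-- Reduces the action to representatives: it is defined exactly when the domain idempotent of `n m`
is in `H`. If the result is known to be a coset, it contains `n m`, so `domain_mem` supplies that
condition. -/
theorem acts_mk_iff {n m : M} (hn : n * n⁻¹ ∈ H) {Z : RightCoset H} :
    (mk n hn).Acts m Z ↔ ∃ h : (n * m) * (n * m)⁻¹ ∈ H, Z = mk (n * m) h := by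
  have h0 := upClosure_coset_mul H n m
  constructor
  · intro h
    have h1 : Z.1 = upClosure {y | ∃ h ∈ H, y = h * (n * m)} := h.trans h0
    obtain ⟨k, hk, rfl⟩ := exists_rep Z
    have h2 : n * m ∈ upClosure {y | ∃ h ∈ H, y = h * k} := by
      rw [show upClosure {y | ∃ h ∈ H, y = h * k} = _ from h1]
      exact hH.self_mem_coset
    exact ⟨hH.domain_mem hk h2, Subtype.ext h1⟩
  · rintro ⟨h, rfl⟩
    exact h0.symm

omit hH in
theorem Acts.unique {Y Z Z' : RightCoset H} {m : M} (h : Y.Acts m Z) (h' : Y.Acts m Z') :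
    Z = Z' := Subtype.ext (h.trans h'.symm)

/-- Both `n m m⁻¹` and `n` pair with the relevant inverses to give `(n m)(n m)⁻¹`, so they represent
the same coset. Hence the action is by partial injections. -/
theorem Acts.inv {Y Z : RightCoset H} {m : M} (h : Y.Acts m Z) : Z.Acts m⁻¹ Y := by
  obtain ⟨n, hn, rfl⟩ := exists_rep Y
  obtain ⟨h1, rfl⟩ := (acts_mk_iff hH hn).1 h
  have h2 : n * m * m⁻¹ * (n * m * m⁻¹)⁻¹ ∈ H := by
    have : n * m * m⁻¹ * (n * m * m⁻¹)⁻¹ = n * m * (n * m)⁻¹ := by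
      rw [mul_inv', mul_inv', inv_inv']
      calc n * m * m⁻¹ * (m * (m⁻¹ * n⁻¹)) = n * (m * m⁻¹ * m) * (m⁻¹ * n⁻¹) := by
            simp only [mul_assoc]
        _ = _ := by rw [mul_inv_mul_self]
    rwa [this]
  refine (acts_mk_iff hH h1).2 ⟨h2, (mk_eq_mk_iff hH hn h2).2 ?_⟩
  have : n * (n * m * m⁻¹)⁻¹ = n * m * (n * m)⁻¹ := by
    simp only [mul_inv', inv_inv', mul_assoc]
  rwa [this]

theorem Acts.injective {Y Y' Z : RightCoset H} {m : M} (h : Y.Acts m Z) (h' : Y'.Acts m Z) :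
    Y = Y' := (h.inv hH).unique (h'.inv hH)

/-- The intermediate coset exists because the domain idempotent of `n m m'` lies below that of `n
m`, and `H` is closed upward. -/
theorem acts_mul_iff {Y Z : RightCoset H} {m m' : M} :
    Y.Acts (m * m') Z ↔ ∃ W : RightCoset H, Y.Acts m W ∧ W.Acts m' Z := by
  obtain ⟨n, hn, rfl⟩ := exists_rep Y
  constructor
  · intro h
    obtain ⟨h1, rfl⟩ := (acts_mk_iff hH hn).1 h
    have h2 : n * m * (n * m)⁻¹ ∈ H := by
      refine hH.mem_of_le ?_ h1
      rw [← mul_assoc, mul_inv' (n * m)]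
      have : n * m * m' * (m'⁻¹ * (n * m)⁻¹) = n * m * (m' * m'⁻¹) * (n * m)⁻¹ := by
        simp only [mul_assoc]
      rw [this]
      exact (NatLE.of_mul_idem (mul_inv_idem m') _).mul_right _
    refine ⟨mk (n * m) h2, (acts_mk_iff hH hn).2 ⟨h2, rfl⟩, (acts_mk_iff hH h2).2 ?_⟩
    refine ⟨by rwa [← mul_assoc] at h1, ?_⟩
    simp only [mul_assoc]
  · rintro ⟨W, h1, h2⟩
    obtain ⟨h3, rfl⟩ := (acts_mk_iff hH hn).1 h1
    obtain ⟨h4, rfl⟩ := (acts_mk_iff hH h3).1 h2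
    refine (acts_mk_iff hH hn).2 ⟨by rwa [← mul_assoc], ?_⟩
    simp only [mul_assoc]

theorem Acts.mono {Y Z : RightCoset H} {m m' : M} (hle : NatLE m m') (h : Y.Acts m Z) :
    Y.Acts m' Z := by
  obtain ⟨n, hn, rfl⟩ := exists_rep Y
  obtain ⟨h1, rfl⟩ := (acts_mk_iff hH hn).1 h
  have hle' := hle.mul_left n
  have h2 := hH.mem_of_le (hle'.mul hle'.inv) h1
  exact (acts_mk_iff hH hn).2 ⟨h2, (mk_eq_mk_iff hH h1 h2).2
    (hH.mem_of_le ((NatLE.refl (n * m)).mul hle'.inv) h1)⟩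

theorem acts_one (Y : RightCoset H) : Y.Acts 1 Y := by
  obtain ⟨n, hn, rfl⟩ := exists_rep Y
  refine (acts_mk_iff hH hn).2 ⟨by rwa [mul_one], ?_⟩
  simp only [mul_one]

/-- An idempotent lies below `1`, which fixes every coset. For this reason the edges of `Γ_H`
labeled over `P` are loops. -/
theorem Acts.eq_of_idem {Y Z : RightCoset H} {e : M} (he : e * e = e) (h : Y.Acts e Z) : Z = Y :=
  (h.mono hH ⟨e, he, (mul_one e).symm⟩).unique (acts_one hH Y)

/-- The stabilizer of the base coset is what becomes the loop monoid of the coset complex. -/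
theorem base_acts_base_iff {m : M} : (base hH).Acts m (base hH) ↔ m ∈ H := by
  rw [base_eq hH, acts_mk_iff hH]
  constructor
  · rintro ⟨h, h'⟩
    have := (mk_eq_mk_iff hH _ _).1 h'.symm
    simpa [inv_eq_self_of_idem] using this
  · intro h
    have h' : 1 * m * (1 * m)⁻¹ ∈ H := by
      rw [one_mul]; exact hH.mul_mem _ h _ (hH.inv_mem _ h)
    refine ⟨h', ((mk_eq_mk_iff hH _ _).2 ?_).symm⟩
    simpa [inv_eq_self_of_idem] using h

theorem exists_base_acts (Y : RightCoset H) : ∃ m, (base hH).Acts m Y := by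
  obtain ⟨n, hn, rfl⟩ := exists_rep Y
  refine ⟨n, ?_⟩
  rw [base_eq hH, acts_mk_iff hH]
  refine ⟨by rwa [one_mul], ?_⟩
  simp only [one_mul]

end RightCoset

end InverseMonoid

/-! ### Open cells, points and boundaries of `2`-complexes -/

namespace TwoComplex

variable (C : TwoComplex.{u})

/-- The closed `n`-cell. -/
abbrev closedCell {n : ℕ} (e : C.Cell n) : Set C :=
  RelCWComplex.closedCell (C := (Set.univ : Set C)) n e

theorem exists_mem_openCell (x : C) : ∃ (n : ℕ) (e : C.Cell n), x ∈ C.openCell e := by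
  have h : x ∈ ⋃ (n : ℕ) (j : C.Cell n), C.openCell j := by
    rw [CWComplex.iUnion_openCell_eq_complex]
    trivial
  simpa using h

variable {C}

theorem sigma_eq_of_mem {n m : ℕ} {e : C.Cell n} {e' : C.Cell m} {x : C} (h : x ∈ C.openCell e)
    (h' : x ∈ C.openCell e') : (⟨n, e⟩ : Σ n, C.Cell n) = ⟨m, e'⟩ :=
  RelCWComplex.eq_of_not_disjoint_openCell (not_disjoint_iff.2 ⟨x, h, h'⟩)

theorem dim_eq_of_mem {n m : ℕ} {e : C.Cell n} {e' : C.Cell m} {x : C} (h : x ∈ C.openCell e)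
    (h' : x ∈ C.openCell e') : n = m :=
  congrArg Sigma.fst (sigma_eq_of_mem h h')

theorem eq_of_mem {n : ℕ} {e e' : C.Cell n} {x : C} (h : x ∈ C.openCell e)
    (h' : x ∈ C.openCell e') : e = e' :=
  eq_of_heq (Sigma.mk.inj (sigma_eq_of_mem h h')).2

theorem charMap_injOn {n : ℕ} (e : C.Cell n) : InjOn (C.charMap e) (ball 0 1) := by
  have := (RelCWComplex.map (C := (Set.univ : Set C)) n e).injOn
  rwa [RelCWComplex.source_eq] at this

theorem charMap_continuousOn {n : ℕ} (e : C.Cell n) :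
    ContinuousOn (C.charMap e) (closedBall 0 1) :=
  RelCWComplex.continuousOn n e

theorem charMap_mem {n : ℕ} (e : C.Cell n) {y : Fin n → ℝ} (hy : y ∈ ball (0 : Fin n → ℝ) 1) :
    C.charMap e y ∈ C.openCell e := mem_image_of_mem _ hy

theorem charMap_zero_mem {n : ℕ} (e : C.Cell n) : C.charMap e 0 ∈ C.openCell e :=
  charMap_mem e (mem_ball_self one_pos)

theorem exists_lower_of_sphere {n : ℕ} (e : C.Cell n) {y : Fin n → ℝ}
    (hy : y ∈ sphere (0 : Fin n → ℝ) 1) :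
    ∃ m < n, ∃ e' : C.Cell m, C.charMap e y ∈ C.openCell e' := by
  obtain ⟨I, hI⟩ := CWComplex.cellFrontier_subset_finite_openCell (C := (Set.univ : Set C)) n e
  have := hI (mem_image_of_mem _ hy)
  simp only [mem_iUnion] at this
  obtain ⟨m, hm, j, _, h⟩ := this
  exact ⟨m, hm, j, h⟩

theorem exists_lower_of_mem_closedCell {n : ℕ} (e : C.Cell n) {x : C} (hx : x ∈ C.closedCell e)
    (hx' : x ∉ C.openCell e) : ∃ m < n, ∃ e' : C.Cell m, x ∈ C.openCell e' := by
  obtain ⟨y, hy, rfl⟩ := hx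
  rw [← ball_union_sphere] at hy
  rcases hy with hy | hy
  · exact absurd (charMap_mem e hy) hx'
  · exact exists_lower_of_sphere e hy

theorem point_mem (v : C.Cell 0) : C.point v ∈ C.openCell v := charMap_zero_mem v

theorem eq_point_of_mem {v : C.Cell 0} {x : C} (h : x ∈ C.openCell v) : x = C.point v := by
  obtain ⟨y, -, rfl⟩ := h
  rw [Subsingleton.elim y 0]

theorem point_injective : Function.Injective C.point := fun _ _ h =>
  eq_of_mem (point_mem _) (h ▸ point_mem _)

theorem dim_le_two {n : ℕ} (e : C.Cell n) : n ≤ 2 := by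
  by_contra h
  exact (C.dim_le n (not_le.1 h)).false e

end TwoComplex

/-! ### Lifting characteristic maps through an immersion -/

open TwoComplex

/-- `V` and the complement of its closure are disjoint open sets covering `s`. -/
theorem IsPreconnected.subset_of_disjoint_frontier {α : Type*} [TopologicalSpace α] {s V : Set α}
    (hs : IsPreconnected s) (hV : IsOpen V) (hd : ∀ x ∈ s, x ∉ frontier V)
    (hn : (s ∩ V).Nonempty) : s ⊆ V := by
  refine hs.subset_left_of_subset_union hV isClosed_closure.isOpen_compl
    (disjoint_compl_right_iff_subset.2 subset_closure) (fun x hx => ?_) hn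
  by_cases h : x ∈ closure V
  · left
    by_contra h'
    exact hd x hx ⟨h, by rwa [hV.interior_eq]⟩
  · exact Or.inr h

/-- A partial lift of a path-like map through a locally injective map on a compact space has
limits. -/
theorem tendsto_lift_of_locallyInjective {K B : Type*} [TopologicalSpace K] [CompactSpace K]
    [T2Space K] [TopologicalSpace B] [T2Space B] {n : ℕ} {q : K → B} (hq : Continuous q)
    (hinj : ∀ c : K, ∃ N ∈ 𝓝 c, InjOn q N) {φ : (Fin n → ℝ) → B}
    (hφ : ContinuousOn φ (closedBall 0 1)) {g : (Fin n → ℝ) → K} (hg : ContinuousOn g (ball 0 1))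
    (hlift : ∀ y ∈ ball (0 : Fin n → ℝ) 1, q (g y) = φ y) {x : Fin n → ℝ}
    (hx : x ∈ closedBall (0 : Fin n → ℝ) 1) :
    ∃ c, Filter.Tendsto g (𝓝[ball 0 1] x) (𝓝 c) ∧ q c = φ x := by
  have hx' : x ∈ closure (ball (0 : Fin n → ℝ) 1) := by rwa [closure_ball _ one_ne_zero]
  have : (𝓝[ball (0 : Fin n → ℝ) 1] x).NeBot := mem_closure_iff_nhdsWithin_neBot.1 hx'
  have hφx : Filter.Tendsto φ (𝓝[ball 0 1] x) (𝓝 (φ x)) :=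
    (hφ x hx).mono_left (nhdsWithin_mono _ ball_subset_closedBall)
  -- Compactness supplies a candidate limit; it lies over `φ x` by continuity of `q` and the
  -- Hausdorff property of `B`.
  obtain ⟨c, hc⟩ := exists_clusterPt_of_compactSpace (Filter.map g (𝓝[ball 0 1] x))
  have hqg : Filter.Tendsto q (Filter.map g (𝓝[ball 0 1] x)) (𝓝 (φ x)) := by
    rw [Filter.tendsto_map'_iff]
    refine hφx.congr' ?_
    filter_upwards [self_mem_nhdsWithin] with y hy
    exact (hlift y hy).symm
  have hqc : q c = φ x := by
    have := hc.map hq.continuousAt hqg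
    exact eq_of_nhds_neBot this
  refine ⟨c, ?_, hqc⟩
  intro U hU
  obtain ⟨N, hN, hNi⟩ := hinj c
  -- A closed neighborhood on which `q` is injective: the frontier of its interior `V` then contains
  -- no point over `φ x`, and its image is compact, so `φ` avoids that image near `x`.
  obtain ⟨V', hV', hV'c, hV's⟩ := exists_mem_nhds_isClosed_subset (Filter.inter_mem hU hN)
  set V := interior V' with hV
  have hVo : IsOpen V := isOpen_interior
  have hcV : c ∈ V := mem_interior_iff_mem_nhds.2 hV'
  have hfr : frontier V ⊆ V' := frontier_subset_closure.trans
    (closure_minimal interior_subset hV'c)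
  have hz : φ x ∉ q '' frontier V := by
    rintro ⟨d, hd, hdx⟩
    have : d = c := hNi (hV's (hfr hd)).2 (hV's (interior_subset hcV)).2 (hdx.trans hqc.symm)
    subst this
    exact hd.2 (by rwa [hVo.interior_eq])
  have hcl : IsClosed (q '' frontier V) := (isClosed_frontier.isCompact.image hq).isClosed
  have hW := hφx (hcl.isOpen_compl.mem_nhds hz)
  rw [Filter.mem_map, Metric.mem_nhdsWithin_iff] at hW
  obtain ⟨ε, hε, hW⟩ := hW
  have hS : ball x ε ∩ ball 0 1 ∈ 𝓝[ball (0 : Fin n → ℝ) 1] x :=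
    Filter.inter_mem (mem_nhdsWithin_of_mem_nhds (ball_mem_nhds x hε)) self_mem_nhdsWithin
  -- The intersection of the two balls is convex, so its image under `g` is connected. It misses the
  -- frontier of `V` and meets `V` since `c` is a cluster point; hence it stays in `V`.
  have hpre : IsPreconnected (g '' (ball x ε ∩ ball 0 1)) :=
    ((convex_ball x ε).inter (convex_ball 0 1)).isPreconnected.image g
      (hg.mono inter_subset_right)
  have hsub : g '' (ball x ε ∩ ball 0 1) ⊆ V := by
    refine hpre.subset_of_disjoint_frontier hVo ?_ ?_
    · rintro _ ⟨y, hy, rfl⟩ hy'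
      apply hW hy
      rw [← hlift y hy.2]
      exact mem_image_of_mem q hy'
    · have := (clusterPt_iff_nonempty.1 hc) (hVo.mem_nhds hcV) (Filter.image_mem_map hS)
      rwa [inter_comm] at this
  refine Filter.mem_map.2 ?_
  filter_upwards [hS] with y hy
  exact (hV's (interior_subset (hsub (mem_image_of_mem g hy)))).1

namespace IsImmersion

variable {D C : TwoComplex.{u}} {f : D → C} (hf : IsImmersion D C f)
include hf

theorem exists_injOn_nhds (y : D) : ∃ U ∈ 𝓝 y, InjOn f U := by
  obtain ⟨U, hU, hU'⟩ := hf.locally_embedding y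
  exact ⟨U, hU, injOn_iff_injective.2 hU'.injective⟩

theorem isLocallyInjective : IsLocallyInjective f := by
  intro x
  obtain ⟨U, hU, hU'⟩ := hf.exists_injOn_nhds x
  exact ⟨interior U, isOpen_interior, mem_interior_iff_mem_nhds.2 hU, hU'.mono interior_subset⟩

/-- Unique lifting: agreement is an open condition because `f` is locally injective, and a closed
one because `D` is Hausdorff. -/
theorem eqOn_of_lift {A : Type*} [TopologicalSpace A] {s : Set A} (hs : IsPreconnected s)
    {g h : A → D} (hg : ContinuousOn g s) (hh : ContinuousOn h s)
    (he : ∀ a ∈ s, f (g a) = f (h a)) {a : A} (ha : a ∈ s) (hga : g a = h a) : EqOn g h s :=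
  (T2Space.isSeparatedMap f).eqOn_of_comp_eqOn hf.isLocallyInjective hs hg hh he ha hga

/-- The cell of the target onto which a cell is mapped. -/
noncomputable def base {n : ℕ} (e : D.Cell n) : C.Cell n := (hf.cellular n e).choose

theorem bijOn_base {n : ℕ} (e : D.Cell n) : BijOn f (D.openCell e) (C.openCell (hf.base e)) :=
  (hf.cellular n e).choose_spec

theorem mem_of_map_mem {n : ℕ} {b : C.Cell n} {x : D} (h : f x ∈ C.openCell b) :
    ∃ e : D.Cell n, x ∈ D.openCell e ∧ hf.base e = b := by
  obtain ⟨m, e, he⟩ := D.exists_mem_openCell x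
  have h' := (hf.bijOn_base e).mapsTo he
  obtain rfl := dim_eq_of_mem h' h
  exact ⟨e, he, eq_of_mem h' h⟩

/-- Over the open ball the lift is the characteristic map of the base cell followed by the inverse
of `f` on the open cell. It extends to the sphere because lifts into the compact closed cell have
limits at boundary points. -/
theorem exists_isLiftedCharMap {n : ℕ} (e : D.Cell n) :
    ∃ G, IsLiftedCharMap f e (hf.base e) G := by
  set b := hf.base e
  have hbij := hf.bijOn_base e
  set K := D.closedCell e with hK
  have hKc : IsCompact K := RelCWComplex.isCompact_closedCell
  have : CompactSpace K := isCompact_iff_compactSpace.1 hKc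
  have hOK : D.openCell e ⊆ K := RelCWComplex.openCell_subset_closedCell n e
  -- The rest of the closed cell lies in cells of lower dimension, and `f` preserves the dimension
  -- of cells.
  have hmem : ∀ x ∈ K, f x ∈ C.openCell b → x ∈ D.openCell e := by
    intro x hx hfx
    by_contra hxo
    obtain ⟨m, hm, e', he'⟩ := exists_lower_of_mem_closedCell e hx hxo
    exact hm.ne (dim_eq_of_mem ((hf.bijOn_base e').mapsTo he') hfx)
  have hex : ∀ y : Fin n → ℝ, ∃ k : K, y ∈ ball (0 : Fin n → ℝ) 1 →
      (k : D) ∈ D.openCell e ∧ f k = C.charMap b y := by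
    intro y
    by_cases hy : y ∈ ball (0 : Fin n → ℝ) 1
    · obtain ⟨x, hx, hxy⟩ := hbij.surjOn (charMap_mem b hy)
      exact ⟨⟨x, hOK hx⟩, fun _ => ⟨hx, hxy⟩⟩
    · obtain ⟨x, hx⟩ := RelCWComplex.closedCell_nonempty n e
      exact ⟨⟨x, hx⟩, fun h => absurd h hy⟩
  choose g hg using hex
  have hq : Continuous fun k : K => f k := hf.continuous.comp continuous_subtype_val
  -- By compactness `f` is a closed map on `K`, and the preimage of `A` under `g` is the preimage of
  -- `f '' A` under the characteristic map below.
  have hgc : ContinuousOn g (ball 0 1) := by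
    rw [continuousOn_iff_isClosed]
    intro A hA
    have hcl : IsClosed ((fun k : K => f k) '' A) := (hA.isCompact.image hq).isClosed
    obtain ⟨u, hu, hu'⟩ := continuousOn_iff_isClosed.1
      ((charMap_continuousOn b).mono ball_subset_closedBall) _ hcl
    refine ⟨u, hu, ?_⟩
    rw [← hu']
    ext y
    refine and_congr_left fun hy => ?_
    constructor
    · intro h
      exact ⟨g y, h, (hg y hy).2⟩
    · rintro ⟨k, hk, hky⟩
      have h1 : (k : D) ∈ D.openCell e := hmem k k.2 (by
        rw [show f k = C.charMap b y from hky]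
        exact charMap_mem b hy)
      have h2 : k = g y :=
        Subtype.ext (hbij.injOn h1 (hg y hy).1 (hky.trans (hg y hy).2.symm))
      rw [h2] at hk
      exact hk
  have hinj : ∀ c : K, ∃ N ∈ 𝓝 c, InjOn (fun k : K => f k) N := by
    intro c
    obtain ⟨U, hU, hU'⟩ := hf.exists_injOn_nhds c
    exact ⟨Subtype.val ⁻¹' U, continuous_subtype_val.continuousAt hU, fun x hx y hy h =>
      Subtype.ext (hU' hx hy h)⟩
  have hlim : ∀ x ∈ closedBall (0 : Fin n → ℝ) 1, ∃ c,
      Filter.Tendsto g (𝓝[ball 0 1] x) (𝓝 c) ∧ f c = C.charMap b x := fun x hx =>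
    tendsto_lift_of_locallyInjective hq hinj (charMap_continuousOn b) hgc
      (fun y hy => (hg y hy).2) hx
  have hclos : closedBall (0 : Fin n → ℝ) 1 ⊆ closure (ball 0 1) := by
    rw [closure_ball _ one_ne_zero]
  have hGc : ContinuousOn (extendFrom (ball 0 1) g) (closedBall 0 1) :=
    continuousOn_extendFrom hclos fun x hx => (hlim x hx).imp fun c hc => hc.1
  refine ⟨fun y => (extendFrom (ball 0 1) g y : K), continuous_subtype_val.comp_continuousOn hGc, ?_, ?_⟩
  · intro y hy
    have h1 := extendFrom_extends hgc y hy
    change ((extendFrom (ball 0 1) g y : K) : D) ∈ _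
    rw [h1]
    exact (hg y hy).1
  · intro y hy
    obtain ⟨c, hc, hc'⟩ := hlim y hy
    rw [extendFrom_eq (hclos hy) hc, hc']

end IsImmersion

namespace IsLiftedCharMap

variable {D C : TwoComplex.{u}} {f : D → C} (hf : IsImmersion D C f) {n : ℕ} {e e' : D.Cell n}
  {b b' : C.Cell n} {G G' : (Fin n → ℝ) → D}

include hf

theorem eqOn (hG : IsLiftedCharMap f e b G) (hG' : IsLiftedCharMap f e' b G') {y : Fin n → ℝ}
    (hy : y ∈ closedBall (0 : Fin n → ℝ) 1) (h : G y = G' y) : EqOn G G' (closedBall 0 1) :=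
  hf.eqOn_of_lift (convex_closedBall 0 1).isPreconnected hG.continuousOn hG'.continuousOn
    (fun a ha => (hG.lift a ha).trans (hG'.lift a ha).symm) hy h

omit hf in
theorem zero_mem (hG : IsLiftedCharMap f e b G) : G 0 ∈ D.openCell e :=
  hG.mapsTo (mem_ball_self one_pos)

/-- The source of determinism: agreement at one point, even on the boundary, propagates to the
center of the ball, which goes into the open cell. -/
theorem cell_eq (hG : IsLiftedCharMap f e b G) (hG' : IsLiftedCharMap f e' b G') {y : Fin n → ℝ}
    (hy : y ∈ closedBall (0 : Fin n → ℝ) 1) (h : G y = G' y) : e = e' := by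
  have := hG.eqOn hf hG' hy h (mem_closedBall_self zero_le_one)
  exact eq_of_mem hG.zero_mem (this ▸ hG'.zero_mem)

theorem base_eq (hG : IsLiftedCharMap f e b G) : hf.base e = b := by
  refine eq_of_mem ((hf.bijOn_base e).mapsTo hG.zero_mem) ?_
  rw [hG.lift 0 (mem_closedBall_self zero_le_one)]
  exact charMap_zero_mem b

/-- The cell `e` has only one point over the center of its base cell, so the two lifts agree at `0`.
-/
theorem unique (hG : IsLiftedCharMap f e b G) (hG' : IsLiftedCharMap f e b' G') :
    b = b' ∧ EqOn G G' (closedBall 0 1) := by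
  obtain rfl : b = b' := (hG.base_eq hf).symm.trans (hG'.base_eq hf)
  refine ⟨rfl, hG.eqOn hf hG' (mem_closedBall_self zero_le_one) ?_⟩
  refine (hf.bijOn_base e).injOn hG.zero_mem hG'.zero_mem ?_
  rw [hG.lift 0 (mem_closedBall_self zero_le_one), hG'.lift 0 (mem_closedBall_self zero_le_one)]

theorem image_ball (hG : IsLiftedCharMap f e b G) : G '' ball 0 1 = D.openCell e := by
  refine Subset.antisymm (image_subset_iff.2 hG.mapsTo) fun x hx => ?_
  have h := (hf.bijOn_base e).mapsTo hx
  rw [hG.base_eq hf] at h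
  obtain ⟨y, hy, hyx⟩ := h
  refine ⟨y, hy, (hf.bijOn_base e).injOn (hG.mapsTo hy) hx ?_⟩
  rw [hG.lift y (ball_subset_closedBall hy)]
  exact hyx

theorem image_closedBall (hG : IsLiftedCharMap f e b G) :
    G '' closedBall 0 1 = D.closedCell e := by
  have hc : closure (ball (0 : Fin n → ℝ) 1) = closedBall 0 1 := closure_ball _ one_ne_zero
  have hcl : closure (D.openCell e) = D.closedCell e := RelCWComplex.closure_openCell_eq_closedCell
  apply Subset.antisymm
  · rw [← hcl, ← hG.image_ball hf, ← hc]
    exact (hc ▸ hG.continuousOn).image_closure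
  · rw [← hcl, ← hG.image_ball hf]
    refine closure_minimal (image_mono ball_subset_closedBall) ?_
    exact ((isCompact_closedBall _ _).image_of_continuousOn hG.continuousOn).isClosed

theorem eq_of_map (hG : IsLiftedCharMap f e b G) {x : D} (hx : x ∈ D.openCell e)
    {y : Fin n → ℝ} (hy : y ∈ ball (0 : Fin n → ℝ) 1) (h : f x = C.charMap b y) : G y = x := by
  refine (hf.bijOn_base e).injOn (hG.mapsTo hy) hx ?_
  rw [hG.lift y (ball_subset_closedBall hy), h]

end IsLiftedCharMap

/-! ### Edges, faces and boundary walks over the bouquet -/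

namespace BouquetLabeling

variable {X P : Type u} {B : TwoComplex.{u}} (L : BouquetLabeling X P B)

/-- The base point of the bouquet. -/
abbrev basePoint : B := B.point L.vertex.default

theorem eq_basePoint_of_mem {v : B.Cell 0} {x : B} (h : x ∈ B.openCell v) : x = L.basePoint := by
  rw [eq_point_of_mem h, L.vertex.uniq v]

theorem charMap_edge_of_sphere (x : X) {y : Fin 1 → ℝ} (hy : y ∈ sphere (0 : Fin 1 → ℝ) 1) :
    B.charMap (L.edge x) y = L.basePoint := by
  obtain ⟨m, hm, e', he'⟩ := exists_lower_of_sphere _ hy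
  obtain rfl : m = 0 := by omega
  exact L.eq_basePoint_of_mem he'

/-- The parametrization of `[-1, 1]` by `[0, 1]`, increasing or decreasing. -/
def segment (s : Bool) (t : ℝ) : Fin 1 → ℝ := fun _ => if s then 2 * t - 1 else 1 - 2 * t

theorem segment_true (t : ℝ) : segment true t = fun _ => 2 * t - 1 := rfl

theorem segment_false (t : ℝ) : segment false t = fun _ => 1 - 2 * t := rfl

theorem continuous_segment (s : Bool) : Continuous (segment s) := by
  cases s
  · simp only [funext segment_false]; fun_prop
  · simp only [funext segment_true]; fun_prop

theorem norm_fin_one (y : Fin 1 → ℝ) : ‖y‖ = |y 0| := by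
  rw [← Real.norm_eq_abs]
  simp [Pi.norm_def]

theorem mem_closedBall_fin_one {y : Fin 1 → ℝ} :
    y ∈ closedBall (0 : Fin 1 → ℝ) 1 ↔ |y 0| ≤ 1 := by
  rw [mem_closedBall_zero_iff, norm_fin_one]

theorem mem_sphere_fin_one {y : Fin 1 → ℝ} :
    y ∈ sphere (0 : Fin 1 → ℝ) 1 ↔ y = (fun _ => -1) ∨ y = fun _ => 1 := by
  rw [mem_sphere_zero_iff_norm, norm_fin_one, abs_eq zero_le_one, or_comm]
  refine or_congr ⟨fun h => ?_, fun h => by rw [h]⟩ ⟨fun h => ?_, fun h => by rw [h]⟩ <;>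
  · funext i
    rw [Subsingleton.elim i 0, h]

theorem segment_mem {s : Bool} {t : ℝ} (ht : t ∈ Icc (0 : ℝ) 1) :
    segment s t ∈ closedBall (0 : Fin 1 → ℝ) 1 := by
  rw [mem_closedBall_fin_one, abs_le]
  cases s <;> constructor <;> simp [segment] <;> linarith [ht.1, ht.2]

theorem segment_mem_ball {s : Bool} {t : ℝ} (ht : t ∈ Ioo (0 : ℝ) 1) :
    segment s t ∈ ball (0 : Fin 1 → ℝ) 1 := by
  rw [mem_ball_zero_iff, norm_fin_one, abs_lt]
  cases s <;> constructor <;> simp [segment] <;> linarith [ht.1, ht.2]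

theorem segment_true_zero : segment true 0 = fun _ => -1 := by
  simp [segment_true]

theorem segment_true_one : segment true 1 = fun _ => 1 := by
  funext i
  rw [segment_true]
  norm_num

theorem segment_false_zero : segment false 0 = fun _ => 1 := by
  simp [segment_false]

theorem segment_false_one : segment false 1 = fun _ => -1 := by
  funext i
  rw [segment_false]
  norm_num

theorem segment_half (s : Bool) : segment s (1 / 2) = 0 := by
  funext; cases s <;> simp [segment]

theorem neg_one_mem_closedBall : (fun _ => -1 : Fin 1 → ℝ) ∈ closedBall (0 : Fin 1 → ℝ) 1 := by
  simp

theorem one_mem_closedBall : (fun _ => 1 : Fin 1 → ℝ) ∈ closedBall (0 : Fin 1 → ℝ) 1 := by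
  simp

theorem circle_mem (ρ : P) {s : ℝ} (hs : s ∈ Icc (0 : ℝ) 1) :
    L.circle ρ s ∈ sphere (0 : Fin 2 → ℝ) 1 := by
  rcases hs.2.eq_or_lt with h | h
  · rw [h, L.circle_closed ρ]
    exact (L.circle_bijOn ρ).mapsTo ⟨le_rfl, one_pos⟩
  · exact (L.circle_bijOn ρ).mapsTo ⟨hs.1, h⟩

theorem circle_mem_closedBall (ρ : P) {s : ℝ} (hs : s ∈ Icc (0 : ℝ) 1) :
    L.circle ρ s ∈ closedBall (0 : Fin 2 → ℝ) 1 := sphere_subset_closedBall (L.circle_mem ρ hs)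

theorem exists_circle_eq (ρ : P) {y : Fin 2 → ℝ} (hy : y ∈ sphere (0 : Fin 2 → ℝ) 1) :
    ∃ s ∈ Icc (0 : ℝ) 1, L.circle ρ s = y := by
  obtain ⟨s, hs, h⟩ := (L.circle_bijOn ρ).surjOn hy
  exact ⟨s, Ico_subset_Icc_self hs, h⟩

theorem div_mem_Icc {k i : ℕ} (hi : i < k) {t : ℝ} (ht : t ∈ Icc (0 : ℝ) 1) :
    (i + t) / k ∈ Icc (0 : ℝ) 1 := by
  have hk : (0 : ℝ) < k := by exact_mod_cast (Nat.zero_le i).trans_lt hi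
  have h : (i : ℝ) + 1 ≤ k := by exact_mod_cast hi
  refine ⟨div_nonneg (add_nonneg (Nat.cast_nonneg i) ht.1) hk.le, ?_⟩
  rw [div_le_one hk]
  linarith [ht.2]

theorem exists_div_eq {k : ℕ} (hk : 0 < k) {s : ℝ} (hs : s ∈ Icc (0 : ℝ) 1) :
    ∃ i < k, ∃ t ∈ Icc (0 : ℝ) 1, s = ((i : ℕ) + t) / k := by
  have hk' : (0 : ℝ) < k := by exact_mod_cast hk
  rcases hs.2.eq_or_lt with h | h
  -- The parameter `s = 1` is the end of the last segment; the floor used below would give the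
  -- invalid index `k`.
  · refine ⟨k - 1, by omega, 1, ⟨zero_le_one, le_rfl⟩, ?_⟩
    rw [h, eq_div_iff hk'.ne', Nat.cast_sub hk]
    simp
  · have h0 : 0 ≤ s * k := mul_nonneg hs.1 hk'.le
    refine ⟨⌊s * k⌋₊, ?_, s * k - ⌊s * k⌋₊, ⟨?_, ?_⟩, ?_⟩
    · rw [Nat.floor_lt h0]
      nlinarith
    · linarith [Nat.floor_le h0]
    · linarith [Nat.lt_floor_add_one (s * k)]
    · rw [eq_div_iff hk'.ne']
      ring

theorem charMap_circle (ρ : P) (i : Fin (L.bl ρ).length) {t : ℝ} (ht : t ∈ Icc (0 : ℝ) 1) :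
    B.charMap (L.face ρ) (L.circle ρ ((i + t) / (L.bl ρ).length)) =
      B.charMap (L.edge ((L.bl ρ).get i).1) (segment ((L.bl ρ).get i).2 t) :=
  L.boundary_cons ρ i t ht

theorem charMap_root (ρ : P) : B.charMap (L.face ρ) (L.circle ρ 0) = L.basePoint := by
  rcases Nat.eq_zero_or_pos (L.bl ρ).length with h | h
  · exact L.boundary_nil ρ (List.length_eq_zero_iff.1 h) _ (L.circle_mem ρ ⟨le_rfl, zero_le_one⟩)
  · have := L.charMap_circle ρ ⟨0, h⟩ (t := 0) ⟨le_rfl, zero_le_one⟩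
    simp only [Nat.cast_zero, add_zero, zero_div] at this
    rw [this]
    apply L.charMap_edge_of_sphere
    rw [mem_sphere_fin_one]
    cases ((L.bl ρ).get ⟨0, h⟩).2
    · exact Or.inr segment_false_zero
    · exact Or.inl segment_true_zero

variable {L} {C : TwoComplex.{u}} {f : C → B} (hf : IsImmersion C B f)

include hf

theorem exists_point_eq {x : C} (h : f x = L.basePoint) : ∃ v, x = C.point v := by
  obtain ⟨v, hv, -⟩ := hf.mem_of_map_mem (b := L.vertex.default) (x := x) (by
    rw [h]; exact point_mem _)
  exact ⟨v, eq_point_of_mem hv⟩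

theorem exists_lift_edge (e : C.Cell 1) : ∃ x G, IsLiftedCharMap f e (L.edge x) G := by
  obtain ⟨G, hG⟩ := hf.exists_isLiftedCharMap e
  exact ⟨L.edge.symm (hf.base e), G, by rwa [Equiv.apply_symm_apply]⟩

theorem exists_isEdge_of_lift {e : C.Cell 1} {x : X} {G} (hG : IsLiftedCharMap f e (L.edge x) G) :
    ∃ v w, G (fun _ => -1) = C.point v ∧ G (fun _ => 1) = C.point w ∧ L.IsEdge f e x v w := by
  obtain ⟨v, hv⟩ := exists_point_eq (L := L) hf (x := G fun _ => -1)
    (by rw [hG.lift _ neg_one_mem_closedBall, L.charMap_edge_of_sphere]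
        exact mem_sphere_fin_one.2 (Or.inl rfl))
  obtain ⟨w, hw⟩ := exists_point_eq (L := L) hf (x := G fun _ => 1)
    (by rw [hG.lift _ one_mem_closedBall, L.charMap_edge_of_sphere]
        exact mem_sphere_fin_one.2 (Or.inr rfl))
  exact ⟨v, w, hv, hw, G, hG, hv, hw⟩

theorem exists_isEdge (e : C.Cell 1) : ∃ x v w, L.IsEdge f e x v w := by
  obtain ⟨x, G, hG⟩ := exists_lift_edge (L := L) hf e
  obtain ⟨v, w, -, -, h⟩ := exists_isEdge_of_lift hf hG
  exact ⟨x, v, w, h⟩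

theorem exists_isFace (c : C.Cell 2) : ∃ ρ v, L.IsFace f c ρ v := by
  obtain ⟨G, hG⟩ := hf.exists_isLiftedCharMap c
  obtain ⟨v, hv⟩ := exists_point_eq (L := L) hf
    (x := G (L.circle (L.face.symm (hf.base c)) 0)) (by
      rw [hG.lift _ (L.circle_mem_closedBall _ ⟨le_rfl, zero_le_one⟩), ← L.charMap_root
        (L.face.symm (hf.base c)), Equiv.apply_symm_apply])
  exact ⟨_, v, G, by rwa [Equiv.apply_symm_apply], hv⟩

/-- Two edges over the same letter with a common source coincide. -/
theorem IsEdge.source_unique {e e' : C.Cell 1} {x : X} {v w w' : C.Cell 0}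
    (h : L.IsEdge f e x v w) (h' : L.IsEdge f e' x v w') : e = e' ∧ w = w' := by
  obtain ⟨G, hG, h1, h2⟩ := h
  obtain ⟨G', hG', h1', h2'⟩ := h'
  have h0 : G (fun _ => -1) = G' fun _ => -1 := h1.trans h1'.symm
  refine ⟨hG.cell_eq hf hG' neg_one_mem_closedBall h0, point_injective ?_⟩
  rw [← h2, ← h2', hG.eqOn hf hG' neg_one_mem_closedBall h0 one_mem_closedBall]

theorem IsEdge.target_unique {e e' : C.Cell 1} {x : X} {v v' w : C.Cell 0}
    (h : L.IsEdge f e x v w) (h' : L.IsEdge f e' x v' w) : e = e' ∧ v = v' := by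
  obtain ⟨G, hG, h1, h2⟩ := h
  obtain ⟨G', hG', h1', h2'⟩ := h'
  have h0 : G (fun _ => 1) = G' fun _ => 1 := h2.trans h2'.symm
  refine ⟨hG.cell_eq hf hG' one_mem_closedBall h0, point_injective ?_⟩
  rw [← h1, ← h1', hG.eqOn hf hG' one_mem_closedBall h0 neg_one_mem_closedBall]

theorem IsEdge.eq_of_cell {e : C.Cell 1} {x x' : X} {v v' w w' : C.Cell 0}
    (h : L.IsEdge f e x v w) (h' : L.IsEdge f e x' v' w') : x = x' ∧ v = v' ∧ w = w' := by
  obtain ⟨G, hG, h1, h2⟩ := h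
  obtain ⟨G', hG', h1', h2'⟩ := h'
  obtain ⟨hx, heq⟩ := hG.unique hf hG'
  refine ⟨L.edge.injective hx, point_injective ?_, point_injective ?_⟩
  · rw [← h1, ← h1', heq neg_one_mem_closedBall]
  · rw [← h2, ← h2', heq one_mem_closedBall]

theorem IsFace.root_unique {c c' : C.Cell 2} {ρ : P} {v : C.Cell 0}
    (h : L.IsFace f c ρ v) (h' : L.IsFace f c' ρ v) : c = c' := by
  obtain ⟨G, hG, h1⟩ := h
  obtain ⟨G', hG', h1'⟩ := h'
  exact hG.cell_eq hf hG' (L.circle_mem_closedBall _ ⟨le_rfl, zero_le_one⟩) (h1.trans h1'.symm)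

theorem IsFace.eq_of_cell {c : C.Cell 2} {ρ ρ' : P} {v v' : C.Cell 0}
    (h : L.IsFace f c ρ v) (h' : L.IsFace f c ρ' v') : ρ = ρ' ∧ v = v' := by
  obtain ⟨G, hG, h1⟩ := h
  obtain ⟨G', hG', h1'⟩ := h'
  obtain ⟨hx, heq⟩ := hG.unique hf hG'
  obtain rfl := L.face.injective hx
  refine ⟨rfl, point_injective ?_⟩
  rw [← h1, ← h1', heq (L.circle_mem_closedBall _ ⟨le_rfl, zero_le_one⟩)]

omit hf in
theorem continuousOn_circle_div (ρ : P) {i : ℕ} (hi : i < (L.bl ρ).length) :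
    ContinuousOn (fun t : ℝ => L.circle ρ ((i + t) / (L.bl ρ).length)) (Icc 0 1) :=
  (L.circle_continuousOn ρ).comp (by fun_prop) fun _ ht => div_mem_Icc hi ht

/-- The characteristic map of a face runs along its boundary walk through characteristic maps of
edges. -/
theorem exists_edge_of_boundary {c : C.Cell 2} {ρ : P} {G : (Fin 2 → ℝ) → C}
    (hG : IsLiftedCharMap f c (L.face ρ) G) (i : Fin (L.bl ρ).length) :
    ∃ e G', IsLiftedCharMap f e (L.edge ((L.bl ρ).get i).1) G' ∧ ∀ t ∈ Icc (0 : ℝ) 1,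
      G (L.circle ρ ((i + t) / (L.bl ρ).length)) = G' (segment ((L.bl ρ).get i).2 t) := by
  have hmem : ∀ t ∈ Icc (0 : ℝ) 1, L.circle ρ ((i + t) / (L.bl ρ).length) ∈
      closedBall (0 : Fin 2 → ℝ) 1 := fun t ht => L.circle_mem_closedBall ρ (div_mem_Icc i.2 ht)
  have hlift : ∀ t ∈ Icc (0 : ℝ) 1, f (G (L.circle ρ ((i + t) / (L.bl ρ).length))) =
      B.charMap (L.edge ((L.bl ρ).get i).1) (segment ((L.bl ρ).get i).2 t) := fun t ht => by
    rw [hG.lift _ (hmem t ht), L.charMap_circle ρ i ht]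
  -- The midpoint of the segment lies over the center of a `1`-cell of `B`, hence in an open
  -- `1`-cell of `C`. The lift for that cell agrees with `G` at the midpoint, and so along the whole
  -- segment.
  have hh : (1 / 2 : ℝ) ∈ Icc (0 : ℝ) 1 := by constructor <;> norm_num
  have hhalf := hlift (1 / 2) hh
  rw [segment_half] at hhalf
  obtain ⟨e, he, hbe⟩ := hf.mem_of_map_mem (b := L.edge ((L.bl ρ).get i).1)
    (hhalf ▸ charMap_zero_mem _)
  obtain ⟨G', hG'⟩ := hf.exists_isLiftedCharMap e
  rw [hbe] at hG'
  refine ⟨e, G', hG', ?_⟩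
  have h0 := hG'.eq_of_map hf he (mem_ball_self one_pos) hhalf
  have key := hf.eqOn_of_lift isPreconnected_Icc
    (hG.continuousOn.comp (continuousOn_circle_div ρ i.2) hmem)
    (hG'.continuousOn.comp (continuous_segment ((L.bl ρ).get i).2).continuousOn
      fun t ht => segment_mem ht) (fun t ht => ?_) hh ?_
  · exact key
  · change f (G _) = f (G' _)
    rw [hlift t ht, hG'.lift _ (segment_mem ht)]
  · change G _ = G' _
    rw [segment_half, h0]

/-- A map on a `2`-complex is determined by compatible lifts of the characteristic maps. -/
theorem exists_lift {T : Type*} [TopologicalSpace T] [T2Space T] {q : T → B}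
    (hq : IsLocallyInjective q) (γ : ∀ n, C.Cell n → (Fin n → ℝ) → T)
    (hγc : ∀ n e, ContinuousOn (γ n e) (closedBall 0 1))
    (hγl : ∀ n (e : C.Cell n), ∀ y ∈ closedBall (0 : Fin n → ℝ) 1,
      q (γ n e y) = B.charMap (hf.base e) y)
    (hend : ∀ e x v w, L.IsEdge f e x v w →
      γ 1 e (fun _ => -1) = γ 0 v 0 ∧ γ 1 e (fun _ => 1) = γ 0 w 0)
    (hroot : ∀ c ρ v, L.IsFace f c ρ v → γ 2 c (L.circle ρ 0) = γ 0 v 0) :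
    ∃ φ : C → T, Continuous φ ∧ (∀ x, q (φ x) = f x) ∧
      ∀ n (e : C.Cell n) b G, IsLiftedCharMap f e b G →
        ∀ y ∈ closedBall (0 : Fin n → ℝ) 1, φ (G y) = γ n e y := by
  -- The value at a point is prescribed through the open cell containing it. It does not depend on
  -- the lifted characteristic map, since such lifts are unique on a given cell.
  have hex : ∀ x : C, ∃ t : T, ∀ n (e : C.Cell n) b G, IsLiftedCharMap f e b G →
      ∀ y ∈ ball (0 : Fin n → ℝ) 1, G y = x → γ n e y = t := by
    intro x
    obtain ⟨n, e, he⟩ := C.exists_mem_openCell x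
    obtain ⟨G, hG⟩ := hf.exists_isLiftedCharMap e
    obtain ⟨y, hy, hyx⟩ := (hG.image_ball hf).symm ▸ he
    refine ⟨γ n e y, fun m e' b G' hG' y' hy' hyx' => ?_⟩
    have he' : x ∈ C.openCell e' := hyx' ▸ hG'.mapsTo hy'
    obtain rfl := dim_eq_of_mem he he'
    obtain rfl := eq_of_mem he he'
    obtain ⟨rfl, heq⟩ := hG.unique hf hG'
    have : B.charMap (hf.base e) y = B.charMap (hf.base e) y' := by
      rw [← hG.lift y (ball_subset_closedBall hy), ← hG'.lift y' (ball_subset_closedBall hy'),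
        hyx, hyx']
    rw [charMap_injOn _ hy hy' this]
  choose φ hφ using hex
  have hball : ∀ n (e : C.Cell n) b G, IsLiftedCharMap f e b G →
      ∀ y ∈ ball (0 : Fin n → ℝ) 1, φ (G y) = γ n e y := fun n e b G hG y hy =>
    (hφ _ n e b G hG y hy rfl).symm
  have hpoint : ∀ v : C.Cell 0, φ (C.point v) = γ 0 v 0 := by
    intro v
    obtain ⟨G, hG⟩ := hf.exists_isLiftedCharMap v
    rw [← hball 0 v _ G hG 0 (mem_ball_self one_pos), eq_point_of_mem hG.zero_mem]
  have hone : ∀ (e : C.Cell 1) b G, IsLiftedCharMap f e b G →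
      ∀ y ∈ closedBall (0 : Fin 1 → ℝ) 1, φ (G y) = γ 1 e y := by
    intro e b G hG y hy
    rw [← ball_union_sphere] at hy
    rcases hy with hy | hy
    · exact hball 1 e b G hG y hy
    · obtain ⟨x, rfl⟩ := L.edge.surjective b
      obtain ⟨v, w, h1, h2, h⟩ := exists_isEdge_of_lift hf hG
      obtain ⟨h3, h4⟩ := hend e x v w h
      rcases mem_sphere_fin_one.1 hy with rfl | rfl
      · rw [h1, hpoint, h3]
      · rw [h2, hpoint, h4]
  have htwo : ∀ (c : C.Cell 2) b G, IsLiftedCharMap f c b G →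
      ∀ y ∈ closedBall (0 : Fin 2 → ℝ) 1, φ (G y) = γ 2 c y := by
    intro c b G hG y hy
    rw [← ball_union_sphere] at hy
    rcases hy with hy | hy
    · exact hball 2 c b G hG y hy
    obtain ⟨ρ, rfl⟩ := L.face.surjective b
    -- On the boundary circle `φ ∘ G` and `γ 2 c` are lifts under `q` of the same loop. They agree
    -- at the root, and agreement is carried around the circle.
    have hz : (0 : ℝ) ∈ Icc (0 : ℝ) 1 := ⟨le_rfl, zero_le_one⟩
    have hbase : φ (G (L.circle ρ 0)) = γ 2 c (L.circle ρ 0) := by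
      obtain ⟨v, hv⟩ := exists_point_eq (L := L) hf (x := G (L.circle ρ 0)) (by
        rw [hG.lift _ (L.circle_mem_closedBall ρ hz), L.charMap_root])
      rw [hv, hpoint, hroot c ρ v ⟨G, hG, hv⟩]
    have hcircle : ContinuousOn (fun s => G (L.circle ρ s)) (Icc 0 1) :=
      hG.continuousOn.comp (L.circle_continuousOn ρ) fun s hs => L.circle_mem_closedBall ρ hs
    have hbc : hf.base c = L.face ρ := hG.base_eq hf
    obtain ⟨s, hs, rfl⟩ := L.exists_circle_eq ρ hy
    rcases Nat.eq_zero_or_pos (L.bl ρ).length with hk | hk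
    -- For the empty word the loop below is constant, so both lifts are constant by local
    -- injectivity.
    · have hnil := L.boundary_nil ρ (List.length_eq_zero_iff.1 hk)
      have h1 : G (L.circle ρ s) = G (L.circle ρ 0) :=
        (T2Space.isSeparatedMap f).constOn_of_comp hf.isLocallyInjective isPreconnected_Icc
          hcircle (fun a ha a' ha' => by
            rw [hG.lift _ (L.circle_mem_closedBall ρ ha), hG.lift _ (L.circle_mem_closedBall ρ ha'),
              hnil _ (L.circle_mem ρ ha), hnil _ (L.circle_mem ρ ha')]) hs hz
      have h2 : γ 2 c (L.circle ρ s) = γ 2 c (L.circle ρ 0) :=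
        (T2Space.isSeparatedMap q).constOn_of_comp hq isPreconnected_Icc
          ((hγc 2 c).comp (L.circle_continuousOn ρ) fun s hs => L.circle_mem_closedBall ρ hs)
          (fun a ha a' ha' => by
            simp only [Function.comp]
            rw [hγl _ _ _ (L.circle_mem_closedBall ρ ha),
              hγl _ _ _ (L.circle_mem_closedBall ρ ha'), hbc,
              hnil _ (L.circle_mem ρ ha), hnil _ (L.circle_mem ρ ha')]) hs hz
      rw [h1, h2, hbase]
    · have hseg : ∀ i, ∀ hi : i < (L.bl ρ).length, ∀ t ∈ Icc (0 : ℝ) 1,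
          φ (G (L.circle ρ ((i + t) / (L.bl ρ).length))) =
            γ 2 c (L.circle ρ ((i + t) / (L.bl ρ).length)) := by
        -- Continuity of `φ` is not yet available. Along a segment `G` runs through the lift of an
        -- edge, where `φ` is already known to be `γ 1 e`, and this gives the continuity that unique
        -- lifting needs.
        have hstep : ∀ i, ∀ hi : i < (L.bl ρ).length,
            φ (G (L.circle ρ ((i + 0) / (L.bl ρ).length))) =
              γ 2 c (L.circle ρ ((i + 0) / (L.bl ρ).length)) →
            ∀ t ∈ Icc (0 : ℝ) 1, φ (G (L.circle ρ ((i + t) / (L.bl ρ).length))) =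
              γ 2 c (L.circle ρ ((i + t) / (L.bl ρ).length)) := by
          intro i hi h0
          obtain ⟨e, G', hG', hGG'⟩ := exists_edge_of_boundary hf hG ⟨i, hi⟩
          have hmaps : MapsTo (fun t : ℝ => L.circle ρ ((i + t) / (L.bl ρ).length)) (Icc 0 1)
              (closedBall 0 1) := fun t ht => L.circle_mem_closedBall ρ (div_mem_Icc hi ht)
          have hL : ∀ t ∈ Icc (0 : ℝ) 1, φ (G (L.circle ρ ((i + t) / (L.bl ρ).length))) =
              γ 1 e (segment ((L.bl ρ).get ⟨i, hi⟩).2 t) := by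
            intro t ht
            rw [hGG' t ht, hone e _ G' hG' _ (segment_mem ht)]
          refine (T2Space.isSeparatedMap q).eqOn_of_comp_eqOn hq isPreconnected_Icc ?_
            ((hγc 2 c).comp (continuousOn_circle_div ρ hi) hmaps) ?_ hz h0
          · refine ContinuousOn.congr ?_ hL
            exact (hγc 1 e).comp (continuous_segment _).continuousOn fun t ht => segment_mem ht
          · intro t ht
            simp only [Function.comp]
            rw [hL t ht, hγl _ _ _ (segment_mem ht), hγl _ _ _ (hmaps ht), hbc, hG'.base_eq hf,
              L.charMap_circle ρ ⟨i, hi⟩ ht]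
        intro i
        induction i with
        | zero =>
          intro hi
          refine hstep _ hi ?_
          simpa using hbase
        | succ i ih =>
          intro hi
          refine hstep _ hi ?_
          have := ih (by omega) 1 ⟨zero_le_one, le_rfl⟩
          simpa using this
      obtain ⟨i, hi, t, ht, rfl⟩ := exists_div_eq hk hs
      exact hseg i hi t ht
  have hall : ∀ n (e : C.Cell n) b G, IsLiftedCharMap f e b G →
      ∀ y ∈ closedBall (0 : Fin n → ℝ) 1, φ (G y) = γ n e y := by
    intro n e b G hG y hy
    have := dim_le_two e
    interval_cases n
    · refine hball 0 e b G hG y ?_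
      rw [Subsingleton.elim y 0]
      exact mem_ball_self one_pos
    · exact hone e b G hG y hy
    · exact htwo e b G hG y hy
  refine ⟨φ, ?_, ?_, hall⟩
  -- In the weak topology it suffices to look at each closed cell, where the preimage of `A` is the
  -- image of a compact subset of the ball.
  · rw [continuous_iff_isClosed]
    intro A hA
    rw [CWComplex.closed univ _ (subset_univ _)]
    intro n e
    obtain ⟨G, hG⟩ := hf.exists_isLiftedCharMap e
    have h1 : φ ⁻¹' A ∩ C.closedCell e = G '' (closedBall 0 1 ∩ γ n e ⁻¹' A) := by
      rw [← hG.image_closedBall hf]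
      ext x
      constructor
      · rintro ⟨hx, y, hy, rfl⟩
        exact ⟨y, ⟨hy, by rw [mem_preimage, ← hall n e _ G hG y hy]; exact hx⟩, rfl⟩
      · rintro ⟨y, ⟨hy, hy'⟩, rfl⟩
        exact ⟨by rw [mem_preimage, hall n e _ G hG y hy]; exact hy', y, hy, rfl⟩
    change IsClosed (φ ⁻¹' A ∩ C.closedCell e)
    rw [h1]
    have h2 : IsClosed (closedBall 0 1 ∩ γ n e ⁻¹' A) :=
      (hγc n e).preimage_isClosed_of_isClosed isClosed_closedBall hA
    have h3 : IsCompact (closedBall 0 1 ∩ γ n e ⁻¹' A) :=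
      (isCompact_closedBall _ _).of_isClosed_subset h2 inter_subset_left
    exact (h3.image_of_continuousOn (hG.continuousOn.mono inter_subset_left)).isClosed
  · intro x
    obtain ⟨n, e, he⟩ := C.exists_mem_openCell x
    obtain ⟨G, hG⟩ := hf.exists_isLiftedCharMap e
    obtain ⟨y, hy, rfl⟩ := (hG.image_ball hf).symm ▸ he
    have hy' := ball_subset_closedBall hy
    rw [hball n e _ G hG y hy, hγl n e y hy', hG.lift y hy']

end BouquetLabeling

/-! ### Paths, labels and the congruence `∼` -/

theorem FreeMonoid.mul_of_inj {α : Type*} {u v : FreeMonoid α} {a b : α} :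
    u * FreeMonoid.of a = v * FreeMonoid.of b ↔ u = v ∧ a = b := by
  constructor
  · intro h
    have h' : FreeMonoid.toList u ++ [a] = FreeMonoid.toList v ++ [b] :=
      congrArg FreeMonoid.toList h
    obtain ⟨h1, h2⟩ := List.append_inj' h' rfl
    exact ⟨h1, by simpa using h2⟩
  · rintro ⟨rfl, rfl⟩
    rfl

theorem FreeMonoid.mul_of_ne_one {α : Type*} {u : FreeMonoid α} {a : α} :
    u * FreeMonoid.of a ≠ 1 := by
  intro h
  have h' : FreeMonoid.toList u ++ [a] = [] := congrArg FreeMonoid.toList h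
  simp at h'

namespace BouquetLabeling

open MXP InverseMonoid

variable {X P : Type u} {B : TwoComplex.{u}} {L : BouquetLabeling X P B}
variable {C : TwoComplex.{u}} {f : C → B}

/-- The label of an arrow of `Γ_C`. -/
def arrowLabel {v w : L.Gamma f} : (v ⟶ w) → (X ⊕ P) × Bool
  | Sum.inl e => (e.label, true)
  | Sum.inr e => (e.label, false)

theorem pathWord_nil (v : L.Gamma f) : L.pathWord f (Quiver.Path.nil : L.GPath f v v) = 1 := rfl

theorem pathWord_cons {u v w : L.Gamma f} (p : L.GPath f u v) (e : v ⟶ w) :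
    L.pathWord f (p.cons e) = L.pathWord f p * FreeMonoid.of (arrowLabel e) := by
  rcases e with e | e <;> rfl

theorem IsEdge.exists_snoc_forward {a v w : L.Gamma f} {e : C.Cell 1} {x : X}
    (h : L.IsEdge f e x v w) (p : L.GPath f a v) : ∃ q : L.GPath f a w,
      L.pathWord f q = L.pathWord f p * FreeMonoid.of (Sum.inl x, true) :=
  ⟨p.cons (Sum.inl (.ofEdge e x h)), rfl⟩

theorem IsEdge.exists_snoc_backward {a v w : L.Gamma f} {e : C.Cell 1} {x : X}
    (h : L.IsEdge f e x v w) (p : L.GPath f a w) : ∃ q : L.GPath f a v,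
      L.pathWord f q = L.pathWord f p * FreeMonoid.of (Sum.inl x, false) :=
  ⟨p.cons (Sum.inr (.ofEdge e x h)), rfl⟩

theorem exists_comp_of_pathWord_eq_mul {a b : L.Gamma f} (p : L.GPath f a b) {u v : Word X P}
    (h : L.pathWord f p = u * v) : ∃ (m : L.Gamma f) (p₁ : L.GPath f a m) (p₂ : L.GPath f m b),
      p = p₁.comp p₂ ∧ L.pathWord f p₁ = u ∧ L.pathWord f p₂ = v := by
  induction p generalizing v with
  | nil =>
    have h' : FreeMonoid.toList u ++ FreeMonoid.toList v = [] := congrArg FreeMonoid.toList h.symm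
    obtain ⟨h1, h2⟩ := List.append_eq_nil_iff.1 h'
    exact ⟨a, .nil, .nil, rfl, h1.symm, h2.symm⟩
  | @cons m b p e ih =>
    rcases List.eq_nil_or_concat (FreeMonoid.toList v) with hv | ⟨v', l, hv⟩
    · obtain rfl : v = 1 := hv
      exact ⟨b, p.cons e, .nil, rfl, by rw [h, mul_one], rfl⟩
    · obtain rfl : v = FreeMonoid.ofList v' * FreeMonoid.of l := by
        rw [List.concat_eq_append] at hv
        exact hv
      rw [pathWord_cons, ← mul_assoc, FreeMonoid.mul_of_inj] at h
      obtain ⟨m, p₁, p₂, rfl, h1, h2⟩ := ih h.1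
      exact ⟨m, p₁, p₂.cons e, rfl, h1, by rw [pathWord_cons, h2, h.2]⟩

variable (hf : IsImmersion C B f)
include hf

theorem GammaEdge.source_unique {v w w' : L.Gamma f} (e : L.GammaEdge f v w)
    (e' : L.GammaEdge f v w') (h : e.label = e'.label) : w = w' ∧ HEq e e' := by
  cases e with
  | ofEdge e x he =>
    cases e' with
    | ofEdge e' x' he' =>
      obtain rfl : x = x' := Sum.inl_injective h
      obtain ⟨rfl, rfl⟩ := he.source_unique hf he'
      exact ⟨rfl, HEq.rfl⟩
    | ofFace c ρ hc => cases h
  | ofFace c ρ hc =>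
    cases e' with
    | ofEdge e' x' he' => cases h
    | ofFace c' ρ' hc' =>
      obtain rfl : ρ = ρ' := Sum.inr_injective h
      obtain rfl := hc.root_unique hf hc'
      exact ⟨rfl, HEq.rfl⟩

theorem GammaEdge.target_unique {v v' w : L.Gamma f} (e : L.GammaEdge f v w)
    (e' : L.GammaEdge f v' w) (h : e.label = e'.label) : v = v' ∧ HEq e e' := by
  cases e with
  | ofEdge e x he =>
    cases e' with
    | ofEdge e' x' he' =>
      obtain rfl : x = x' := Sum.inl_injective h
      obtain ⟨rfl, rfl⟩ := he.target_unique hf he'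
      exact ⟨rfl, HEq.rfl⟩
    | ofFace c ρ hc => cases h
  | ofFace c ρ hc =>
    cases e' with
    | ofEdge e' x' he' => cases h
    | ofFace c' ρ' hc' =>
      obtain rfl : ρ = ρ' := Sum.inr_injective h
      obtain rfl := hc.root_unique hf hc'
      exact ⟨rfl, HEq.rfl⟩

theorem arrow_unique {v w w' : L.Gamma f} (e : v ⟶ w) (e' : v ⟶ w')
    (h : arrowLabel e = arrowLabel e') : w = w' ∧ HEq e e' := by
  rcases e with e | e <;> rcases e' with e' | e'
  · obtain ⟨rfl, h2⟩ := e.source_unique hf e' (Prod.ext_iff.1 h).1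
    obtain rfl := eq_of_heq h2
    exact ⟨rfl, HEq.rfl⟩
  · cases (Prod.ext_iff.1 h).2
  · cases (Prod.ext_iff.1 h).2
  · obtain ⟨rfl, h2⟩ := e.target_unique hf e' (Prod.ext_iff.1 h).1
    obtain rfl := eq_of_heq h2
    exact ⟨rfl, HEq.rfl⟩

/-- A path in `Γ_C` is determined by its initial vertex and its label. -/
theorem path_unique {a b c : L.Gamma f} (p : L.GPath f a b) (q : L.GPath f a c)
    (h : L.pathWord f p = L.pathWord f q) : b = c ∧ HEq p q := by
  induction p generalizing c with
  | nil =>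
    cases q with
    | nil => exact ⟨rfl, HEq.rfl⟩
    | cons q e =>
      rw [pathWord_cons] at h
      exact absurd h.symm FreeMonoid.mul_of_ne_one
  | cons p e ih =>
    cases q with
    | nil =>
      rw [pathWord_cons] at h
      exact absurd h FreeMonoid.mul_of_ne_one
    | cons q e' =>
      rw [pathWord_cons, pathWord_cons, FreeMonoid.mul_of_inj] at h
      obtain ⟨rfl, h2⟩ := ih q h.1
      obtain rfl := eq_of_heq h2
      obtain ⟨rfl, h3⟩ := arrow_unique hf e e' h.2
      obtain rfl := eq_of_heq h3
      exact ⟨rfl, HEq.rfl⟩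

omit hf in
theorem eq_of_pathWord_eq_letter {a b : L.Gamma f} (p : L.GPath f a b) {ρ : P}
    (h : L.pathWord f p = letter (Sum.inr ρ)) : a = b ∧ ∃ c : C.Cell 2, L.IsFace f c ρ a := by
  cases p with
  | nil =>
    rw [pathWord_nil] at h
    exact absurd h.symm (FreeMonoid.of_ne_one _)
  | cons p e =>
    rw [pathWord_cons, letter, ← one_mul (FreeMonoid.of (Sum.inr ρ, true)),
      FreeMonoid.mul_of_inj] at h
    cases p with
    | cons p e' =>
      rw [pathWord_cons] at h
      exact absurd h.1 FreeMonoid.mul_of_ne_one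
    | nil =>
      rcases e with e | e
      · cases e with
        | ofEdge e x he => cases (Prod.ext_iff.1 h.2).1
        | ofFace c ρ' hc =>
          obtain rfl : ρ' = ρ := Sum.inr_injective (Prod.ext_iff.1 h.2).1
          exact ⟨rfl, c, hc⟩
      · cases (Prod.ext_iff.1 h.2).2

/-- The boundary of a face is a closed path at its root. -/
theorem IsFace.exists_path {c : C.Cell 2} {ρ : P} {v : L.Gamma f} (h : L.IsFace f c ρ v) :
    ∃ p : L.GPath f v v, L.pathWord f p = wordOfX (L.bl ρ) := by
  obtain ⟨G, hG, hv⟩ := h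
  rcases Nat.eq_zero_or_pos (L.bl ρ).length with hk | hk
  · refine ⟨.nil, ?_⟩
    rw [List.length_eq_zero_iff.1 hk]
    rfl
  -- The prefix of length `j` is lifted together with the position on the circle at which it ends.
  -- At the full length the circle closes up, and the end vertex is the root.
  have key : ∀ j ≤ (L.bl ρ).length, ∃ (w : L.Gamma f) (p : L.GPath f v w),
      G (L.circle ρ (j / (L.bl ρ).length)) = C.point w ∧
        L.pathWord f p = wordOfX ((L.bl ρ).take j) := by
    intro j
    induction j with
    | zero =>
      intro _
      exact ⟨v, .nil, by simpa using hv, rfl⟩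
    | succ j ih =>
      intro hj
      obtain ⟨w, p, hw, hp⟩ := ih (by omega)
      obtain ⟨e, G', hG', hGG'⟩ := exists_edge_of_boundary hf hG ⟨j, hj⟩
      obtain ⟨a, b, ha, hb, hab⟩ := exists_isEdge_of_lift hf hG'
      have h0 := hGG' 0 ⟨le_rfl, zero_le_one⟩
      have h1 := hGG' 1 ⟨zero_le_one, le_rfl⟩
      rw [List.take_succ_eq_append_getElem hj]
      simp only [add_zero, hw] at h0
      have hword : ∀ l : List (X × Bool), wordOfX (X := X) (P := P) (l ++ [(L.bl ρ)[j]]) =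
          wordOfX l * FreeMonoid.of (Sum.inl ((L.bl ρ)[j]).1, ((L.bl ρ)[j]).2) := by
        intro l
        simp [wordOfX]
      rw [hword, Nat.cast_succ]
      simp only [List.get_eq_getElem] at h0 h1 hab
      generalize (L.bl ρ)[j] = xs at *
      obtain ⟨x, s⟩ := xs
      cases s
      · simp only [segment_false_zero, segment_false_one, hb, ha] at h0 h1
        obtain rfl := point_injective h0
        obtain ⟨q, hq⟩ := hab.exists_snoc_backward p
        exact ⟨a, q, h1, by rw [hq, hp]⟩
      · simp only [segment_true_zero, segment_true_one, hb, ha] at h0 h1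
        obtain rfl := point_injective h0
        obtain ⟨q, hq⟩ := hab.exists_snoc_forward p
        exact ⟨b, q, h1, by rw [hq, hp]⟩
  obtain ⟨w, p, hw, hp⟩ := key _ le_rfl
  have hk' : ((L.bl ρ).length : ℝ) ≠ 0 := by exact_mod_cast hk.ne'
  rw [div_self hk', L.circle_closed, hv] at hw
  obtain rfl := point_injective hw
  exact ⟨p, by rw [hp, List.take_length]⟩

omit hf in
variable (L f) in
/-- Paths labeled `u` are equivalent to coterminal paths labeled `u'`. -/
def Transfers (u u' : Word X P) : Prop :=
  ∀ (a b : L.Gamma f) (p : L.GPath f a b), L.pathWord f p = u →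
    ∃ q : L.GPath f a b, L.pathWord f q = u' ∧ L.PathEquiv f p q

/-- By determinism a factor labeled `w.inv` that follows a path labeled `w` is the reverse of that
path, so the whole path has the shape required by the generator `comm` of `∼`. -/
theorem transfers_comm (w u : Word X P) :
    Transfers L f (w * w.inv * (u * u.inv)) (u * u.inv * (w * w.inv)) := by
  intro a b p hp
  obtain ⟨m, p₁, p₂, rfl, h1, h2⟩ := exists_comp_of_pathWord_eq_mul p hp
  obtain ⟨m₁, p₃, p₄, rfl, h3, h4⟩ := exists_comp_of_pathWord_eq_mul p₁ h1
  obtain ⟨m₂, p₅, p₆, rfl, h5, h6⟩ := exists_comp_of_pathWord_eq_mul p₂ h2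
  obtain ⟨rfl, h7⟩ := path_unique hf p₄ p₃.reverse (by rw [h4, pathWord_reverse, h3])
  obtain rfl := eq_of_heq h7
  obtain ⟨rfl, h7⟩ := path_unique hf p₆ p₅.reverse (by rw [h6, pathWord_reverse, h5])
  obtain rfl := eq_of_heq h7
  exact ⟨_, by simp only [pathWord_comp, pathWord_reverse, h3, h5], .comm p₃ p₅⟩

/-- Determinism forces a path labeled by one side of a relation to have the form in which the
matching generator of `∼` applies. To replace `ρ` by `ρ bl(ρ)` a new path is needed; the boundary of
the face with label `ρ` provides it. -/
theorem transfers_of_rel {u u' : Word X P} (h : Rel L.bl u u') :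
    Transfers L f u u' ∧ Transfers L f u' u := by
  cases h with
  | inv w =>
    constructor
    · intro a b p hp
      obtain ⟨m, p₁, p₂, rfl, h1, h2⟩ := exists_comp_of_pathWord_eq_mul p hp
      obtain ⟨m₁, p₃, p₄, rfl, h3, h4⟩ := exists_comp_of_pathWord_eq_mul p₁ h1
      obtain ⟨rfl, h7⟩ := path_unique hf p₄ p₃.reverse (by rw [h4, pathWord_reverse, h3])
      obtain rfl := eq_of_heq h7
      obtain ⟨rfl, h7⟩ := path_unique hf p₂ p₃ (by rw [h2, h3])
      obtain rfl := eq_of_heq h7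
      exact ⟨_, h3, .inv _⟩
    · intro a b p hp
      exact ⟨_, by simp only [pathWord_comp, pathWord_reverse, hp], .symm (.inv p)⟩
  | comm w u => exact ⟨transfers_comm hf w u, transfers_comm hf u w⟩
  | idem ρ =>
    constructor
    · intro a b p hp
      obtain ⟨m, p₁, p₂, rfl, h1, h2⟩ := exists_comp_of_pathWord_eq_mul p hp
      obtain ⟨rfl, -⟩ := eq_of_pathWord_eq_letter p₁ h1
      obtain ⟨rfl, h7⟩ := path_unique hf p₂ p₁ (by rw [h1, h2])
      obtain rfl := eq_of_heq h7
      exact ⟨_, h1, .idem _ ρ h1⟩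
    · intro a b p hp
      obtain ⟨rfl, -⟩ := eq_of_pathWord_eq_letter p hp
      exact ⟨_, by simp only [pathWord_comp, hp], .symm (.idem p ρ hp)⟩
  | bound ρ =>
    constructor
    · intro a b p hp
      obtain ⟨rfl, c, hc⟩ := eq_of_pathWord_eq_letter p hp
      obtain ⟨r, hr⟩ := IsFace.exists_path hf hc
      exact ⟨_, by simp only [pathWord_comp, hp, hr], .bound p r ρ hp hr⟩
    · intro a b p hp
      obtain ⟨m, p₁, p₂, rfl, h1, h2⟩ := exists_comp_of_pathWord_eq_mul p hp
      obtain ⟨rfl, c, hc⟩ := eq_of_pathWord_eq_letter p₁ h1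
      obtain ⟨r, hr⟩ := IsFace.exists_path hf hc
      obtain ⟨rfl, -⟩ := path_unique hf p₂ r (by rw [h2, hr])
      exact ⟨_, h1, .symm (.bound p₁ p₂ ρ h1 h2)⟩

/-- Rewriting inside a product is followed by cutting the path at the corresponding factorization of
its label. Symmetry of the congruence is the reason for carrying both directions. -/
theorem transfers_of_conGen {u u' : Word X P} (h : conGen (Rel L.bl) u u') :
    Transfers L f u u' ∧ Transfers L f u' u := by
  induction h with
  | of _ _ h => exact transfers_of_rel hf h
  | refl _ => exact ⟨fun a b p hp => ⟨p, hp, .refl p⟩, fun a b p hp => ⟨p, hp, .refl p⟩⟩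
  | symm _ ih => exact ih.symm
  | trans _ _ ih1 ih2 =>
    constructor
    · intro a b p hp
      obtain ⟨q, hq, hpq⟩ := ih1.1 a b p hp
      obtain ⟨r, hr, hqr⟩ := ih2.1 a b q hq
      exact ⟨r, hr, hpq.trans hqr⟩
    · intro a b p hp
      obtain ⟨q, hq, hpq⟩ := ih2.2 a b p hp
      obtain ⟨r, hr, hqr⟩ := ih1.2 a b q hq
      exact ⟨r, hr, hpq.trans hqr⟩
  | mul _ _ ih1 ih2 =>
    have key : ∀ {u u' v v' : Word X P}, Transfers L f u u' → Transfers L f v v' →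
        Transfers L f (u * v) (u' * v') := by
      intro u u' v v' h h' a b p hp
      obtain ⟨m, p₁, p₂, rfl, h1, h2⟩ := exists_comp_of_pathWord_eq_mul p hp
      obtain ⟨q₁, h3, h4⟩ := h a m p₁ h1
      obtain ⟨q₂, h5, h6⟩ := h' m b p₂ h2
      exact ⟨q₁.comp q₂, by rw [pathWord_comp, h3, h5], h4.comp h6⟩
    exact ⟨key ih1.1 ih2.1, key ih1.2 ih2.2⟩

/-- Transfer turns `p` into an equivalent path with the label of `q`, and that path is `q` by
`path_unique`. -/
theorem pathEquiv_of_ofWord_eq {a b : L.Gamma f} {p q : L.GPath f a b}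
    (h : ofWord L.bl (L.pathWord f p) = ofWord L.bl (L.pathWord f q)) : L.PathEquiv f p q := by
  obtain ⟨r, hr, hpr⟩ := (transfers_of_conGen hf ((ofWord_eq_iff L.bl).1 h)).1 a b p rfl
  obtain ⟨-, h7⟩ := path_unique hf r q hr
  obtain rfl := eq_of_heq h7
  exact hpr

theorem loopLabel_injective (v : L.Gamma f) : Function.Injective (L.loopLabel f v) := by
  rintro ⟨p⟩ ⟨q⟩ h
  exact Quotient.sound (pathEquiv_of_ofWord_eq hf h)

omit hf in
variable (L f) in
/-- There is a path from `v` to `w` whose label represents `m`. -/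
def Reach (v : L.Gamma f) (m : MXP L.bl) (w : L.Gamma f) : Prop :=
  ∃ p : L.GPath f v w, ofWord L.bl (L.pathWord f p) = m

omit hf in
theorem mem_loopSet {v : L.Gamma f} {m : MXP L.bl} : m ∈ L.loopSet f v ↔ Reach L f v m v := by
  constructor
  · rintro ⟨⟨p⟩, rfl⟩
    exact ⟨p, rfl⟩
  · rintro ⟨p, rfl⟩
    exact ⟨Quotient.mk _ p, rfl⟩

namespace Reach

omit hf in
theorem one (v : L.Gamma f) : Reach L f v 1 v := ⟨.nil, rfl⟩

omit hf in
theorem inv {v w : L.Gamma f} {m : MXP L.bl} (h : Reach L f v m w) : Reach L f w m⁻¹ v := by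
  obtain ⟨p, rfl⟩ := h
  exact ⟨p.reverse, by rw [pathWord_reverse]; rfl⟩

omit hf in
theorem mul {u v w : L.Gamma f} {m n : MXP L.bl} (h : Reach L f u m v) (h' : Reach L f v n w) :
    Reach L f u (m * n) w := by
  obtain ⟨p, rfl⟩ := h
  obtain ⟨q, rfl⟩ := h'
  exact ⟨p.comp q, by rw [pathWord_comp, map_mul]⟩

/-- Reachability under `m` is independent of the word chosen for `m`, so words may be cut wherever a
product of elements is given. -/
theorem exists_path {v w : L.Gamma f} {u : Word X P} (h : Reach L f v (ofWord L.bl u) w) :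
    ∃ p : L.GPath f v w, L.pathWord f p = u := by
  obtain ⟨p, hp⟩ := h
  obtain ⟨q, hq, -⟩ := (transfers_of_conGen hf ((ofWord_eq_iff L.bl).1 hp)).1 v w p rfl
  exact ⟨q, hq⟩

theorem unique {v w w' : L.Gamma f} {m : MXP L.bl} (h : Reach L f v m w)
    (h' : Reach L f v m w') : w = w' := by
  obtain ⟨p, rfl⟩ := h
  obtain ⟨q, hq⟩ := exists_path hf h'
  exact (path_unique hf p q hq.symm).1

theorem injective {v v' w : L.Gamma f} {m : MXP L.bl} (h : Reach L f v m w)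
    (h' : Reach L f v' m w) : v = v' := unique hf h.inv h'.inv

theorem split {v w : L.Gamma f} {m n : MXP L.bl} (h : Reach L f v (m * n) w) :
    ∃ a, Reach L f v m a ∧ Reach L f a n w := by
  obtain ⟨x, rfl⟩ := ofWord_surjective L.bl m
  obtain ⟨y, rfl⟩ := ofWord_surjective L.bl n
  rw [← map_mul] at h
  obtain ⟨p, hp⟩ := exists_path hf h
  obtain ⟨a, p₁, p₂, -, h1, h2⟩ := exists_comp_of_pathWord_eq_mul p hp
  exact ⟨a, ⟨p₁, by rw [h1]⟩, ⟨p₂, by rw [h2]⟩⟩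

/-- Splitting `e = e e` gives a vertex reached from `v` by `e`, which must be `w`; then `e` also
leads from `w` to `w`, and injectivity gives `w = v`. -/
theorem eq_of_idem {v w : L.Gamma f} {e : MXP L.bl} (he : e * e = e) (h : Reach L f v e w) :
    w = v := by
  have h' := h
  rw [← he] at h'
  obtain ⟨a, h1, h2⟩ := h'.split hf
  obtain rfl := h.unique hf h1
  exact h2.injective hf h

/-- In `m = e n` the idempotent `e` labels a closed path, so the part labeled `n` already starts at
`v`. Upward closure of loop monoids follows. -/
theorem mono {v w : L.Gamma f} {m n : MXP L.bl} (hle : NatLE m n) (h : Reach L f v m w) :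
    Reach L f v n w := by
  obtain ⟨e, he, rfl⟩ := hle
  obtain ⟨a, h1, h2⟩ := h.split hf
  rwa [h1.eq_of_idem hf he] at h2

end Reach

theorem isClosedInverseSubmonoid_loopSet (v : L.Gamma f) :
    IsClosedInverseSubmonoid (L.loopSet f v) where
  one_mem := mem_loopSet.2 (.one v)
  mul_mem a ha b hb := mem_loopSet.2 ((mem_loopSet.1 ha).mul (mem_loopSet.1 hb))
  inv_mem a ha := mem_loopSet.2 (mem_loopSet.1 ha).inv
  closed := by
    refine Subset.antisymm ?_ (subset_upClosure _)
    rintro m ⟨n, hn, hle⟩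
    exact mem_loopSet.2 ((mem_loopSet.1 hn).mono hf hle)

omit hf in
-- Applied to `B × Bool → B`, which lets `exists_lift` produce continuous two-valued functions on
-- `C`.
theorem isLocallyInjective_fst {Y Z : Type*} [TopologicalSpace Y] [TopologicalSpace Z]
    [DiscreteTopology Z] : IsLocallyInjective (Prod.fst : Y × Z → Y) := by
  intro p
  refine ⟨Prod.snd ⁻¹' {p.2}, (isOpen_discrete _).preimage continuous_snd, rfl, ?_⟩
  intro a ha b hb h
  exact Prod.ext h ((show a.2 = p.2 from ha).trans (show b.2 = p.2 from hb).symm)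

open Classical in
-- Topological connectedness becomes combinatorial: reachability from `v` has the same value at all
-- vertices of a cell, so it extends to a continuous map from `C` to `Bool`, which is constant.
theorem exists_path (v w : L.Gamma f) : Nonempty (L.GPath f v w) := by
  -- An edge takes the value of its source and a face that of its root. Above dimension `2` there
  -- are no cells, and the value is irrelevant.
  let r : ∀ n, C.Cell n → Prop
    | 0 => fun w => Nonempty (L.GPath f v w)
    | 1 => fun e => ∃ x a b, L.IsEdge f e x a b ∧ Nonempty (L.GPath f v a)
    | 2 => fun c => ∃ ρ a, L.IsFace f c ρ a ∧ Nonempty (L.GPath f v a)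
    | _ + 3 => fun _ => True
  let γ : ∀ n, C.Cell n → (Fin n → ℝ) → B × Bool :=
    fun n e y => (B.charMap (hf.base e) y, decide (r n e))
  have hbase : ∀ a : C.Cell 0, B.charMap (hf.base a) 0 = L.basePoint := fun a =>
    L.eq_basePoint_of_mem (charMap_zero_mem (hf.base a))
  obtain ⟨φ, hφc, -, hφ⟩ := exists_lift (L := L) hf
    (isLocallyInjective_fst (Y := B) (Z := Bool)) γ
    (fun n e => (charMap_continuousOn _).prodMk continuousOn_const) (fun _ _ _ _ => rfl)
    (by
      intro e x a b h
      obtain ⟨G, hG, -⟩ := id h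
      have hb := hG.base_eq hf
      have h1 : r 1 e ↔ r 0 a := by
        constructor
        · rintro ⟨x', a', b', h', hr⟩
          obtain ⟨-, rfl, -⟩ := h.eq_of_cell hf h'
          exact hr
        · exact fun hr => ⟨x, a, b, h, hr⟩
      have h2 : r 0 a ↔ r 0 b := by
        constructor
        · rintro ⟨p⟩
          obtain ⟨q, -⟩ := h.exists_snoc_forward p
          exact ⟨q⟩
        · rintro ⟨p⟩
          obtain ⟨q, -⟩ := h.exists_snoc_backward p
          exact ⟨q⟩
      simp only [γ, Prod.mk.injEq, decide_eq_decide, hb, hbase]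
      refine ⟨⟨L.charMap_edge_of_sphere x (mem_sphere_fin_one.2 (Or.inl rfl)), h1⟩,
        L.charMap_edge_of_sphere x (mem_sphere_fin_one.2 (Or.inr rfl)), h1.trans h2⟩)
    (by
      intro c ρ a h
      obtain ⟨G, hG, -⟩ := id h
      have hb := hG.base_eq hf
      have h1 : r 2 c ↔ r 0 a := by
        constructor
        · rintro ⟨ρ', a', h', hr⟩
          obtain ⟨-, rfl⟩ := h.eq_of_cell hf h'
          exact hr
        · exact fun hr => ⟨ρ, a, h, hr⟩
      simp only [γ, Prod.mk.injEq, decide_eq_decide, hb, hbase]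
      exact ⟨L.charMap_root ρ, h1⟩)
  have hval : ∀ a : C.Cell 0, φ (C.point a) = γ 0 a 0 := by
    intro a
    obtain ⟨G, hG⟩ := hf.exists_isLiftedCharMap a
    rw [← hφ 0 a _ G hG 0 (mem_closedBall_self zero_le_one), eq_point_of_mem hG.zero_mem]
  have hconst : (φ (C.point v)).2 = (φ (C.point w)).2 :=
    PreconnectedSpace.constant inferInstance (continuous_snd.comp hφc)
  have hconst' : (γ 0 v 0).2 = (γ 0 w 0).2 := by
    rw [← hval v, ← hval w]
    exact hconst
  have : r 0 v ↔ r 0 w := decide_eq_decide.1 hconst'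
  exact this.1 ⟨.nil⟩

variable (L) in
theorem nonempty_gamma : Nonempty (L.Gamma f) := by
  obtain ⟨x⟩ := (inferInstance : Nonempty C)
  obtain ⟨n, e, -⟩ := C.exists_mem_openCell x
  have := dim_le_two e
  interval_cases n
  · exact ⟨e⟩
  · obtain ⟨-, v, -⟩ := exists_isEdge (L := L) hf e
    exact ⟨v⟩
  · obtain ⟨-, v, -⟩ := exists_isFace (L := L) hf e
    exact ⟨v⟩

theorem exists_reach (v w : L.Gamma f) : ∃ m, Reach L f v m w := by
  obtain ⟨p⟩ := exists_path hf v w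
  exact ⟨_, p, rfl⟩

theorem isConjugacyClass_loopSet :
    IsConjugacyClass (Set.range fun v : L.Gamma f => L.loopSet f v) := by
  obtain ⟨v⟩ := nonempty_gamma L hf
  refine ⟨L.loopSet f v, isClosedInverseSubmonoid_loopSet hf v, ?_⟩
  ext K
  constructor
  · rintro ⟨w, rfl⟩
    obtain ⟨m, hm⟩ := exists_reach hf v w
    refine ⟨isClosedInverseSubmonoid_loopSet hf w, m, fun h hh => ?_, fun k hk => ?_⟩
    · exact mem_loopSet.2 ((hm.inv.mul (mem_loopSet.1 hh)).mul hm)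
    · exact mem_loopSet.2 ((hm.mul (mem_loopSet.1 hk)).mul hm.inv)
  · rintro ⟨hK, m, h1, h2⟩
    -- Since `m m⁻¹` is a loop at `v`, a path representing `m` starts there; `K` will be the loop
    -- monoid at its end `w`.
    have h3 := mem_loopSet.1 (h2 1 hK.one_mem)
    rw [mul_one] at h3
    obtain ⟨w, hw, -⟩ := h3.split hf
    refine ⟨w, Subset.antisymm (fun l hl => ?_) fun k hk => ?_⟩
    · have h4 := h1 _ (mem_loopSet.2 ((hw.mul (mem_loopSet.1 hl)).mul hw.inv))
      refine hK.mem_of_le ?_ h4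
      -- The twice conjugated element is `l` multiplied by idempotents on both sides, so it lies
      -- below `l`.
      have h5 : m⁻¹ * (m * l * m⁻¹) * m = m⁻¹ * m * l * (m⁻¹ * m) := by simp only [mul_assoc]
      rw [h5]
      exact (NatLE.of_mul_idem (inv_mul_idem m) _).trans (NatLE.of_idem_mul (inv_mul_idem m) l)
    -- In a loop representing `m k m⁻¹` the first factor ends at `w` and the last one starts at `w`,
    -- so `k` is represented by a loop at `w`.
    · obtain ⟨a, h4, h5⟩ := (mem_loopSet.1 (h2 k hk)).split hf
      obtain ⟨b, h6, h7⟩ := h4.split hf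
      obtain rfl := h6.unique hf hw
      have h8 : a = b := by
        have := h5.inv
        rw [inv_inv'] at this
        exact this.unique hf hw
      rw [h8] at h7
      exact mem_loopSet.2 h7

end BouquetLabeling

/-! ### Uniqueness of the immersion with a given loop monoid -/

namespace BouquetLabeling

open MXP InverseMonoid

variable {X P : Type u} {B : TwoComplex.{u}} {L : BouquetLabeling X P B}
variable {C C' : TwoComplex.{u}} {f : C → B} {f' : C' → B}

theorem exists_isEdge_of_pathWord_eq_letter {a b : L.Gamma f} (p : L.GPath f a b) {x : X}
    (h : L.pathWord f p = letter (Sum.inl x)) : ∃ e : C.Cell 1, L.IsEdge f e x a b := by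
  cases p with
  | nil =>
    rw [pathWord_nil] at h
    exact absurd h.symm (FreeMonoid.of_ne_one _)
  | cons p e =>
    rw [pathWord_cons, letter, ← one_mul (FreeMonoid.of (Sum.inl x, true)),
      FreeMonoid.mul_of_inj] at h
    cases p with
    | cons p e' =>
      rw [pathWord_cons] at h
      exact absurd h.1 FreeMonoid.mul_of_ne_one
    | nil =>
      rcases e with e | e
      · cases e with
        | ofEdge e x' he =>
          obtain rfl : x' = x := Sum.inl_injective (Prod.ext_iff.1 h.2).1
          exact ⟨e, he⟩
        | ofFace c ρ' hc => cases (Prod.ext_iff.1 h.2).1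
      · cases (Prod.ext_iff.1 h.2).2

theorem IsEdge.reach {v w : L.Gamma f} {e : C.Cell 1} {x : X} (h : L.IsEdge f e x v w) :
    Reach L f v (ofWord L.bl (letter (Sum.inl x))) w :=
  ⟨Quiver.Path.nil.cons (Sum.inl (.ofEdge e x h)), rfl⟩

theorem IsFace.reach {v : L.Gamma f} {c : C.Cell 2} {ρ : P} (h : L.IsFace f c ρ v) :
    Reach L f v (ofWord L.bl (letter (Sum.inr ρ))) v :=
  ⟨Quiver.Path.nil.cons (Sum.inl (.ofFace c ρ h)), rfl⟩

variable (hf : IsImmersion C B f) (hf' : IsImmersion C' B f')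
include hf hf'

/-- A morphism of labeled graphs is induced by a morphism of complexes over the bouquet. -/
theorem exists_morphism (β : C.Cell 0 → C'.Cell 0)
    (hE : ∀ e x v w, L.IsEdge f e x v w → ∃ e', L.IsEdge f' e' x (β v) (β w))
    (hF : ∀ c ρ v, L.IsFace f c ρ v → ∃ c', L.IsFace f' c' ρ (β v)) :
    ∃ φ : C → C', Continuous φ ∧ (∀ x, f' (φ x) = f x) ∧
      (∀ v, φ (C.point v) = C'.point (β v)) ∧
      ∀ (n : ℕ) (e : C.Cell n), ∃ e' : C'.Cell n, φ '' C.openCell e = C'.openCell e' := by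
  have h0 : ∀ v : C.Cell 0, ∃ v' G, IsLiftedCharMap f' v' (hf.base v) G ∧
      G 0 = C'.point (β v) := by
    intro v
    obtain ⟨G, hG⟩ := hf'.exists_isLiftedCharMap (β v)
    refine ⟨β v, G, ?_, eq_point_of_mem hG.zero_mem⟩
    have : hf'.base (β v) = hf.base v :=
      (L.vertex.uniq _).trans (L.vertex.uniq _).symm
    rwa [this] at hG
  -- The lift in `C'` is chosen from one description of `e` as a labeled edge; by `eq_of_cell` every
  -- other description is the same.
  have h1 : ∀ e : C.Cell 1, ∃ e' G, IsLiftedCharMap f' e' (hf.base e) G ∧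
      ∀ x v w, L.IsEdge f e x v w → G (fun _ => -1) = C'.point (β v) ∧
        G (fun _ => 1) = C'.point (β w) := by
    intro e
    obtain ⟨x, v, w, h⟩ := exists_isEdge (L := L) hf e
    obtain ⟨e', G, hG, hv, hw⟩ := hE e x v w h
    obtain ⟨G', hG', -⟩ := id h
    refine ⟨e', G, by rwa [hG'.base_eq hf], fun x' v' w' h' => ?_⟩
    obtain ⟨rfl, rfl, rfl⟩ := h.eq_of_cell hf h'
    exact ⟨hv, hw⟩
  have h2 : ∀ c : C.Cell 2, ∃ c' G, IsLiftedCharMap f' c' (hf.base c) G ∧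
      ∀ ρ v, L.IsFace f c ρ v → G (L.circle ρ 0) = C'.point (β v) := by
    intro c
    obtain ⟨ρ, v, h⟩ := exists_isFace (L := L) hf c
    obtain ⟨c', G, hG, hv⟩ := hF c ρ v h
    obtain ⟨G', hG', -⟩ := id h
    refine ⟨c', G, by rwa [hG'.base_eq hf], fun ρ' v' h' => ?_⟩
    obtain ⟨rfl, rfl⟩ := h.eq_of_cell hf h'
    exact hv
  choose σ0 γ0 hγ0 hp0 using h0
  choose σ1 γ1 hγ1 hp1 using h1
  choose σ2 γ2 hγ2 hp2 using h2
  let γ : ∀ n, C.Cell n → (Fin n → ℝ) → C'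
    | 0 => γ0
    | 1 => γ1
    | 2 => γ2
    | n + 3 => fun e => ((C.dim_le (n + 3) (by omega)).false e).elim
  have hγ : ∀ n (e : C.Cell n), ∃ e', IsLiftedCharMap f' e' (hf.base e) (γ n e) := by
    intro n e
    have := dim_le_two e
    interval_cases n
    · exact ⟨_, hγ0 e⟩
    · exact ⟨_, hγ1 e⟩
    · exact ⟨_, hγ2 e⟩
  choose σ hσ using hγ
  obtain ⟨φ, hφc, hφl, hφ⟩ := exists_lift (L := L) hf hf'.isLocallyInjective γ
    (fun n e => (hσ n e).continuousOn) (fun n e => (hσ n e).lift)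
    (fun e x v w h => by
      have := hp1 e x v w h
      exact ⟨this.1.trans (hp0 v).symm, this.2.trans (hp0 w).symm⟩)
    (fun c ρ v h => (hp2 c ρ v h).trans (hp0 v).symm)
  refine ⟨φ, hφc, hφl, fun v => ?_, fun n e => ⟨σ n e, ?_⟩⟩
  · obtain ⟨G, hG⟩ := hf.exists_isLiftedCharMap v
    rw [← eq_point_of_mem hG.zero_mem, hφ 0 v _ G hG 0 (mem_closedBall_self zero_le_one)]
    exact hp0 v
  · obtain ⟨G, hG⟩ := hf.exists_isLiftedCharMap e
    rw [← hG.image_ball hf, ← (hσ n e).image_ball hf', image_image]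
    exact image_congr fun y hy => hφ n e _ G hG y (ball_subset_closedBall hy)

/-- The vertex reached from `p` by `m` is sent to the vertex reached from `p'` by `m`. The latter
exists because `m m⁻¹` is in the common loop monoid. If `n` reaches the same vertex as `m`, then `m
n⁻¹` is in it, so the image does not depend on the choice. -/
theorem exists_morphism_of_loopSet {p : L.Gamma f} {p' : L.Gamma f'}
    (h : L.loopSet f p = L.loopSet f' p') :
    ∃ φ : C → C', Continuous φ ∧ (∀ x, f' (φ x) = f x) ∧ φ (C.point p) = C'.point p' ∧
      ∀ (n : ℕ) (e : C.Cell n), ∃ e' : C'.Cell n, φ '' C.openCell e = C'.openCell e' := by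
  have hex : ∀ v m, Reach L f p m v → ∃ w, Reach L f' p' m w := by
    intro v m hm
    have := mem_loopSet.1 (h ▸ mem_loopSet.2 (hm.mul hm.inv))
    obtain ⟨w, hw, -⟩ := this.split hf'
    exact ⟨w, hw⟩
  have huniq : ∀ v m n w w', Reach L f p m v → Reach L f p n v → Reach L f' p' m w →
      Reach L f' p' n w' → w = w' := by
    intro v m n w w' h1 h2 h3 h4
    have := mem_loopSet.1 (h ▸ mem_loopSet.2 (h1.mul h2.inv))
    obtain ⟨a, h5, h6⟩ := this.split hf'
    obtain rfl := h5.unique hf' h3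
    have h7 := h6.inv
    rw [inv_inv'] at h7
    exact h7.unique hf' h4
  have hβ : ∀ v : L.Gamma f, ∃ w : L.Gamma f', ∃ m, Reach L f p m v ∧ Reach L f' p' m w := by
    intro v
    obtain ⟨m, hm⟩ := exists_reach hf p v
    obtain ⟨w, hw⟩ := hex v m hm
    exact ⟨w, m, hm, hw⟩
  choose β m hm hm' using hβ
  have hreach : ∀ v w n, Reach L f v n w → Reach L f' (β v) n (β w) := by
    intro v w n hn
    have h1 := (hm v).mul hn
    obtain ⟨w', hw'⟩ := hex w _ h1
    obtain rfl := huniq w _ _ _ _ h1 (hm w) hw' (hm' w)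
    obtain ⟨a, h2, h3⟩ := hw'.split hf'
    obtain rfl := h2.unique hf' (hm' v)
    exact h3
  obtain ⟨φ, h1, h2, h3, h4⟩ := exists_morphism (L := L) hf hf' β
    (fun e x v w he => by
      obtain ⟨q, hq⟩ := (hreach v w _ he.reach).exists_path hf'
      exact exists_isEdge_of_pathWord_eq_letter q hq)
    (fun c ρ v hc => by
      obtain ⟨q, hq⟩ := (hreach v v _ hc.reach).exists_path hf'
      exact (eq_of_pathWord_eq_letter q hq).2)
  refine ⟨φ, h1, h2, ?_, h4⟩
  have hp : β p = p' := huniq p _ _ _ _ (hm p) (.one p) (hm' p) (.one p')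
  have := h3 p
  rwa [hp] at this

/-- Immersions with a common loop monoid are equivalent. -/
theorem exists_homeomorph_of_loopSet {p : L.Gamma f} {p' : L.Gamma f'}
    (h : L.loopSet f p = L.loopSet f' p') : ∃ φ : C ≃ₜ C', IsCellularIso φ ∧ f' ∘ φ = f := by
  obtain ⟨φ, h1, h2, h3, h4⟩ := exists_morphism_of_loopSet hf hf' h
  obtain ⟨ψ, h1', h2', h3', -⟩ := exists_morphism_of_loopSet hf' hf h.symm
  -- Both sides are lifts of `f` through `f` on a connected space, and they agree at the base
  -- vertex.
  have hid : ψ ∘ φ = id := (T2Space.isSeparatedMap f).eq_of_comp_eq hf.isLocallyInjective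
    (h1'.comp h1) continuous_id (by funext x; simp [h2', h2]) (C.point p) (by simp [h3, h3'])
  have hid' : φ ∘ ψ = id := (T2Space.isSeparatedMap f').eq_of_comp_eq hf'.isLocallyInjective
    (h1.comp h1') continuous_id (by funext x; simp [h2', h2]) (C'.point p') (by simp [h3, h3'])
  exact ⟨⟨⟨φ, ψ, congrFun hid, congrFun hid'⟩, h1, h1'⟩, h4, funext h2⟩

end BouquetLabeling

/-! ### Complexes obtained by lifting the attaching maps of `B` -/

/-- A point of an open cell, for a family `J` of cells. -/
structure CellPoint (J : ℕ → Type u) : Type u where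
  dim : ℕ
  cell : J dim
  pos : Fin dim → ℝ
  mem : pos ∈ ball (0 : Fin dim → ℝ) 1

namespace CellPoint

variable {J : ℕ → Type u}

/-- The cell containing a point. -/
def carrier (p : CellPoint J) : Σ n, J n := ⟨p.dim, p.cell⟩

open Classical in
/-- The characteristic map of a cell with given values on the boundary sphere. -/
noncomputable def charMap (att : ∀ n, J n → (Fin n → ℝ) → CellPoint J) {n : ℕ} (c : J n)
    (y : Fin n → ℝ) : CellPoint J :=
  if h : y ∈ ball 0 1 then ⟨n, c, y, h⟩ else att n c y

end CellPoint

/-- Combinatorial data for a complex mapping to `B`: cells over the cells of `B`, with attaching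
maps that lift those of `B`. -/
structure CellLift (B : TwoComplex.{u}) where
  J : ℕ → Type u
  base : ∀ {n}, J n → B.Cell n
  att : ∀ n, J n → (Fin n → ℝ) → CellPoint J
  att_dim : ∀ {n} (c : J n), ∀ y ∈ sphere (0 : Fin n → ℝ) 1, (att n c y).dim < n
  att_map : ∀ {n} (c : J n), ∀ y ∈ sphere (0 : Fin n → ℝ) 1,
    B.charMap (base (att n c y).cell) (att n c y).pos = B.charMap (base c) y
  att_closed : ∀ {n} (c : J n) (S : Set (CellPoint J)),
    (∀ k < n, ∀ d : J k, IsClosed {y | y ∈ closedBall (0 : Fin k → ℝ) 1 ∧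
      CellPoint.charMap att d y ∈ S}) →
    IsClosed {y | y ∈ sphere (0 : Fin n → ℝ) 1 ∧ att n c y ∈ S}
  att_inj : ∀ {n} (c c' : J n), base c = base c' → ∀ y ∈ sphere (0 : Fin n → ℝ) 1,
    att n c y = att n c' y → c = c'
  /-- The cells met by the boundary of a cell can be found from finitely many points, which depend
  only on the cell of `B`. -/
  att_sample : ∀ {n} (b : B.Cell n), ∃ Y : Set (Fin n → ℝ), Y.Finite ∧ Y ⊆ sphere 0 1 ∧
    ∀ c : J n, base c = b → ∀ y ∈ sphere (0 : Fin n → ℝ) 1, ∃ y' ∈ Y,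
      (att n c y).carrier = (att n c y').carrier

namespace CellLift

variable {B : TwoComplex.{u}} (D : CellLift B)

/-- The points of the lifted complex. -/
abbrev Pt : Type u := CellPoint D.J

/-- The characteristic maps of the lifted complex. -/
noncomputable def chr {n : ℕ} (c : D.J n) (y : Fin n → ℝ) : D.Pt := CellPoint.charMap D.att c y

/-- The projection to `B`. -/
def proj (p : D.Pt) : B := B.charMap (D.base p.cell) p.pos

variable {D}

theorem chr_of_mem {n : ℕ} {c : D.J n} {y : Fin n → ℝ} (h : y ∈ ball (0 : Fin n → ℝ) 1) :
    D.chr c y = (⟨n, c, y, h⟩ : CellPoint D.J) := dif_pos h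

theorem chr_of_sphere {n : ℕ} {c : D.J n} {y : Fin n → ℝ} (h : y ∈ sphere (0 : Fin n → ℝ) 1) :
    D.chr c y = D.att n c y := by
  refine dif_neg ?_
  rw [mem_ball, not_lt, mem_sphere.1 h]

theorem proj_chr {n : ℕ} (c : D.J n) {y : Fin n → ℝ} (h : y ∈ closedBall (0 : Fin n → ℝ) 1) :
    D.proj (D.chr c y) = B.charMap (D.base c) y := by
  rw [← ball_union_sphere] at h
  rcases h with h | h
  · rw [chr_of_mem h]
    rfl
  · rw [chr_of_sphere h]
    exact D.att_map c y h

theorem proj_mem (p : D.Pt) : D.proj p ∈ B.openCell (D.base p.cell) := charMap_mem _ p.mem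

theorem exists_of_proj_mem {p : D.Pt} {n : ℕ} {b : B.Cell n} (h : D.proj p ∈ B.openCell b) :
    ∃ (c : D.J n) (y : Fin n → ℝ) (hy : y ∈ ball (0 : Fin n → ℝ) 1),
      p = (⟨n, c, y, hy⟩ : CellPoint D.J) ∧ D.base c = b := by
  obtain ⟨m, c, y, hy⟩ := p
  have h' := proj_mem (D := D) (⟨m, c, y, hy⟩ : CellPoint D.J)
  obtain rfl := dim_eq_of_mem h h'
  exact ⟨c, y, hy, rfl, eq_of_mem h' h⟩

/-- Open cells of `B` are disjoint and their characteristic maps injective on the ball, so points of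
one fiber have the same position and differ at most in the cell. -/
theorem exists_of_proj_eq {p q : D.Pt} (h : D.proj p = D.proj q) :
    ∃ (n : ℕ) (c c' : D.J n) (y : Fin n → ℝ) (hy : y ∈ ball (0 : Fin n → ℝ) 1),
      p = (⟨n, c, y, hy⟩ : CellPoint D.J) ∧ q = (⟨n, c', y, hy⟩ : CellPoint D.J) ∧
        D.base c = D.base c' := by
  obtain ⟨n, c, y, hy⟩ := p
  have h1 := proj_mem (D := D) (⟨n, c, y, hy⟩ : CellPoint D.J)
  rw [h] at h1
  obtain ⟨c', y', hy', rfl, hb⟩ := exists_of_proj_mem h1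
  have h2 : B.charMap (D.base c) y = B.charMap (D.base c') y' := h
  rw [hb] at h2
  obtain rfl := charMap_injOn _ hy hy' h2
  exact ⟨n, c, c', y, hy, rfl, rfl, hb.symm⟩

/-- The weak topology. -/
instance : TopologicalSpace D.Pt :=
  TopologicalSpace.ofClosed
    {S | ∀ (n : ℕ) (c : D.J n), IsClosed {y | y ∈ closedBall (0 : Fin n → ℝ) 1 ∧ D.chr c y ∈ S}}
    (by simp)
    (by
      intro A hA n c
      have : {y | y ∈ closedBall (0 : Fin n → ℝ) 1 ∧ D.chr c y ∈ ⋂₀ A} = closedBall 0 1 ∩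
          ⋂ S ∈ A, {y | y ∈ closedBall (0 : Fin n → ℝ) 1 ∧ D.chr c y ∈ S} := by
        ext y
        simp only [mem_ofPred_eq, mem_sInter, mem_inter_iff, mem_iInter]
        exact ⟨fun h => ⟨h.1, fun S hS => ⟨h.1, h.2 S hS⟩⟩,
          fun h => ⟨h.1, fun S hS => (h.2 S hS).2⟩⟩
      rw [this]
      exact isClosed_closedBall.inter (isClosed_biInter fun S hS => hA hS n c))
    (by
      intro S hS S' hS' n c
      have : {y | y ∈ closedBall (0 : Fin n → ℝ) 1 ∧ D.chr c y ∈ S ∪ S'} =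
          {y | y ∈ closedBall (0 : Fin n → ℝ) 1 ∧ D.chr c y ∈ S} ∪
          {y | y ∈ closedBall (0 : Fin n → ℝ) 1 ∧ D.chr c y ∈ S'} := by
        ext y
        simp only [mem_ofPred_eq, mem_union]
        tauto
      rw [this]
      exact (hS n c).union (hS' n c))

theorem isClosed_iff {S : Set D.Pt} : IsClosed S ↔
    ∀ (n : ℕ) (c : D.J n), IsClosed {y | y ∈ closedBall (0 : Fin n → ℝ) 1 ∧ D.chr c y ∈ S} := by
  rw [← isOpen_compl_iff]
  change Sᶜᶜ ∈ _ ↔ _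
  rw [compl_compl]
  rfl

theorem continuousOn_chr {n : ℕ} (c : D.J n) : ContinuousOn (D.chr c) (closedBall 0 1) := by
  rw [continuousOn_iff_isClosed]
  intro S hS
  refine ⟨_, isClosed_iff.1 hS n c, ?_⟩
  ext y
  simp only [mem_inter_iff, mem_preimage, mem_ofPred_eq]
  tauto

theorem continuous_proj : Continuous D.proj := by
  rw [continuous_iff_isClosed]
  intro A hA
  rw [isClosed_iff]
  intro n c
  have : {y | y ∈ closedBall (0 : Fin n → ℝ) 1 ∧ D.chr c y ∈ D.proj ⁻¹' A} =
      closedBall 0 1 ∩ B.charMap (D.base c) ⁻¹' A := by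
    ext y
    refine and_congr_right fun hy => ?_
    rw [mem_preimage, proj_chr c hy]
    rfl
  rw [this]
  exact (charMap_continuousOn _).preimage_isClosed_of_isClosed isClosed_closedBall hA

/-! #### Star neighborhoods -/

/-- The points obtained from a subset `S` of the cell `c₀` by successively thickening radially in
the cells of higher dimension, with radii in `R`. -/
inductive Star {n₀ : ℕ} (c₀ : D.J n₀) (S : Set (Fin n₀ → ℝ)) (R : Set ℝ) : CellPoint D.J → Prop
  | center (y : Fin n₀ → ℝ) (hy : y ∈ ball (0 : Fin n₀ → ℝ) 1) : y ∈ S → Star c₀ S R ⟨n₀, c₀, y, hy⟩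
  | radial (n : ℕ) (c : D.J n) (y : Fin n → ℝ) (hy : y ∈ ball (0 : Fin n → ℝ) 1) : ‖y‖ ∈ R →
      Star c₀ S R (D.att n c (‖y‖⁻¹ • y)) → Star c₀ S R ⟨n, c, y, hy⟩

theorem normalize_mem_sphere {n : ℕ} {y : Fin n → ℝ} (h : 0 < ‖y‖) :
    ‖y‖⁻¹ • y ∈ sphere (0 : Fin n → ℝ) 1 := by
  rw [mem_sphere_zero_iff_norm, norm_smul, norm_inv, norm_norm, inv_mul_cancel₀ h.ne']

namespace Star

variable {n₀ : ℕ} {c₀ c₀' : D.J n₀} {S : Set (Fin n₀ → ℝ)} {R : Set ℝ}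

theorem mono {S' : Set (Fin n₀ → ℝ)} {R' : Set ℝ} (hS : S ⊆ S') (hR : R ⊆ R') {p : CellPoint D.J}
    (h : Star c₀ S R p) : Star c₀ S' R' p := by
  induction h with
  | center y hy h => exact .center y hy (hS h)
  | radial n c y hy h _ ih => exact .radial n c y hy (hR h) ih

variable (hR : R ⊆ Ioi 0)
include hR

theorem dim_le {p : CellPoint D.J} (h : Star c₀ S R p) : n₀ ≤ p.dim := by
  induction h with
  | center y hy h => exact le_rfl
  | radial n c y hy h _ ih =>
    exact ih.trans (D.att_dim c _ (normalize_mem_sphere (hR h))).le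

theorem center_iff {c : D.J n₀} {y : Fin n₀ → ℝ} {hy : y ∈ ball (0 : Fin n₀ → ℝ) 1} :
    Star c₀ S R ⟨n₀, c, y, hy⟩ ↔ c = c₀ ∧ y ∈ S := by
  constructor
  · intro h
    cases h with
    | center y hy h => exact ⟨rfl, h⟩
    | radial _ _ _ _ h h' =>
      exact absurd (h'.dim_le hR) (D.att_dim c _ (normalize_mem_sphere (hR h))).not_ge
  · rintro ⟨rfl, h⟩
    exact .center y hy h

omit hR in
theorem radial_iff {n : ℕ} (hn : n ≠ n₀) {c : D.J n} {y : Fin n → ℝ}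
    {hy : y ∈ ball (0 : Fin n → ℝ) 1} :
    Star c₀ S R ⟨n, c, y, hy⟩ ↔ ‖y‖ ∈ R ∧ Star c₀ S R (D.att n c (‖y‖⁻¹ • y)) := by
  constructor
  · intro h
    cases h with
    | center y hy h => exact absurd rfl hn
    | radial _ _ _ _ h h' => exact ⟨h, h'⟩
  · rintro ⟨h, h'⟩
    exact .radial n c y hy h h'

theorem chr_center_iff (hS : S ⊆ ball 0 1) {c : D.J n₀} {y : Fin n₀ → ℝ}
    (hy : y ∈ closedBall (0 : Fin n₀ → ℝ) 1) : Star c₀ S R (D.chr c y) ↔ c = c₀ ∧ y ∈ S := by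
  by_cases h : y ∈ ball (0 : Fin n₀ → ℝ) 1
  · rw [chr_of_mem h, center_iff hR]
  · have h' : y ∈ sphere (0 : Fin n₀ → ℝ) 1 := by
      rw [← ball_union_sphere] at hy
      exact hy.resolve_left h
    rw [chr_of_sphere h']
    refine iff_of_false (fun hs => ?_) fun hs => h (hS hs.2)
    exact absurd (hs.dim_le hR) (D.att_dim c _ h').not_ge

omit hR in
-- For a boundary point radial projection does nothing, so with `1 ∈ R` a single rule describes the
-- star on the whole closed ball.
theorem chr_radial_iff (h1 : (1 : ℝ) ∈ R) {n : ℕ} (hn : n ≠ n₀) {c : D.J n} {y : Fin n → ℝ}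
    (hy : y ∈ closedBall (0 : Fin n → ℝ) 1) :
    Star c₀ S R (D.chr c y) ↔ ‖y‖ ∈ R ∧ Star c₀ S R (D.att n c (‖y‖⁻¹ • y)) := by
  rw [← ball_union_sphere] at hy
  rcases hy with hy | hy
  · rw [chr_of_mem hy, radial_iff hn]
  · rw [chr_of_sphere hy, mem_sphere_zero_iff_norm.1 hy, inv_one, one_smul]
    simp [h1]

/-- Points with the same projection have the same position, hence the same radial direction. By
induction their radial projections into lower cells coincide, and `att_inj` then identifies the
cells. -/
theorem injOn {p q : CellPoint D.J} (hp : Star c₀ S R p) (hq : Star c₀ S R q)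
    (h : D.proj p = D.proj q) : p = q := by
  induction hp generalizing q with
  | center y hy hyS =>
    obtain ⟨n, c, c', z, hz, h1, rfl, hb⟩ := exists_of_proj_eq h
    cases h1
    obtain ⟨rfl, -⟩ := (center_iff hR).1 hq
    rfl
  | radial n c y hy hyR hs ih =>
    have hsph := normalize_mem_sphere (hR hyR)
    obtain ⟨n', c₁, c', z, hz, h1, rfl, hb⟩ := exists_of_proj_eq h
    cases h1
    cases hq with
    | center =>
      exact absurd (hs.dim_le hR) (D.att_dim _ _ hsph).not_ge
    | radial _ _ _ _ hR' hs' =>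
      have h2 := ih hs' ((D.att_map _ _ hsph).trans (by rw [hb]; exact (D.att_map _ _ hsph).symm))
      obtain rfl := D.att_inj _ _ hb _ hsph h2
      rfl

/-- Successive radial projection of a point leads to a single center. Stars around different cells
of the same dimension are therefore disjoint. -/
theorem center_unique {p : CellPoint D.J} (h : Star c₀ S R p)
    (h' : Star c₀' S R p) : c₀ = c₀' := by
  induction h with
  | center y hy h => exact ((center_iff hR).1 h').1
  | radial n c y hy hyR hs ih =>
    cases h' with
    | center =>
      exact absurd (hs.dim_le hR) (D.att_dim _ _ (normalize_mem_sphere (hR hyR))).not_ge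
    | radial _ _ _ _ _ hs' => exact ih hs'

/-- A cell over `b` that meets the star has a star cell on its boundary, detected at one of finitely
many sample points. At a fixed sample point the attached point determines the cell by `att_inj`, and
it lies over a fixed point of `B` in a star cell of lower dimension; induction leaves finitely many
choices. -/
theorem finite_cells {n : ℕ} (b : B.Cell n) :
    {c : D.J n | D.base c = b ∧ ∃ y hy, Star c₀ S R ⟨n, c, y, hy⟩}.Finite := by
  induction n using Nat.strong_induction_on with
  | _ n ih =>
    by_cases hn : n = n₀
    · subst hn
      refine (finite_singleton c₀).subset ?_
      rintro c ⟨-, y, hy, h⟩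
      exact ((center_iff hR).1 h).1
    obtain ⟨Y, hYf, hYs, hY⟩ := D.att_sample b
    have hsub : {c : D.J n | D.base c = b ∧ ∃ y hy, Star c₀ S R ⟨n, c, y, hy⟩} ⊆ ⋃ y' ∈ Y,
        {c : D.J n | D.base c = b ∧ ∃ p : CellPoint D.J, Star c₀ S R p ∧
          p.carrier = (D.att n c y').carrier} := by
      rintro c ⟨hb, y, hy, h⟩
      obtain ⟨hyR, hs⟩ := (radial_iff hn).1 h
      obtain ⟨y', hy', hc⟩ := hY c hb _ (normalize_mem_sphere (hR hyR))
      simp only [mem_iUnion]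
      exact ⟨y', hy', hb, _, hs, hc⟩
    refine Finite.subset (hYf.biUnion fun y' hy' => ?_) hsub
    obtain ⟨k, hk, b', hb'⟩ := exists_lower_of_sphere b (hYs hy')
    obtain ⟨z, hz, hzb⟩ := id hb'
    have hfin := (ih k hk b').image fun d => (⟨k, d, z, hz⟩ : CellPoint D.J)
    refine Finite.of_finite_image (f := fun c => D.att n c y') (hfin.subset ?_) ?_
    · rintro _ ⟨c, ⟨rfl, p, hp, hpc⟩, rfl⟩
      have h1 : D.proj (D.att n c y') = B.charMap (D.base c) y' := D.att_map c y' (hYs hy')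
      obtain ⟨d, z', hz', h2, hdb⟩ := exists_of_proj_mem (h1 ▸ hb')
      have h3 : B.charMap (D.base d) z' = B.charMap (D.base d) z := by
        have h4 : D.proj (D.att n c y') = B.charMap (D.base d) z' := by rw [h2]; rfl
        rw [← h4, h1, hdb]
        exact hzb.symm
      obtain rfl := charMap_injOn _ hz' hz h3
      refine ⟨d, ⟨hdb, ?_⟩, h2.symm⟩
      rw [h2] at hpc
      obtain ⟨m, e, w, hw⟩ := p
      cases hpc
      exact ⟨w, hw, hp⟩
    · rintro c ⟨hc, -⟩ c' ⟨hc', -⟩ h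
      exact D.att_inj c c' (hc.trans hc'.symm) y' (hYs hy') h

end Star

/-- The bound `1 / 2` keeps away from the origin, where radial projection is not continuous. -/
theorem isClosed_radial {n : ℕ} {T : Set (Fin n → ℝ)} (hT : IsClosed T) :
    IsClosed {y : Fin n → ℝ | y ∈ closedBall (0 : Fin n → ℝ) 1 ∧ 1 / 2 ≤ ‖y‖ ∧ ‖y‖⁻¹ • y ∈ T} := by
  have h1 : IsClosed {y : Fin n → ℝ | 1 / 2 ≤ ‖y‖} := isClosed_le continuous_const continuous_norm
  have h2 : ContinuousOn (fun y : Fin n → ℝ => ‖y‖⁻¹ • y) {y | 1 / 2 ≤ ‖y‖} := by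
    refine (continuous_norm.continuousOn.inv₀ fun y hy => ?_).smul continuousOn_id
    have : (1 : ℝ) / 2 ≤ ‖y‖ := hy
    intro h0
    norm_num [h0] at this
  exact isClosed_closedBall.inter (h2.preimage_isClosed_of_isClosed h1 hT)

/-- By induction on dimension: `att_closed` handles the sphere, and radial thickening to norm at
least `1 / 2` preserves closedness. -/
theorem isClosed_star {n₀ : ℕ} (c₀ : D.J n₀) {S : Set (Fin n₀ → ℝ)} (hS : IsClosed S)
    (hSb : S ⊆ ball 0 1) : IsClosed {p : D.Pt | Star c₀ S (Ici (1 / 2)) p} := by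
  have hR : Ici (1 / 2 : ℝ) ⊆ Ioi 0 := fun x hx =>
    (half_pos one_pos).trans_le (mem_Ici.1 hx)
  have h1 : (1 : ℝ) ∈ Ici (1 / 2 : ℝ) := by norm_num
  rw [isClosed_iff]
  intro n
  induction n using Nat.strong_induction_on with
  | _ n ih =>
    intro c
    by_cases hn : n = n₀
    · subst hn
      by_cases hc : c = c₀
      · subst hc
        convert hS using 1
        ext y
        exact ⟨fun h => ((Star.chr_center_iff hR hSb h.1).1 h.2).2, fun h =>
          ⟨ball_subset_closedBall (hSb h),
            (Star.chr_center_iff hR hSb (ball_subset_closedBall (hSb h))).2 ⟨rfl, h⟩⟩⟩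
      · convert isClosed_empty using 1
        ext y
        exact ⟨fun h => hc ((Star.chr_center_iff hR hSb h.1).1 h.2).1, fun h => h.elim⟩
    · have hT := D.att_closed c {p | Star c₀ S (Ici (1 / 2)) p} ih
      convert isClosed_radial hT using 1
      ext y
      refine and_congr_right fun hy => ?_
      rw [mem_ofPred_eq, Star.chr_radial_iff h1 hn hy]
      exact ⟨fun h => ⟨h.1, normalize_mem_sphere (hR h.1), h.2⟩, fun h => ⟨h.1, h.2.2⟩⟩

/-- In a higher cell the complement is the inner ball of radius `1 / 2` together with the radial
thickening of the complement on the sphere, both closed. -/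
theorem isOpen_star {n₀ : ℕ} (c₀ : D.J n₀) {S : Set (Fin n₀ → ℝ)} (hS : IsOpen S)
    (hSb : S ⊆ ball 0 1) : IsOpen {p : D.Pt | Star c₀ S (Ioi (1 / 2)) p} := by
  have hR : Ioi (1 / 2 : ℝ) ⊆ Ioi 0 := fun x hx =>
    (half_pos one_pos).trans (mem_Ioi.1 hx)
  have h1 : (1 : ℝ) ∈ Ioi (1 / 2 : ℝ) := by norm_num
  rw [← isClosed_compl_iff, isClosed_iff]
  intro n
  induction n using Nat.strong_induction_on with
  | _ n ih =>
    intro c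
    by_cases hn : n = n₀
    · subst hn
      by_cases hc : c = c₀
      · subst hc
        have heq : {y | y ∈ closedBall (0 : Fin n → ℝ) 1 ∧
            D.chr c y ∈ {p : D.Pt | Star c S (Ioi (1 / 2)) p}ᶜ} = closedBall 0 1 ∩ Sᶜ := by
          ext y
          refine and_congr_right fun hy => not_congr ?_
          rw [mem_ofPred_eq, Star.chr_center_iff hR hSb hy]
          simp
        rw [heq]
        exact isClosed_closedBall.inter hS.isClosed_compl
      · have heq : {y | y ∈ closedBall (0 : Fin n → ℝ) 1 ∧
            D.chr c y ∈ {p : D.Pt | Star c₀ S (Ioi (1 / 2)) p}ᶜ} = closedBall 0 1 := by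
          ext y
          exact ⟨fun h => h.1, fun h =>
            ⟨h, fun h' => hc ((Star.chr_center_iff hR hSb h).1 h').1⟩⟩
        rw [heq]
        exact isClosed_closedBall
    · have hT := D.att_closed c {p : CellPoint D.J | Star c₀ S (Ioi (1 / 2)) p}ᶜ ih
      have hle : IsClosed {y : Fin n → ℝ | ‖y‖ ≤ 1 / 2} :=
        isClosed_le continuous_norm continuous_const
      have heq : {y | y ∈ closedBall (0 : Fin n → ℝ) 1 ∧
          D.chr c y ∈ {p : D.Pt | Star c₀ S (Ioi (1 / 2)) p}ᶜ} =
          (closedBall 0 1 ∩ {y | ‖y‖ ≤ 1 / 2}) ∪ {y | y ∈ closedBall (0 : Fin n → ℝ) 1 ∧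
            1 / 2 ≤ ‖y‖ ∧ ‖y‖⁻¹ • y ∈ {y | y ∈ sphere (0 : Fin n → ℝ) 1 ∧
              D.att n c y ∈ {p : CellPoint D.J | Star c₀ S (Ioi (1 / 2)) p}ᶜ}} := by
        ext y
        simp only [mem_ofPred_eq, mem_union, mem_inter_iff, mem_compl_iff]
        rw [← and_or_left]
        refine and_congr_right fun hy => ?_
        rw [Star.chr_radial_iff h1 hn hy, mem_Ioi]
        constructor
        · intro h
          rcases le_or_gt ‖y‖ (1 / 2) with h' | h'
          · exact Or.inl h'
          · exact Or.inr ⟨h'.le, normalize_mem_sphere (hR h'), fun hs => h ⟨h', hs⟩⟩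
        · rintro (h | ⟨-, -, h⟩) ⟨h', hs⟩
          · exact absurd h' h.not_gt
          · exact h hs
      rw [heq]
      exact (isClosed_closedBall.inter hle).union (isClosed_radial hT)

instance : T2Space D.Pt := by
  refine ⟨fun p q hpq => ?_⟩
  by_cases h : D.proj p = D.proj q
  -- Points in one fiber are separated by the disjoint stars of their cells; points in different
  -- fibers by open sets pulled back from `B`.
  · obtain ⟨n, c, c', y, hy, rfl, rfl, hb⟩ := exists_of_proj_eq h
    have hR : Ioi (1 / 2 : ℝ) ⊆ Ioi 0 := fun x hx =>
    (half_pos one_pos).trans (mem_Ioi.1 hx)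
    refine ⟨_, _, isOpen_star c isOpen_ball Subset.rfl, isOpen_star c' isOpen_ball Subset.rfl,
      .center y hy hy, .center y hy hy, disjoint_left.2 fun p hp hp' => hpq ?_⟩
    rw [Star.center_unique hR hp hp']
  · obtain ⟨U, V, hU, hV, hpU, hqV, hUV⟩ := t2_separation h
    exact ⟨_, _, hU.preimage continuous_proj, hV.preimage continuous_proj, hpU, hqV,
      hUV.preimage _⟩

/-- Over a closed cell of `B` the image consists of its part in the frontier, closed by induction on
dimension, and of finitely many compact pieces by `finite_cells`. -/
theorem isClosed_proj_image {n₀ : ℕ} {c₀ : D.J n₀} {S : Set (Fin n₀ → ℝ)} {R : Set ℝ}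
    (hR : R ⊆ Ioi 0) {A : Set D.Pt} (hA : IsClosed A) (hAs : ∀ p ∈ A, Star c₀ S R p) :
    IsClosed (D.proj '' A) := by
  rw [CWComplex.closed univ _ (subset_univ _)]
  intro n
  induction n using Nat.strong_induction_on with
  | _ n ih =>
    intro b
    set F := {c : D.J n | D.base c = b ∧ ∃ y hy, Star c₀ S R ⟨n, c, y, hy⟩} with hF
    have hfin : F.Finite := Star.finite_cells hR b
    have hfr : IsClosed (D.proj '' A ∩ RelCWComplex.cellFrontier (C := (univ : Set B)) n b) := by
      cases n with
      | zero =>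
        rw [RelCWComplex.cellFrontier_zero_eq_empty, inter_empty]
        exact isClosed_empty
      | succ n =>
        exact CWComplex.isClosed_inter_cellFrontier_succ_of_le_isClosed_inter_closedCell
          (fun m hm => ih m (Nat.lt_succ_of_le hm)) b
    have heq : D.proj '' A ∩ RelCWComplex.closedCell (C := (univ : Set B)) n b =
        (D.proj '' A ∩ RelCWComplex.cellFrontier (C := (univ : Set B)) n b) ∪
        ⋃ c ∈ F, B.charMap b '' {y | y ∈ closedBall (0 : Fin n → ℝ) 1 ∧ D.chr c y ∈ A} := by
      apply Subset.antisymm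
      · rintro _ ⟨⟨p, hp, rfl⟩, hpb⟩
        rw [← RelCWComplex.cellFrontier_union_openCell_eq_closedCell] at hpb
        rcases hpb with hpb | hpb
        · exact Or.inl ⟨⟨p, hp, rfl⟩, hpb⟩
        · obtain ⟨c, y, hy, rfl, hb⟩ := exists_of_proj_mem hpb
          refine Or.inr ?_
          simp only [mem_iUnion]
          refine ⟨c, ⟨hb, y, hy, hAs _ hp⟩, y, ⟨ball_subset_closedBall hy, ?_⟩, ?_⟩
          · rw [chr_of_mem hy]
            exact hp
          · subst hb
            rfl
      · rintro x (hx | hx)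
        · exact ⟨hx.1, RelCWComplex.cellFrontier_subset_closedCell _ _ hx.2⟩
        · simp only [mem_iUnion] at hx
          obtain ⟨c, ⟨rfl, -⟩, y, ⟨hy, hyA⟩, rfl⟩ := hx
          exact ⟨⟨_, hyA, proj_chr c hy⟩, y, hy, rfl⟩
    rw [heq]
    refine hfr.union (hfin.isClosed_biUnion fun c _ => ?_)
    have h1 : IsCompact {y | y ∈ closedBall (0 : Fin n → ℝ) 1 ∧ D.chr c y ∈ A} :=
      (isCompact_closedBall _ _).of_isClosed_subset (isClosed_iff.1 hA n c) fun y hy => hy.1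
    exact (h1.image_of_continuousOn ((charMap_continuousOn b).mono fun y hy => hy.1)).isClosed

/-- On the closed star over a small closed ball the projection is continuous, injective and closed,
hence a closed embedding. The open star inside it shows that it is a neighborhood. -/
theorem exists_embedding_nhds (p : D.Pt) : ∃ U ∈ 𝓝 p, IsEmbedding (U.domRestrict D.proj) := by
  obtain ⟨n, c, y, hy⟩ := p
  have hR : Ici (1 / 2 : ℝ) ⊆ Ioi 0 := fun x hx =>
    (half_pos one_pos).trans_le (mem_Ici.1 hx)
  have hy1 : ‖y‖ < 1 := mem_ball_zero_iff.1 hy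
  -- Half the distance from `y` to the sphere keeps the closed ball of radius `r` inside the open
  -- cell.
  set r := (1 - ‖y‖) / 2 with hr
  have hr0 : 0 < r := by rw [hr]; linarith
  have hsub : closedBall y r ⊆ ball 0 1 := by
    intro z hz
    rw [mem_closedBall, dist_eq_norm] at hz
    rw [mem_ball_zero_iff]
    have := norm_le_norm_add_norm_sub' z y
    rw [hr] at hz
    linarith
  set U : Set D.Pt := {p | Star c (closedBall y r) (Ici (1 / 2)) p} with hU
  have hUc : IsClosed U := isClosed_star c isClosed_closedBall hsub
  refine ⟨U, ?_, ?_⟩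
  · refine Filter.mem_of_superset ((isOpen_star c isOpen_ball
      (ball_subset_closedBall.trans hsub)).mem_nhds
      (.center y hy (mem_ball_self hr0) : Star c (ball y r) (Ioi (1 / 2)) ⟨n, c, y, hy⟩)) ?_
    exact fun q hq => Star.mono ball_subset_closedBall Ioi_subset_Ici_self hq
  · refine (IsClosedEmbedding.of_continuous_injective_isClosedMap
      (continuous_proj.comp continuous_subtype_val) ?_ ?_).isEmbedding
    · exact fun p q h => Subtype.ext (Star.injOn hR p.2 q.2 h)
    · intro A hA
      have h1 : IsClosed ((↑) '' A : Set D.Pt) := hUc.isClosedMap_subtype_val A hA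
      have h2 := isClosed_proj_image (c₀ := c) hR h1 (by
        rintro _ ⟨p, -, rfl⟩
        exact p.2)
      rw [image_image] at h2
      exact h2

/-! #### The complex -/

/-- The characteristic maps as partial equivalences. -/
noncomputable def chrEquiv {n : ℕ} (c : D.J n) : PartialEquiv (Fin n → ℝ) D.Pt where
  toFun := D.chr c
  -- The position in the cell is read off after projecting to `B`, so continuity of the inverse is
  -- inherited from `B`.
  invFun p := (RelCWComplex.map (C := (univ : Set B)) n (D.base c)).symm (D.proj p)
  source := ball 0 1
  target := D.chr c '' ball 0 1
  map_source' y hy := mem_image_of_mem _ hy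
  map_target' := by
    rintro _ ⟨y, hy, rfl⟩
    rw [proj_chr c (ball_subset_closedBall hy)]
    have := (RelCWComplex.map (C := (univ : Set B)) n (D.base c)).left_inv
      (by rwa [RelCWComplex.source_eq])
    rwa [this]
  left_inv' := by
    intro y hy
    rw [proj_chr c (ball_subset_closedBall hy)]
    exact (RelCWComplex.map (C := (univ : Set B)) n (D.base c)).left_inv
      (by rwa [RelCWComplex.source_eq])
  right_inv' := by
    rintro _ ⟨y, hy, rfl⟩
    rw [proj_chr c (ball_subset_closedBall hy)]
    congr 1
    exact (RelCWComplex.map (C := (univ : Set B)) n (D.base c)).left_inv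
      (by rwa [RelCWComplex.source_eq])

theorem exists_chr_eq (p : D.Pt) : ∃ (n : ℕ) (c : D.J n), ∃ y ∈ ball (0 : Fin n → ℝ) 1,
    D.chr c y = p := by
  obtain ⟨n, c, y, hy⟩ := p
  exact ⟨n, c, y, hy, chr_of_mem hy⟩

theorem finite_boundary {n : ℕ} (c : D.J n) :
    {d : Σ m, D.J m | ∃ y ∈ sphere (0 : Fin n → ℝ) 1, (D.att n c y).carrier = d}.Finite := by
  obtain ⟨Y, hYf, hYs, hY⟩ := D.att_sample (D.base c)
  refine (hYf.image fun y => (D.att n c y).carrier).subset ?_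
  rintro _ ⟨y, hy, rfl⟩
  obtain ⟨y', hy', h⟩ := hY c rfl y hy
  exact ⟨y', hy', h.symm⟩

noncomputable instance : CWComplex (univ : Set D.Pt) where
  cell := D.J
  map _ c := chrEquiv c
  source_eq _ _ := rfl
  continuousOn _ c := continuousOn_chr c
  continuousOn_symm n c := by
    refine (RelCWComplex.continuousOn_symm n (D.base c)).comp continuous_proj.continuousOn ?_
    rintro _ ⟨y, hy, rfl⟩
    rw [proj_chr c (ball_subset_closedBall hy)]
    exact (RelCWComplex.map (C := (univ : Set B)) n (D.base c)).map_source
      (by rwa [RelCWComplex.source_eq])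
  pairwiseDisjoint' := by
    rintro ⟨n, c⟩ - ⟨n', c'⟩ - hne
    refine disjoint_left.2 ?_
    rintro _ ⟨y, hy, rfl⟩ ⟨y', hy', h⟩
    change D.chr c' y' = D.chr c y at h
    rw [chr_of_mem hy, chr_of_mem hy'] at h
    exact hne (congrArg CellPoint.carrier h).symm
  mapsTo' n c := by
    classical
    have hfin := fun m => (finite_boundary c).preimage
      (sigma_mk_injective (i := m) (β := D.J)).injOn
    refine ⟨fun m => (hfin m).toFinset, fun y hy => ?_⟩
    simp only [mem_iUnion, Finite.mem_toFinset]
    change ∃ m, ∃ (_ : m < n), ∃ d, ∃ (_ : _), D.chr c y ∈ D.chr d '' closedBall 0 1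
    rw [chr_of_sphere hy]
    refine ⟨_, D.att_dim c y hy, (D.att n c y).cell, ⟨y, hy, rfl⟩, (D.att n c y).pos,
      ball_subset_closedBall (D.att n c y).mem, ?_⟩
    rw [chr_of_mem (D.att n c y).mem]
  closed' A _ h := by
    rw [isClosed_iff]
    intro n c
    -- The part of `A` in the closed cell `c` is tested against the characteristic map of `c`
    -- itself.
    have := isClosed_iff.1 (h n c) n c
    convert this using 1
    ext y
    exact and_congr_right fun hy => ⟨fun h => ⟨h, y, hy, rfl⟩, fun h => h.1⟩
  union' := by
    refine eq_univ_of_forall fun p => ?_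
    obtain ⟨n, c, y, hy, rfl⟩ := exists_chr_eq p
    simp only [mem_iUnion]
    exact ⟨n, c, y, ball_subset_closedBall hy, rfl⟩

variable (D) in
/-- The complex with the given cells. -/
noncomputable def toTwoComplex [ConnectedSpace D.Pt] (h : ∀ n, 2 < n → IsEmpty (D.J n)) :
    TwoComplex.{u} where
  carrier := D.Pt
  dim_le := h

theorem bijOn_proj {n : ℕ} (c : D.J n) :
    BijOn D.proj (D.chr c '' ball 0 1) (B.openCell (D.base c)) := by
  refine ⟨?_, ?_, ?_⟩
  · rintro _ ⟨y, hy, rfl⟩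
    rw [proj_chr _ (ball_subset_closedBall hy)]
    exact charMap_mem _ hy
  · rintro _ ⟨y, hy, rfl⟩ _ ⟨y', hy', rfl⟩ heq
    rw [proj_chr _ (ball_subset_closedBall hy), proj_chr _ (ball_subset_closedBall hy')] at heq
    rw [charMap_injOn _ hy hy' heq]
  · rintro _ ⟨y, hy, rfl⟩
    exact ⟨_, ⟨y, hy, rfl⟩, proj_chr _ (ball_subset_closedBall hy)⟩

theorem isImmersion_proj [ConnectedSpace D.Pt] (h : ∀ n, 2 < n → IsEmpty (D.J n)) :
    IsImmersion (D.toTwoComplex h) B D.proj where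
  continuous := continuous_proj
  cellular n c := ⟨_, bijOn_proj (n := n) c⟩
  locally_embedding := exists_embedding_nhds

theorem isLiftedCharMap_chr [ConnectedSpace D.Pt] (h : ∀ n, 2 < n → IsEmpty (D.J n)) {n : ℕ}
    (c : D.J n) : IsLiftedCharMap (D := D.toTwoComplex h) D.proj c (D.base c) (D.chr c) where
  continuousOn := continuousOn_chr c
  mapsTo _ hy := mem_image_of_mem _ hy
  lift _ hy := proj_chr c hy

end CellLift

/-! ### Partial actions of the letters and the cells they define -/

namespace BouquetLabeling

variable {X P : Type u} {B : TwoComplex.{u}} (L : BouquetLabeling X P B)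

theorem circle_eq_cases {ρ : P} {s s' : ℝ} (hs : s ∈ Icc (0 : ℝ) 1) (hs' : s' ∈ Icc (0 : ℝ) 1)
    (h : L.circle ρ s = L.circle ρ s') : s = s' ∨ (s = 0 ∧ s' = 1) ∨ (s = 1 ∧ s' = 0) := by
  have h0 : (0 : ℝ) ∈ Ico (0 : ℝ) 1 := ⟨le_rfl, one_pos⟩
  have hinj := (L.circle_bijOn ρ).injOn
  rcases hs.2.eq_or_lt with h1 | h1 <;> rcases hs'.2.eq_or_lt with h2 | h2
  · exact Or.inl (h1.trans h2.symm)
  · rw [h1, L.circle_closed] at h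
    exact Or.inr (Or.inr ⟨h1, (hinj h0 ⟨hs'.1, h2⟩ h).symm⟩)
  · rw [h2, L.circle_closed] at h
    exact Or.inr (Or.inl ⟨hinj ⟨hs.1, h1⟩ h0 h, h2⟩)
  · exact Or.inl (hinj ⟨hs.1, h1⟩ ⟨hs'.1, h2⟩ h)

/-- A function on the boundary circle of a face can be defined piecewise on the segments. -/
theorem exists_glue {Z : Type*} (ρ : P) {k : ℕ} (w : ℕ → ℝ → Z) (node : ℕ → Z)
    (h0 : ∀ i < k, w i 0 = node i) (h1 : ∀ i < k, w i 1 = node (i + 1)) (hk : node k = node 0) :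
    ∃ g : (Fin 2 → ℝ) → Z, (∀ i < k, ∀ t ∈ Icc (0 : ℝ) 1, g (L.circle ρ ((i + t) / k)) = w i t) ∧
      (k = 0 → ∀ y, g y = node 0) := by
  rcases Nat.eq_zero_or_pos k with rfl | hpos
  · exact ⟨fun _ => node 0, fun i hi => absurd hi (Nat.not_lt_zero i), fun _ _ => rfl⟩
  have hk0 : (0 : ℝ) < k := by exact_mod_cast hpos
  have hex : ∀ y : Fin 2 → ℝ, ∃ z : Z, ∀ i < k, ∀ t ∈ Icc (0 : ℝ) 1,
      L.circle ρ ((i + t) / k) = y → z = w i t := by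
    intro y
    by_cases hy : ∃ i < k, ∃ t ∈ Icc (0 : ℝ) 1, L.circle ρ (((i : ℕ) + t) / k) = y
    · obtain ⟨i, hi, t, ht, rfl⟩ := hy
      refine ⟨w i t, fun j hj s hs h => ?_⟩
      -- One parameter is `0` and the other `1`: the start of the first segment meets the end of the
      -- last one, and the values agree by `hk`.
      have hend : ∀ {i j : ℕ} {t s : ℝ}, i < k → j < k → t ∈ Icc (0 : ℝ) 1 → s ∈ Icc (0 : ℝ) 1 →
          ((i : ℝ) + t) / k = 0 → ((j : ℝ) + s) / k = 1 → w i t = w j s := by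
        intro i j t s hi hj ht hs h2 h3
        rw [div_eq_zero_iff, or_iff_left hk0.ne'] at h2
        rw [div_eq_one_iff_eq hk0.ne'] at h3
        have hi0 : (i : ℝ) = 0 := by
          have : (0 : ℝ) ≤ i := Nat.cast_nonneg i
          linarith [ht.1]
        have ht0 : t = 0 := by linarith
        have hjk : (j : ℝ) + 1 ≤ k := by exact_mod_cast hj
        have hs1 : s = 1 := by linarith [hs.2]
        have hj1 : j + 1 = k := by
          have : (j : ℝ) + 1 = k := by linarith
          exact_mod_cast this
        obtain rfl : i = 0 := by exact_mod_cast hi0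
        rw [ht0, hs1, h0 _ hi, h1 _ hj, hj1, hk]
      rcases L.circle_eq_cases (div_mem_Icc hi ht) (div_mem_Icc hj hs) h.symm with h2 | h2 | h2
      · have h3 : (i : ℝ) + t = j + s := by
          have := congrArg (fun a => a * (k : ℝ)) h2
          simpa [div_mul_cancel₀ _ hk0.ne'] using this
        -- Equal parameters in different segments occur only at the common node of consecutive ones.
        have hnode : ∀ {i j : ℕ} {t s : ℝ}, i < k → j < k → t ∈ Icc (0 : ℝ) 1 →
            s ∈ Icc (0 : ℝ) 1 → (i : ℝ) + t = j + s → i < j → w i t = w j s := by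
          intro i j t s hi hj ht hs h hij
          have hij' : (i : ℝ) + 1 ≤ j := by exact_mod_cast hij
          have ht1 : t = 1 := by linarith [ht.2, hs.1]
          have hs0 : s = 0 := by linarith [ht.2, hs.1]
          have hj1 : j = i + 1 := by
            have : (j : ℝ) = i + 1 := by linarith
            exact_mod_cast this
          rw [ht1, hs0, h0 _ hj, h1 _ hi, hj1]
        rcases lt_trichotomy i j with hij | rfl | hij
        · exact hnode hi hj ht hs h3 hij
        · rw [add_left_cancel h3]
        · exact (hnode hj hi hs ht h3.symm hij).symm
      · exact hend hi hj ht hs h2.1 h2.2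
      · exact (hend hj hi hs ht h2.2 h2.1).symm
    · exact ⟨node 0, fun i hi t ht h => absurd ⟨i, hi, t, ht, h⟩ hy⟩
  choose g hg using hex
  exact ⟨g, fun i hi t ht => hg _ i hi t ht rfl, fun h => absurd h hpos.ne'⟩

/-- A set of vertices with partial injections for the letters in `X`, and with domains for the
letters in `P`, such that `bl ρ` labels a closed walk at each point of the domain of `ρ`. -/
structure PartialAction where
  V : Type u
  step : X → V → V → Prop
  step_unique : ∀ {x v w w'}, step x v w → step x v w' → w = w'
  step_injective : ∀ {x v v' w}, step x v w → step x v' w → v = v'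
  face : P → V → Prop
  walk : ∀ {ρ v}, face ρ v → ∃ vs : ℕ → V, vs 0 = v ∧ vs (L.bl ρ).length = v ∧
    ∀ i (hi : i < (L.bl ρ).length), if ((L.bl ρ)[i]).2 then step ((L.bl ρ)[i]).1 (vs i) (vs (i + 1))
      else step ((L.bl ρ)[i]).1 (vs (i + 1)) (vs i)

namespace PartialAction

variable {L} (A : L.PartialAction)

/-- The edges. -/
abbrev Edge : Type u := {q : X × A.V × A.V // A.step q.1 q.2.1 q.2.2}

/-- The faces. -/
abbrev Face : Type u := {q : P × A.V // A.face q.1 q.2}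

/-- The cells over those of the bouquet. -/
def cells : ℕ → Type u
  | 0 => A.V
  | 1 => A.Edge
  | 2 => A.Face
  | _ + 3 => PEmpty

/-- The cell of the bouquet under a given cell. -/
def base : ∀ {n}, A.cells n → B.Cell n
  | 0, _ => L.vertex.default
  | 1, e => L.edge (show A.Edge from e).1.1
  | 2, c => L.face (show A.Face from c).1.1
  | _ + 3, c => (show PEmpty from c).elim

/-- A vertex as a point. -/
def vert (v : A.V) : CellPoint A.cells := ⟨0, v, 0, mem_ball_self one_pos⟩

/-- An edge as a cell. -/
def edgeCell (e : A.Edge) : A.cells 1 := e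

/-- A face as a cell. -/
def faceCell (c : A.Face) : A.cells 2 := c

variable {A}

theorem vert_injective : Function.Injective A.vert := by
  intro v w h
  exact eq_of_heq (CellPoint.mk.inj h).2.1

variable (A)

open Classical in
/-- The characteristic map of an edge. -/
noncomputable def edgeChr (e : A.Edge) (y : Fin 1 → ℝ) : CellPoint A.cells :=
  if h : y ∈ ball (0 : Fin 1 → ℝ) 1 then ⟨1, A.edgeCell e, y, h⟩
  else if y 0 < 0 then A.vert e.1.2.1 else A.vert e.1.2.2

variable {A}

theorem edgeChr_neg_one (e : A.Edge) : A.edgeChr e (fun _ => -1) = A.vert e.1.2.1 := by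
  rw [edgeChr, dif_neg, if_pos]
  · norm_num
  · rw [mem_ball_zero_iff, norm_fin_one]
    norm_num

theorem edgeChr_one (e : A.Edge) : A.edgeChr e (fun _ => 1) = A.vert e.1.2.2 := by
  rw [edgeChr, dif_neg, if_neg]
  · norm_num
  · rw [mem_ball_zero_iff, norm_fin_one]
    norm_num

theorem edgeChr_of_mem (e : A.Edge) {y : Fin 1 → ℝ} (h : y ∈ ball (0 : Fin 1 → ℝ) 1) :
    A.edgeChr e y = ⟨1, A.edgeCell e, y, h⟩ := dif_pos h

theorem edge_eq_of_source {e e' : A.Edge} (hx : e.1.1 = e'.1.1) (h : e.1.2.1 = e'.1.2.1) :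
    e = e' := by
  obtain ⟨⟨x, v, w⟩, he⟩ := e
  obtain ⟨⟨x', v', w'⟩, he'⟩ := e'
  dsimp only at hx h he he'
  subst hx h
  obtain rfl := A.step_unique he he'
  rfl

theorem edge_eq_of_target {e e' : A.Edge} (hx : e.1.1 = e'.1.1) (h : e.1.2.2 = e'.1.2.2) :
    e = e' := by
  obtain ⟨⟨x, v, w⟩, he⟩ := e
  obtain ⟨⟨x', v', w'⟩, he'⟩ := e'
  dsimp only at hx h he he'
  subst hx h
  obtain rfl := A.step_injective he he'
  rfl

theorem edge_eq_of_edgeChr {e e' : A.Edge} (hx : e.1.1 = e'.1.1) {y : Fin 1 → ℝ}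
    (hy : y ∈ closedBall (0 : Fin 1 → ℝ) 1) (h : A.edgeChr e y = A.edgeChr e' y) : e = e' := by
  rw [← ball_union_sphere] at hy
  rcases hy with hy | hy
  · rw [edgeChr_of_mem e hy, edgeChr_of_mem e' hy] at h
    exact eq_of_heq (CellPoint.mk.inj h).2.1
  · rcases mem_sphere_fin_one.1 hy with rfl | rfl
    · rw [edgeChr_neg_one, edgeChr_neg_one] at h
      exact edge_eq_of_source hx (vert_injective h)
    · rw [edgeChr_one, edgeChr_one] at h
      exact edge_eq_of_target hx (vert_injective h)

theorem proj_vert (v : A.V) : B.charMap (A.base (A.vert v).cell) (A.vert v).pos = L.basePoint := rfl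

theorem proj_edgeChr (e : A.Edge) {y : Fin 1 → ℝ} (hy : y ∈ closedBall (0 : Fin 1 → ℝ) 1) :
    B.charMap (A.base (A.edgeChr e y).cell) (A.edgeChr e y).pos =
      B.charMap (L.edge e.1.1) y := by
  rw [← ball_union_sphere] at hy
  rcases hy with hy | hy
  · rw [edgeChr_of_mem e hy]
    rfl
  · rw [L.charMap_edge_of_sphere _ hy]
    rcases mem_sphere_fin_one.1 hy with rfl | rfl
    · rw [edgeChr_neg_one]
      exact proj_vert _
    · rw [edgeChr_one]
      exact proj_vert _

theorem edgeChr_dim_lt (e : A.Edge) (y : Fin 1 → ℝ) : (A.edgeChr e y).dim < 2 := by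
  unfold edgeChr
  split_ifs <;> simp [vert]

variable (A)

/-- The vertices of the boundary walk of a face. -/
noncomputable def walkVertex (c : A.Face) : ℕ → A.V := (A.walk c.2).choose

variable {A}

theorem walkVertex_zero (c : A.Face) : A.walkVertex c 0 = c.1.2 := (A.walk c.2).choose_spec.1

theorem walkVertex_length (c : A.Face) : A.walkVertex c (L.bl c.1.1).length = c.1.2 :=
  (A.walk c.2).choose_spec.2.1

theorem exists_walkEdge (c : A.Face) {i : ℕ} (hi : i < (L.bl c.1.1).length) :
    ∃ e : A.Edge, e.1.1 = ((L.bl c.1.1)[i]).1 ∧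
      A.edgeChr e (segment ((L.bl c.1.1)[i]).2 0) = A.vert (A.walkVertex c i) ∧
      A.edgeChr e (segment ((L.bl c.1.1)[i]).2 1) = A.vert (A.walkVertex c (i + 1)) := by
  have h := (A.walk c.2).choose_spec.2.2 i hi
  generalize (L.bl c.1.1)[i] = xs at *
  obtain ⟨x, s⟩ := xs
  cases s
  · refine ⟨⟨(x, _, _), by simpa using h⟩, rfl, ?_, ?_⟩
    · simp only [segment_false_zero, edgeChr_one]
      rfl
    · simp only [segment_false_one, edgeChr_neg_one]
      rfl
  · refine ⟨⟨(x, _, _), by simpa using h⟩, rfl, ?_, ?_⟩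
    · simp only [segment_true_zero, edgeChr_neg_one]
      rfl
    · simp only [segment_true_one, edgeChr_one]
      rfl

variable (A) in
/-- The edges of the boundary walk of a face. -/
noncomputable def walkEdge (c : A.Face) (i : ℕ) (hi : i < (L.bl c.1.1).length) : A.Edge :=
  (exists_walkEdge c hi).choose

theorem walkEdge_label (c : A.Face) {i : ℕ} (hi : i < (L.bl c.1.1).length) :
    (A.walkEdge c i hi).1.1 = ((L.bl c.1.1)[i]).1 := (exists_walkEdge c hi).choose_spec.1

theorem walkEdge_zero (c : A.Face) {i : ℕ} (hi : i < (L.bl c.1.1).length) :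
    A.edgeChr (A.walkEdge c i hi) (segment ((L.bl c.1.1)[i]).2 0) = A.vert (A.walkVertex c i) :=
  (exists_walkEdge c hi).choose_spec.2.1

theorem walkEdge_one (c : A.Face) {i : ℕ} (hi : i < (L.bl c.1.1).length) :
    A.edgeChr (A.walkEdge c i hi) (segment ((L.bl c.1.1)[i]).2 1) =
      A.vert (A.walkVertex c (i + 1)) :=
  (exists_walkEdge c hi).choose_spec.2.2

theorem exists_boundary (c : A.Face) : ∃ g : (Fin 2 → ℝ) → CellPoint A.cells,
    (∀ i (hi : i < (L.bl c.1.1).length), ∀ t ∈ Icc (0 : ℝ) 1,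
      g (L.circle c.1.1 ((i + t) / (L.bl c.1.1).length)) =
        A.edgeChr (A.walkEdge c i hi) (segment ((L.bl c.1.1)[i]).2 t)) ∧
      ((L.bl c.1.1).length = 0 → ∀ y, g y = A.vert c.1.2) := by
  obtain ⟨g, hg, hg'⟩ := L.exists_glue c.1.1 (k := (L.bl c.1.1).length)
    (fun i t => if hi : i < (L.bl c.1.1).length then
      A.edgeChr (A.walkEdge c i hi) (segment ((L.bl c.1.1)[i]).2 t) else A.vert c.1.2)
    (fun i => A.vert (A.walkVertex c i))
    (fun i hi => by rw [dif_pos hi, walkEdge_zero])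
    (fun i hi => by rw [dif_pos hi, walkEdge_one])
    (by rw [walkVertex_length, walkVertex_zero])
  refine ⟨g, fun i hi t ht => ?_, fun h y => ?_⟩
  · rw [hg i hi t ht, dif_pos hi]
  · rw [hg' h y, walkVertex_zero]

variable (A) in
/-- The attaching map of a face. -/
noncomputable def boundary (c : A.Face) : (Fin 2 → ℝ) → CellPoint A.cells :=
  (exists_boundary c).choose

theorem boundary_circle (c : A.Face) {i : ℕ} (hi : i < (L.bl c.1.1).length) {t : ℝ}
    (ht : t ∈ Icc (0 : ℝ) 1) : A.boundary c (L.circle c.1.1 ((i + t) / (L.bl c.1.1).length)) =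
      A.edgeChr (A.walkEdge c i hi) (segment ((L.bl c.1.1)[i]).2 t) :=
  (exists_boundary c).choose_spec.1 i hi t ht

theorem boundary_of_nil (c : A.Face) (h : (L.bl c.1.1).length = 0) (y : Fin 2 → ℝ) :
    A.boundary c y = A.vert c.1.2 :=
  (exists_boundary c).choose_spec.2 h y

theorem boundary_root (c : A.Face) : A.boundary c (L.circle c.1.1 0) = A.vert c.1.2 := by
  rcases Nat.eq_zero_or_pos (L.bl c.1.1).length with h | h
  · exact boundary_of_nil c h _
  · have := boundary_circle c h (t := 0) ⟨le_rfl, zero_le_one⟩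
    rw [walkEdge_zero, walkVertex_zero] at this
    simpa using this

variable (A)

open Classical in
/-- The attaching maps. -/
noncomputable def att : ∀ n, A.cells n → (Fin n → ℝ) → CellPoint A.cells
  -- A default value: in dimension `0` the unit sphere is empty.
  | 0, v, _ => A.vert v
  | 1, e, y => if y 0 < 0 then A.vert (show A.Edge from e).1.2.1
      else A.vert (show A.Edge from e).1.2.2
  | 2, c, y => A.boundary c y
  | _ + 3, c, _ => (show PEmpty from c).elim

variable {A}

theorem att_edge (e : A.Edge) {y : Fin 1 → ℝ} (hy : y ∈ sphere (0 : Fin 1 → ℝ) 1) :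
    A.att 1 (A.edgeCell e) y = A.edgeChr e y := by
  refine Eq.symm (dif_neg ?_)
  rw [mem_ball, not_lt, mem_sphere.1 hy]

theorem finite_sphere_fin_one : (sphere (0 : Fin 1 → ℝ) 1).Finite := by
  refine (finite_singleton (fun _ => 1 : Fin 1 → ℝ)).insert (fun _ => -1) |>.subset ?_
  exact fun y hy => mem_sphere_fin_one.1 hy

theorem not_mem_sphere_fin_zero (y : Fin 0 → ℝ) : y ∉ sphere (0 : Fin 0 → ℝ) 1 := by
  rw [Subsingleton.elim y 0, mem_sphere, dist_self]
  exact zero_ne_one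

theorem exists_boundary_param {ρ : P} (hk : 0 < (L.bl ρ).length) {y : Fin 2 → ℝ}
    (hy : y ∈ sphere (0 : Fin 2 → ℝ) 1) : ∃ i, i < (L.bl ρ).length ∧ ∃ t ∈ Icc (0 : ℝ) 1,
      y = L.circle ρ (((i : ℕ) + t) / (L.bl ρ).length) := by
  obtain ⟨s, hs, rfl⟩ := L.exists_circle_eq ρ hy
  obtain ⟨i, hi, t, ht, rfl⟩ := exists_div_eq hk hs
  exact ⟨i, hi, t, ht, rfl⟩

theorem boundary_dim_lt (c : A.Face) {y : Fin 2 → ℝ} (hy : y ∈ sphere (0 : Fin 2 → ℝ) 1) :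
    (A.boundary c y).dim < 2 := by
  rcases Nat.eq_zero_or_pos (L.bl c.1.1).length with hk | hk
  · rw [boundary_of_nil c hk]
    exact two_pos
  · obtain ⟨i, hi, t, ht, rfl⟩ := exists_boundary_param hk hy
    rw [boundary_circle c hi ht]
    exact edgeChr_dim_lt _ _

theorem proj_boundary (c : A.Face) {y : Fin 2 → ℝ} (hy : y ∈ sphere (0 : Fin 2 → ℝ) 1) :
    B.charMap (A.base (A.boundary c y).cell) (A.boundary c y).pos =
      B.charMap (L.face c.1.1) y := by
  rcases Nat.eq_zero_or_pos (L.bl c.1.1).length with hk | hk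
  · rw [boundary_of_nil c hk, L.boundary_nil _ (List.length_eq_zero_iff.1 hk) y hy]
    exact proj_vert _
  · obtain ⟨i, hi, t, ht, rfl⟩ := exists_boundary_param hk hy
    rw [boundary_circle c hi ht, proj_edgeChr _ (segment_mem ht), walkEdge_label]
    exact (L.charMap_circle c.1.1 ⟨i, hi⟩ ht).symm

/-- The set is a finite union of continuous images of compact sets of parameters, one for each edge
of the boundary walk. -/
theorem isClosed_boundary (c : A.Face) {S : Set (CellPoint A.cells)}
    (hS : ∀ e : A.Edge, IsClosed {y | y ∈ closedBall (0 : Fin 1 → ℝ) 1 ∧ A.edgeChr e y ∈ S}) :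
    IsClosed {y | y ∈ sphere (0 : Fin 2 → ℝ) 1 ∧ A.boundary c y ∈ S} := by
  rcases Nat.eq_zero_or_pos (L.bl c.1.1).length with hk | hk
  · simp only [boundary_of_nil c hk]
    exact isClosed_sphere.inter isClosed_const
  · have heq : {y | y ∈ sphere (0 : Fin 2 → ℝ) 1 ∧ A.boundary c y ∈ S} =
        ⋃ i : Fin (L.bl c.1.1).length,
          (fun t : ℝ => L.circle c.1.1 ((i + t) / (L.bl c.1.1).length)) ''
          (Icc 0 1 ∩ segment ((L.bl c.1.1)[i]).2 ⁻¹'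
            {y | y ∈ closedBall (0 : Fin 1 → ℝ) 1 ∧ A.edgeChr (A.walkEdge c i i.2) y ∈ S}) := by
      ext y
      simp only [mem_iUnion]
      constructor
      · rintro ⟨hy, hyS⟩
        obtain ⟨i, hi, t, ht, rfl⟩ := exists_boundary_param hk hy
        rw [boundary_circle c hi ht] at hyS
        exact ⟨⟨i, hi⟩, t, ⟨ht, segment_mem ht, hyS⟩, rfl⟩
      · rintro ⟨i, t, ⟨ht, -, hyS⟩, rfl⟩
        refine ⟨L.circle_mem _ (div_mem_Icc i.2 ht), ?_⟩
        change A.boundary c (L.circle c.1.1 _) ∈ S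
        rw [boundary_circle c i.2 ht]
        exact hyS
    rw [heq]
    refine isClosed_iUnion_of_finite fun i => ?_
    have hcl := isClosed_Icc (a := (0 : ℝ)) (b := 1) |>.inter
      ((hS (A.walkEdge c i i.2)).preimage (continuous_segment ((L.bl c.1.1)[i]).2))
    have hcpt := (isCompact_Icc (a := (0 : ℝ)) (b := 1)).of_isClosed_subset hcl inter_subset_left
    exact (hcpt.image_of_continuousOn
      ((continuousOn_circle_div c.1.1 i.2).mono inter_subset_left)).isClosed

/-- Two walks with the same label that meet at time `i` used the same edge just before, because
letters act injectively; going back step by step they have the same start. -/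
theorem walkVertex_eq_zero_of_eq {ρ : P} {v v' : A.V} {hc : A.face ρ v} {hc' : A.face ρ v'} {i : ℕ}
    (hi : i ≤ (L.bl ρ).length)
    (h : A.walkVertex ⟨(ρ, v), hc⟩ i = A.walkVertex ⟨(ρ, v'), hc'⟩ i) : v = v' := by
  induction i with
  | zero => rwa [walkVertex_zero, walkVertex_zero] at h
  | succ i ih =>
    have hi' : i < (L.bl ρ).length := hi
    refine ih hi'.le (vert_injective ?_)
    have h1 := walkEdge_one (A := A) ⟨(ρ, v), hc⟩ hi'
    have h2 := walkEdge_one (A := A) ⟨(ρ, v'), hc'⟩ hi'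
    rw [h, ← h2] at h1
    have h3 := edge_eq_of_edgeChr ((walkEdge_label (A := A) ⟨(ρ, v), hc⟩ hi').trans
      (walkEdge_label (A := A) ⟨(ρ, v'), hc'⟩ hi').symm) (segment_mem ⟨zero_le_one, le_rfl⟩) h1
    rw [← walkEdge_zero ⟨(ρ, v), hc⟩ hi', ← walkEdge_zero ⟨(ρ, v'), hc'⟩ hi', h3]

/-- A common boundary point lies on the same edge of both walks at the same index, so the walks
share a vertex there and hence their roots. -/
theorem face_eq_of_boundary {c c' : A.Face} (hρ : c.1.1 = c'.1.1) {y : Fin 2 → ℝ}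
    (hy : y ∈ sphere (0 : Fin 2 → ℝ) 1) (h : A.boundary c y = A.boundary c' y) : c = c' := by
  obtain ⟨⟨ρ, v⟩, hc⟩ := c
  obtain ⟨⟨ρ', v'⟩, hc'⟩ := c'
  dsimp only at hρ
  subst hρ
  have hv : v = v' := by
    rcases Nat.eq_zero_or_pos (L.bl ρ).length with hk | hk
    · rw [boundary_of_nil _ hk, boundary_of_nil _ hk] at h
      exact vert_injective h
    · obtain ⟨i, hi, t, ht, rfl⟩ := exists_boundary_param hk hy
      have h1 := (boundary_circle (A := A) ⟨(ρ, v), hc⟩ hi ht).symm.trans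
        (h.trans (boundary_circle (A := A) ⟨(ρ, v'), hc'⟩ hi ht))
      have h3 := edge_eq_of_edgeChr ((walkEdge_label (A := A) ⟨(ρ, v), hc⟩ hi).trans
        (walkEdge_label (A := A) ⟨(ρ, v'), hc'⟩ hi).symm) (segment_mem ht) h1
      refine walkVertex_eq_zero_of_eq (hc := hc) (hc' := hc') hi.le (vert_injective ?_)
      rw [← walkEdge_zero ⟨(ρ, v), hc⟩ hi, ← walkEdge_zero ⟨(ρ, v'), hc'⟩ hi, h3]
  subst hv
  rfl

theorem exists_sample (ρ : P) : ∃ Y : Set (Fin 2 → ℝ), Y.Finite ∧ Y ⊆ sphere 0 1 ∧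
    ∀ c : A.Face, c.1.1 = ρ → ∀ y ∈ sphere (0 : Fin 2 → ℝ) 1, ∃ y' ∈ Y,
      (A.boundary c y).carrier = (A.boundary c y').carrier := by
  have hh : (1 / 2 : ℝ) ∈ Ioo (0 : ℝ) 1 := by constructor <;> norm_num
  have hT : ({0, 1 / 2, 1} : Set ℝ) ⊆ Icc 0 1 := by
    rintro t (rfl | rfl | rfl)
    · exact ⟨le_rfl, zero_le_one⟩
    · exact Ioo_subset_Icc_self hh
    · exact ⟨zero_le_one, le_rfl⟩
  -- The endpoints and the midpoint of each segment meet every cell on the boundary, as the inside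
  -- of a segment stays in one open edge. The root is added for the empty word.
  refine ⟨insert (L.circle ρ 0) (⋃ i : Fin (L.bl ρ).length,
    (fun t : ℝ => L.circle ρ ((i + t) / (L.bl ρ).length)) '' {0, 1 / 2, 1}), ?_, ?_, ?_⟩
  · exact (finite_iUnion fun i => (toFinite _).image _).insert _
  · rintro y (rfl | hy)
    · exact L.circle_mem ρ ⟨le_rfl, zero_le_one⟩
    · obtain ⟨i, t, ht, rfl⟩ := mem_iUnion.1 hy
      exact L.circle_mem ρ (div_mem_Icc i.2 (hT ht))
  · rintro c rfl y hy
    rcases Nat.eq_zero_or_pos (L.bl c.1.1).length with hk | hk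
    · exact ⟨_, mem_insert _ _, by rw [boundary_of_nil c hk, boundary_of_nil c hk]⟩
    · obtain ⟨i, hi, t, ht, rfl⟩ := exists_boundary_param hk hy
      have hmem : ∀ t ∈ ({0, 1 / 2, 1} : Set ℝ), L.circle c.1.1 ((i + t) / (L.bl c.1.1).length) ∈
          insert (L.circle c.1.1 0) (⋃ i : Fin (L.bl c.1.1).length,
          (fun t : ℝ => L.circle c.1.1 ((i + t) / (L.bl c.1.1).length)) '' {0, 1 / 2, 1}) :=
        fun t ht => Or.inr (mem_iUnion.2 ⟨⟨i, hi⟩, t, ht, rfl⟩)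
      by_cases ht' : t ∈ Ioo (0 : ℝ) 1
      · refine ⟨_, hmem (1 / 2) (by simp), ?_⟩
        rw [boundary_circle c hi ht, boundary_circle c hi (Ioo_subset_Icc_self hh),
          edgeChr_of_mem _ (segment_mem_ball ht'), edgeChr_of_mem _ (segment_mem_ball hh)]
        rfl
      · have : t = 0 ∨ t = 1 := by
          by_contra hne
          push Not at hne
          exact ht' ⟨lt_of_le_of_ne ht.1 (Ne.symm hne.1), lt_of_le_of_ne ht.2 hne.2⟩
        exact ⟨_, hmem t (by rcases this with rfl | rfl <;> simp), rfl⟩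

variable (A)

/-- The lifted cells and attaching maps. -/
noncomputable def cellLift : CellLift B where
  J := A.cells
  base := A.base
  att := A.att
  att_dim {n} c y hy := by
    match n, c, y, hy with
    | 0, _, y, hy => exact absurd hy (not_mem_sphere_fin_zero y)
    | 1, e, y, hy =>
      change CellPoint.dim (if y 0 < 0 then _ else _) < 1
      split_ifs <;> exact one_pos
    | 2, c, y, hy => exact boundary_dim_lt (A := A) c hy
    | _ + 3, c, _, _ => exact (show PEmpty from c).elim
  att_map {n} c y hy := by
    match n, c, y, hy with
    | 0, _, y, hy => exact absurd hy (not_mem_sphere_fin_zero y)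
    | 1, e, y, hy =>
      have h := proj_edgeChr (A := A) e (sphere_subset_closedBall hy)
      rw [← att_edge e hy] at h
      exact h
    | 2, c, y, hy => exact proj_boundary (A := A) c hy
    | _ + 3, c, _, _ => exact (show PEmpty from c).elim
  att_closed {n} c S hS := by
    match n, c, hS with
    | 0, _, _ =>
      convert isClosed_empty using 1
      exact eq_empty_of_forall_notMem fun y hy => not_mem_sphere_fin_zero y hy.1
    | 1, e, _ => exact (finite_sphere_fin_one.subset fun y hy => hy.1).isClosed
    | 2, c, hS => exact isClosed_boundary (A := A) c fun e => hS 1 one_lt_two e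
    | _ + 3, c, _ => exact (show PEmpty from c).elim
  att_inj {n} c c' hb y hy h := by
    match n, c, c', hb, y, hy, h with
    | 0, _, _, _, y, hy, _ => exact absurd hy (not_mem_sphere_fin_zero y)
    | 1, e, e', hb, y, hy, h =>
      have h' : A.att 1 (A.edgeCell e) y = A.att 1 (A.edgeCell e') y := h
      rw [att_edge e hy, att_edge e' hy] at h'
      exact edge_eq_of_edgeChr (A := A) (L.edge.injective hb) (sphere_subset_closedBall hy) h'
    | 2, c, c', hb, y, hy, h => exact face_eq_of_boundary (A := A) (L.face.injective hb) hy h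
    | _ + 3, c, _, _, _, _, _ => exact (show PEmpty from c).elim
  att_sample {n} b := by
    match n, b with
    | 0, _ => exact ⟨∅, finite_empty, empty_subset _, fun _ _ y hy =>
        absurd hy (not_mem_sphere_fin_zero y)⟩
    | 1, _ => exact ⟨_, finite_sphere_fin_one, Subset.rfl, fun _ _ y hy => ⟨y, hy, rfl⟩⟩
    | 2, b =>
      obtain ⟨Y, h1, h2, h3⟩ := exists_sample (A := A) (L.face.symm b)
      refine ⟨Y, h1, h2, fun c hc => h3 c ?_⟩
      rw [← hc]
      exact (L.face.symm_apply_apply _).symm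
    | _ + 3, _ => exact ⟨∅, finite_empty, empty_subset _, fun c => (show PEmpty from c).elim⟩

theorem isEmpty_cells (n : ℕ) (hn : 2 < n) : IsEmpty (A.cellLift.J n) := by
  obtain ⟨m, rfl⟩ : ∃ m, n = m + 3 := ⟨n - 3, by omega⟩
  exact inferInstanceAs (IsEmpty PEmpty)

variable {A}

theorem chr_edge_neg_one (e : A.Edge) :
    A.cellLift.chr (n := 1) (A.edgeCell e) (fun _ => -1) = A.vert e.1.2.1 := edgeChr_neg_one e

theorem chr_edge_one (e : A.Edge) :
    A.cellLift.chr (n := 1) (A.edgeCell e) (fun _ => 1) = A.vert e.1.2.2 := edgeChr_one e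

theorem chr_face_root (c : A.Face) :
    A.cellLift.chr (n := 2) (A.faceCell c) (L.circle c.1.1 0) = A.vert c.1.2 :=
  (CellLift.chr_of_sphere (L.circle_mem c.1.1 ⟨le_rfl, zero_le_one⟩)).trans (boundary_root c)

theorem chr_vertex (v : A.V) (y : Fin 0 → ℝ) :
    A.cellLift.chr (n := 0) (show A.cells 0 from v) y = A.vert v := by
  rw [Subsingleton.elim y 0]
  exact CellLift.chr_of_mem _

/-- Each closed cell is connected and contains a vertex, and edges join the vertices that the action
relates. -/
theorem connectedSpace (hne : Nonempty A.V)
    (hconn : ∀ v w : A.V, Relation.EqvGen (fun a b => ∃ x, A.step x a b) v w) :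
    ConnectedSpace A.cellLift.Pt := by
  obtain ⟨v₀⟩ := hne
  have hpre : ∀ (n : ℕ) (c : A.cellLift.J n),
      IsPreconnected (A.cellLift.chr c '' closedBall 0 1) := fun n c =>
    (convex_closedBall 0 1).isPreconnected.image _ (CellLift.continuousOn_chr c)
  have hV : ∀ v w : A.V, connectedComponent (α := A.cellLift.Pt) (A.vert v) =
      connectedComponent (α := A.cellLift.Pt) (A.vert w) := by
    intro v w
    induction hconn v w with
    | rel a b h =>
      obtain ⟨x, h⟩ := h
      let e : A.Edge := ⟨(x, a, b), h⟩
      refine connectedComponent_eq ?_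
      exact (hpre 1 (A.edgeCell e)).subset_connectedComponent
        ⟨_, neg_one_mem_closedBall, chr_edge_neg_one e⟩ ⟨_, one_mem_closedBall, chr_edge_one e⟩
    | refl a => rfl
    | symm _ _ _ ih => exact ih.symm
    | trans _ _ _ _ _ ih1 ih2 => exact ih1.trans ih2
  have hall : ∀ p : A.cellLift.Pt, p ∈ connectedComponent (α := A.cellLift.Pt) (A.vert v₀) := by
    intro p
    obtain ⟨n, c, y, hy, rfl⟩ := CellLift.exists_chr_eq p
    have hy' := ball_subset_closedBall hy
    have : ∃ (v : A.V), ∃ z ∈ closedBall (0 : Fin n → ℝ) 1, A.cellLift.chr c z = A.vert v := by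
      match n, c with
      | 0, v => exact ⟨v, 0, mem_closedBall_self zero_le_one, chr_vertex v 0⟩
      | 1, e => exact ⟨_, _, neg_one_mem_closedBall, chr_edge_neg_one e⟩
      | 2, c => exact ⟨_, _, L.circle_mem_closedBall _ ⟨le_rfl, zero_le_one⟩, chr_face_root c⟩
      | _ + 3, c => exact (show PEmpty from c).elim
    obtain ⟨v, z, hz, hzv⟩ := this
    rw [hV v₀ v]
    exact (hpre n c).subset_connectedComponent ⟨z, hz, hzv⟩ ⟨y, hy', rfl⟩
  refine { toPreconnectedSpace := ?_, toNonempty := ⟨A.vert v₀⟩ }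
  refine preconnectedSpace_iff_connectedComponent.2 fun p => ?_
  rw [← connectedComponent_eq (hall p)]
  exact eq_univ_of_forall hall

end PartialAction

end BouquetLabeling

/-! ### The labeled graph of a partial action and the action on cosets -/

namespace BouquetLabeling

open MXP InverseMonoid

variable {X P : Type u} {B : TwoComplex.{u}} {L : BouquetLabeling X P B}

namespace PartialAction

variable (A : L.PartialAction) [ConnectedSpace A.cellLift.Pt]

/-- The complex of a partial action. -/
noncomputable def complex : TwoComplex.{u} := A.cellLift.toTwoComplex A.isEmpty_cells

/-- The immersion of the complex of a partial action. -/
noncomputable def immersion : A.complex → B := A.cellLift.proj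

theorem isImmersion : IsImmersion A.complex B A.immersion :=
  CellLift.isImmersion_proj A.isEmpty_cells

/-- A point of the action as a vertex of the complex. -/
def vertex (v : A.V) : A.complex.Cell 0 := v

variable {A}

theorem point_vertex (v : A.V) : A.complex.point (A.vertex v) = A.vert v := chr_vertex v 0

theorem isEdge_cell (e : A.Edge) : L.IsEdge (C := A.complex) A.immersion (A.edgeCell e) e.1.1
    (A.vertex e.1.2.1) (A.vertex e.1.2.2) :=
  ⟨_, CellLift.isLiftedCharMap_chr A.isEmpty_cells (n := 1) (A.edgeCell e),
    (chr_edge_neg_one e).trans (point_vertex _).symm, (chr_edge_one e).trans (point_vertex _).symm⟩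

theorem isFace_cell (c : A.Face) : L.IsFace (C := A.complex) A.immersion (A.faceCell c) c.1.1
    (A.vertex c.1.2) :=
  ⟨_, CellLift.isLiftedCharMap_chr A.isEmpty_cells (n := 2) (A.faceCell c),
    (chr_face_root c).trans (point_vertex _).symm⟩

theorem step_of_isEdge {e : A.Edge} {x : X} {v w : A.V}
    (h : L.IsEdge (C := A.complex) A.immersion (A.edgeCell e) x (A.vertex v) (A.vertex w)) :
    A.step x v w := by
  obtain ⟨rfl, h1, h2⟩ := h.eq_of_cell A.isImmersion (isEdge_cell (A := A) e)
  have h1' : v = e.1.2.1 := h1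
  have h2' : w = e.1.2.2 := h2
  rw [h1', h2']
  exact e.2

theorem exists_isEdge_iff {x : X} {v w : A.V} :
    (∃ e, L.IsEdge (C := A.complex) A.immersion e x (A.vertex v) (A.vertex w)) ↔ A.step x v w :=
  ⟨fun ⟨e, he⟩ => step_of_isEdge (e := (e : A.Edge)) he,
    fun h => ⟨_, isEdge_cell ⟨(x, v, w), h⟩⟩⟩

theorem face_of_isFace {c : A.Face} {ρ : P} {v : A.V}
    (h : L.IsFace (C := A.complex) A.immersion (A.faceCell c) ρ (A.vertex v)) : A.face ρ v := by
  obtain ⟨rfl, h1⟩ := h.eq_of_cell A.isImmersion (isFace_cell (A := A) c)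
  have h1' : v = c.1.2 := h1
  rw [h1']
  exact c.2

theorem exists_isFace_iff {ρ : P} {v : A.V} :
    (∃ c, L.IsFace (C := A.complex) A.immersion c ρ (A.vertex v)) ↔ A.face ρ v :=
  ⟨fun ⟨c, hc⟩ => face_of_isFace (c := (c : A.Face)) hc,
    fun h => ⟨_, isFace_cell ⟨(ρ, v), h⟩⟩⟩

end PartialAction

/-! ### The coset complex -/

section Coset

variable {H : Set (MXP L.bl)}

theorem acts_of_true_iff {a : X ⊕ P} {Y Z : RightCoset H} :
    Y.Acts (ofWord L.bl (FreeMonoid.of (a, true))) Z ↔ Y.Acts (ofWord L.bl (letter a)) Z := Iff.rfl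

theorem ofWord_letter_idem (ρ : P) : ofWord L.bl (letter (Sum.inr ρ)) *
    ofWord L.bl (letter (Sum.inr ρ)) = ofWord L.bl (letter (Sum.inr ρ)) := by
  rw [← map_mul]
  exact ofWord_rel _ (Rel.idem ρ)

variable (hH : IsClosedInverseSubmonoid H)
include hH

theorem acts_of_false_iff {a : X ⊕ P} {Y Z : RightCoset H} :
    Y.Acts (ofWord L.bl (FreeMonoid.of (a, false))) Z ↔ Z.Acts (ofWord L.bl (letter a)) Y := by
  have h : ofWord L.bl (FreeMonoid.of (a, false)) = (ofWord L.bl (letter a))⁻¹ := rfl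
  rw [h]
  refine ⟨fun h => ?_, fun h => h.inv hH⟩
  have := h.inv hH
  rwa [inv_inv'] at this

theorem acts_face_eq {ρ : P} {Y Z : RightCoset H}
    (h : Y.Acts (ofWord L.bl (letter (Sum.inr ρ))) Z) : Z = Y :=
  h.eq_of_idem hH (ofWord_letter_idem ρ)

/-- The relation `ρ ≤ bl(ρ)` enters here: the action is monotone, so `bl(ρ)` fixes every coset fixed
by `ρ`. This is what allows the face to be attached. -/
theorem acts_boundary {ρ : P} {Y : RightCoset H}
    (h : Y.Acts (ofWord L.bl (letter (Sum.inr ρ))) Y) :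
    Y.Acts (ofWord L.bl (wordOfX (L.bl ρ))) Y := by
  refine h.mono hH ⟨_, ofWord_letter_idem ρ, ?_⟩
  rw [← map_mul]
  exact ofWord_rel _ (Rel.bound ρ)

theorem exists_walk_of_acts (l : List (X × Bool)) {Y Z : RightCoset H}
    (h : Y.Acts (ofWord L.bl (wordOfX l)) Z) : ∃ vs : ℕ → RightCoset H, vs 0 = Y ∧
      vs l.length = Z ∧ ∀ i (hi : i < l.length),
        if (l[i]).2 then (vs i).Acts (ofWord L.bl (letter (Sum.inl (l[i]).1))) (vs (i + 1))
        else (vs (i + 1)).Acts (ofWord L.bl (letter (Sum.inl (l[i]).1))) (vs i) := by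
  induction l generalizing Y with
  | nil => exact ⟨fun _ => Y, rfl, (RightCoset.acts_one hH Y).unique h, fun i hi => by simp at hi⟩
  | cons a l ih =>
    have hw : ofWord L.bl (wordOfX (a :: l)) =
        ofWord L.bl (FreeMonoid.of (Sum.inl a.1, a.2)) * ofWord L.bl (wordOfX l) := by
      rw [← map_mul]
      rfl
    rw [hw, RightCoset.acts_mul_iff hH] at h
    obtain ⟨W, h1, h2⟩ := h
    obtain ⟨vs, h3, h4, h5⟩ := ih h2
    refine ⟨fun i => Nat.casesOn i Y vs, rfl, h4, fun i hi => ?_⟩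
    cases i with
    | zero =>
      obtain ⟨x, s⟩ := a
      change if s = true then Y.Acts _ (vs 0) else (vs 0).Acts _ Y
      rw [h3]
      cases s
      · exact (acts_of_false_iff hH).1 h1
      · exact h1
    | succ i => exact h5 i (Nat.lt_of_succ_lt_succ hi)

/-- The partial action of the letters on the `ω`-cosets. -/
def cosetAction : L.PartialAction where
  V := RightCoset H
  step x Y Z := Y.Acts (ofWord L.bl (letter (Sum.inl x))) Z
  step_unique h h' := h.unique h'
  step_injective h h' := h.injective hH h'
  face ρ Y := Y.Acts (ofWord L.bl (letter (Sum.inr ρ))) Y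
  walk h := exists_walk_of_acts hH _ (acts_boundary hH h)

/-- Letters in `P` act as partial identities, so steps by letters in `X` already connect everything
that the action of a word connects. -/
theorem eqvGen_of_acts (w : Word X P) {Y Z : RightCoset H} (h : Y.Acts (ofWord L.bl w) Z) :
    Relation.EqvGen (fun a b => ∃ x, (cosetAction hH).step x a b) Y Z := by
  induction w using FreeMonoid.recOn generalizing Y with
  | one =>
    rw [map_one] at h
    rw [(RightCoset.acts_one hH Y).unique h]
    exact .refl _
  | of_mul a w ih =>
    rw [map_mul, RightCoset.acts_mul_iff hH] at h
    obtain ⟨W, h1, h2⟩ := h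
    refine .trans _ W _ ?_ (ih h2)
    obtain ⟨a | ρ, s⟩ := a <;> cases s
    · exact .symm _ _ (.rel _ _ ⟨a, (acts_of_false_iff hH).1 h1⟩)
    · exact .rel _ _ ⟨a, h1⟩
    · rw [acts_face_eq hH ((acts_of_false_iff hH).1 h1)]
      exact .refl _
    · rw [acts_face_eq hH h1]
      exact .refl _

theorem connectedSpace_coset : ConnectedSpace (cosetAction hH).cellLift.Pt := by
  have hbase : ∀ Y, Relation.EqvGen (fun a b => ∃ x, (cosetAction hH).step x a b)
      (RightCoset.base hH) Y := by
    intro Y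
    obtain ⟨m, hm⟩ := RightCoset.exists_base_acts hH Y
    obtain ⟨w, rfl⟩ := ofWord_surjective L.bl m
    exact eqvGen_of_acts hH w hm
  exact PartialAction.connectedSpace ⟨RightCoset.base hH⟩ fun v w =>
    .trans _ _ _ (.symm _ _ (hbase v)) (hbase w)

omit hH in
theorem gammaEdge_exists_iff {C : TwoComplex.{u}} {f : C → B} {a : X ⊕ P} {v w : L.Gamma f} :
    (∃ e : L.GammaEdge f v w, e.label = a) ↔
      (∃ x, a = Sum.inl x ∧ ∃ e, L.IsEdge f e x v w) ∨
      (∃ ρ, a = Sum.inr ρ ∧ v = w ∧ ∃ c, L.IsFace f c ρ v) := by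
  constructor
  · rintro ⟨e, rfl⟩
    cases e with
    | ofEdge e x h => exact Or.inl ⟨x, rfl, e, h⟩
    | ofFace c ρ h => exact Or.inr ⟨ρ, rfl, rfl, c, h⟩
  · rintro (⟨x, rfl, e, h⟩ | ⟨ρ, rfl, rfl, c, h⟩)
    · exact ⟨.ofEdge e x h, rfl⟩
    · exact ⟨.ofFace c ρ h, rfl⟩

variable [ConnectedSpace (cosetAction hH).cellLift.Pt]

/-- The vertices of the coset complex are the cosets. -/
def cosetVertexEquiv :
    L.Gamma (C := (cosetAction hH).complex) (cosetAction hH).immersion ≃ RightCoset H :=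
  Equiv.refl _

theorem exists_label_iff {a : X ⊕ P}
    {v w : L.Gamma (C := (cosetAction hH).complex) (cosetAction hH).immersion} :
    (∃ e : L.GammaEdge _ v w, e.label = a) ↔
      (cosetVertexEquiv hH v).Acts (ofWord L.bl (letter a)) (cosetVertexEquiv hH w) := by
  rw [gammaEdge_exists_iff]
  constructor
  · rintro (⟨x, rfl, h⟩ | ⟨ρ, rfl, rfl, h⟩)
    · exact (PartialAction.exists_isEdge_iff (A := cosetAction hH)).1 h
    · exact (PartialAction.exists_isFace_iff (A := cosetAction hH)).1 h
  · intro h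
    rcases a with x | ρ
    · exact Or.inl ⟨x, rfl, (PartialAction.exists_isEdge_iff (A := cosetAction hH)).2 h⟩
    · have heq := acts_face_eq hH h
      rw [heq] at h
      exact Or.inr ⟨ρ, rfl, heq.symm,
        (PartialAction.exists_isFace_iff (A := cosetAction hH)).2 h⟩

/-- The labeled graph of the coset complex is the coset graph. -/
noncomputable def cosetComplexIso :
    L.CosetComplexIso (C := (cosetAction hH).complex) (cosetAction hH).immersion H where
  vertexEquiv := cosetVertexEquiv hH
  edgeEquiv v w := Equiv.ofBijective
    -- An edge with given ends is determined by its label, by determinism of the immersion; every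
    -- label that acts between the two cosets occurs.
    (fun e => ⟨e.label, (exists_label_iff hH).1 ⟨e, rfl⟩⟩) ⟨fun e e' h =>
      eq_of_heq (e.source_unique (cosetAction hH).isImmersion e' (congrArg Subtype.val h)).2,
      fun a => by
        obtain ⟨e, he⟩ := (exists_label_iff hH).2 a.2
        exact ⟨e, Subtype.ext he⟩⟩
  label_eq _ _ _ := rfl

theorem exists_arrow_iff {a : (X ⊕ P) × Bool}
    {v w : L.Gamma (C := (cosetAction hH).complex) (cosetAction hH).immersion} :
    (∃ e : v ⟶ w, arrowLabel e = a) ↔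
      (cosetVertexEquiv hH v).Acts (ofWord L.bl (FreeMonoid.of a)) (cosetVertexEquiv hH w) := by
  obtain ⟨a, s⟩ := a
  cases s
  · rw [acts_of_false_iff hH, ← exists_label_iff hH]
    constructor
    · rintro ⟨e | e, he⟩
      · cases (Prod.ext_iff.1 he).2
      · exact ⟨e, (Prod.ext_iff.1 he).1⟩
    · rintro ⟨e, rfl⟩
      exact ⟨Sum.inr e, rfl⟩
  · rw [acts_of_true_iff, ← exists_label_iff hH]
    constructor
    · rintro ⟨e | e, he⟩
      · exact ⟨e, (Prod.ext_iff.1 he).1⟩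
      · cases (Prod.ext_iff.1 he).2
    · rintro ⟨e, rfl⟩
      exact ⟨Sum.inl e, rfl⟩

/-- The action of a word splits letter by letter, and each letter acts exactly along the arrows of
the graph. -/
theorem exists_pathWord_iff {u : Word X P}
    {v w : L.Gamma (C := (cosetAction hH).complex) (cosetAction hH).immersion} :
    (∃ p : L.GPath _ v w, L.pathWord _ p = u) ↔
      (cosetVertexEquiv hH v).Acts (ofWord L.bl u) (cosetVertexEquiv hH w) := by
  constructor
  · rintro ⟨p, rfl⟩
    induction p with
    | nil => exact RightCoset.acts_one hH _
    | cons p e ih =>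
      rw [pathWord_cons, map_mul, RightCoset.acts_mul_iff hH]
      exact ⟨_, ih, (exists_arrow_iff hH).1 ⟨e, rfl⟩⟩
  · intro h
    induction u using FreeMonoid.recOn generalizing v with
    | one =>
      rw [map_one] at h
      obtain rfl := (cosetVertexEquiv hH).injective ((RightCoset.acts_one hH _).unique h)
      exact ⟨.nil, rfl⟩
    | of_mul a u ih =>
      rw [map_mul, RightCoset.acts_mul_iff hH] at h
      obtain ⟨W, h1, h2⟩ := h
      obtain ⟨W, rfl⟩ := (cosetVertexEquiv hH).surjective W
      obtain ⟨e, rfl⟩ := (exists_arrow_iff hH).2 h1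
      obtain ⟨p, rfl⟩ := ih h2
      refine ⟨(Quiver.Path.nil.cons e).comp p, ?_⟩
      rw [pathWord_comp, pathWord_cons, pathWord_nil, one_mul]

/-- Closed paths at the base vertex labeled `u` exist exactly when `u` fixes the base coset, that
is, when `u` represents an element of `H`. -/
theorem loopSet_coset : L.loopSet (C := (cosetAction hH).complex) (cosetAction hH).immersion
    ((cosetVertexEquiv hH).symm (RightCoset.base hH)) = H := by
  ext m
  obtain ⟨u, rfl⟩ := ofWord_surjective L.bl m
  rw [← RightCoset.base_acts_base_iff hH, mem_loopSet]
  have h := exists_pathWord_iff hH (u := u)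
    (v := (cosetVertexEquiv hH).symm (RightCoset.base hH))
    (w := (cosetVertexEquiv hH).symm (RightCoset.base hH))
  rw [Equiv.apply_symm_apply] at h
  rw [← h]
  constructor
  · exact fun h => h.exists_path (cosetAction hH).isImmersion
  · rintro ⟨p, rfl⟩
    exact ⟨p, rfl⟩

end Coset

end BouquetLabeling

theorem mainTheorem1 {X P : Type u} (B : TwoComplex.{u}) (L : BouquetLabeling X P B) :
    -- Loop monoids of a complex immersing into `B`.
    (∀ (C : TwoComplex.{u}) (f : C → B), IsImmersion C B f →
      (∀ p : L.Gamma f, Function.Injective (L.loopLabel f p) ∧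
        InverseMonoid.IsClosedInverseSubmonoid (L.loopSet f p)) ∧
      InverseMonoid.IsConjugacyClass (Set.range fun p : L.Gamma f => L.loopSet f p)) ∧
    (∀ H : Set (MXP L.bl), InverseMonoid.IsClosedInverseSubmonoid H →
      -- Existence: the coset complex immerses into `B` and has loop monoid `H` at the vertex `H`.
      (∃ (C : TwoComplex.{u}) (f : C → B), IsImmersion C B f ∧
        ∃ (i : L.CosetComplexIso f H) (p : L.Gamma f),
          (i.vertexEquiv p).1 = H ∧ L.loopSet f p = H) ∧
      -- Uniqueness of the complex up to isomorphism and of the immersion up to equivalence.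
      (∀ (C C' : TwoComplex.{u}) (f : C → B) (f' : C' → B),
        IsImmersion C B f → IsImmersion C' B f' →
        (∃ p : L.Gamma f, L.loopSet f p = H) → (∃ p' : L.Gamma f', L.loopSet f' p' = H) →
        ∃ φ : C ≃ₜ C', IsCellularIso φ ∧ f' ∘ φ = f)) := by
  refine ⟨fun C f hf => ⟨fun p => ⟨BouquetLabeling.loopLabel_injective hf p,
    BouquetLabeling.isClosedInverseSubmonoid_loopSet hf p⟩,
    BouquetLabeling.isConjugacyClass_loopSet hf⟩, fun H hH => ⟨?_, ?_⟩⟩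
  · have := BouquetLabeling.connectedSpace_coset hH
    exact ⟨_, _, (BouquetLabeling.cosetAction hH).isImmersion,
      BouquetLabeling.cosetComplexIso hH, _, rfl, BouquetLabeling.loopSet_coset hH⟩
  · rintro C C' f f' hf hf' ⟨p, hp⟩ ⟨p', hp'⟩
    exact BouquetLabeling.exists_homeomorph_of_loopSet hf hf' (hp.trans hp'.symm)
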